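/- Let $\mathbb T^2=[0,2\pi]^2$ with periodic boundary conditions, let $\mathbb Z^2_*=\mathbb Z^2\setminus\{0\}$, and write $\widehat f(k)=(2\pi)^{-2}\int_{\mathbb T^2}f(x)e^{-ik\cdot x}\,dx$. Fix $r>3$. For $s\ge 1$ and $\tau>0$ let $G^s_\tau$ be the space of real-valued, mean-free functions $f\in C^\infty(\mathbb T^2)$ with $$\|f\|_{G^s_\tau}=\Big(\sum_{k\in\mathbb Z^2_*}|k|^{2r}e^{2\tau|k|^{1/s}}|\widehat f(k)|^2\Big)^{1/2}<\infty,$$ and let $G^s=\bigcup_{\tau>0}G^s_\tau$. For $\alpha\ge 0$ consider the (singular) incompressible porous media equation $$\partial_t\theta+u\cdot\nabla\theta=0,\qquad u=(-\Delta)^{\alpha/2}\mathbf I\theta,\qquad \theta(\cdot,0)=\theta_0\qquad\text{on }\mathbb T^2, \tag{$*$}$$ where $(-\Delta)^{\alpha/2}\mathbf I$ is the Fourier multiplier operator with symbol $|k|^{\alpha}\,\widehat{\mathbf I}(k)$, $\widehat{\mathbf I}(k)=\Big(\frac{-k_1k_2}{k_1^2+k_2^2},\frac{k_1^2}{k_1^2+k_2^2}\Big)$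 for $k\in\mathbb Z^2_*$, and $\widehat{\mathbf I}(0)=0$. A solution of $(*)$ in $G^s$ on $[0,T)$ is a real-valued function $\theta$ on $\mathbb T^2\times[0,T)$ that satisfies $(*)$ pointwise (with a one-sided time derivative at $t=0$) and is such that for every $T'<T$ there is $\tau>0$ with $\theta(\cdot,t)\in G^s_\tau$ for all $t\in[0,T']$ and $\sup_{0\le t\le T'}\|\theta(\cdot,t)\|_{G^s_\tau}<\infty$. **Theorem.** Let either $\alpha\in(0,1]$ and $s\in[1,\frac1\alpha]$, or $\alpha=0$ and $s\ge 1$. Then for all $K_0>0$ and $\tau_0>0$ there is a time $T_*=T_*(\tau_0,K_0)>0$ (which may also depend on $r$, $\alpha$ and $s$) such that for every $\theta_0\in G^s_{\tau_0}$ with $$\|(-\Delta)^{r/2}e^{\tau_0(-\Delta)^{1/(2s)}}\theta_0\|_{L^2}=\|\theta_0\|_{G^s_{\tau_0}}\le K_0$$ there exists a unique solution of $(*)$ in $G^s$ on $[0,T_*)$. -/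

import Mathlib

open scoped ENNReal ContDiff

noncomputable section

namespace SIPM

/-- Points of the plane; functions on the torus `[0,2π]²` are functions on the plane that are
`2π`-periodic in each variable. -/
abbrev Plane : Type := Fin 2 → ℝ

/-- Frequencies, i.e. elements of `ℤ²`. -/
abbrev Freq : Type := Fin 2 → ℤ

/-- The Euclidean length `|k|` of a frequency. -/
def freqNorm (k : Freq) : ℝ := Real.sqrt ((k 0 : ℝ) ^ 2 + (k 1 : ℝ) ^ 2)

/-- The character `x ↦ exp (i k·x)`. -/
def character (k : Freq) (x : Plane) : ℂ :=
  Complex.exp (Complex.I * (((k 0 : ℝ) * x 0 + (k 1 : ℝ) * x 1 : ℝ) : ℂ))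

/-- `f` is `2π`-periodic in each of the two variables. -/
def IsPeriodic (f : Plane → ℝ) : Prop :=
  ∀ (j : Fin 2) (x : Plane), f (x + Pi.single j (2 * Real.pi)) = f x

/-- The Fourier coefficient `(2π)⁻² ∫_{[0,2π]²} f(x) exp (-i k·x) dx`. -/
def fourierCoef (f : Plane → ℝ) (k : Freq) : ℂ :=
  ((((2 * Real.pi) ^ 2)⁻¹ : ℝ) : ℂ) *
    ∫ x in Set.Icc (0 : Plane) (fun _ => 2 * Real.pi), (f x : ℂ) * character (-k) x

/-- The Fourier multiplier operator with symbol `m`. -/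
def fourierMultiplier (m : Freq → ℝ) (f : Plane → ℝ) (x : Plane) : ℂ :=
  ∑' k : Freq, (m k : ℂ) * fourierCoef f k * character k x

/-- The symbol of the operator `I = (I₁, I₂)` of the incompressible porous media equation:
`I₁(k) = -k₁k₂/|k|²` and `I₂(k) = k₁²/|k|²` for `k ≠ 0`, and `I(0) = 0`. -/
def ipmSymbol (j : Fin 2) (k : Freq) : ℝ :=
  if k = 0 then 0
  else ![-((k 0 : ℝ) * (k 1 : ℝ)), (k 0 : ℝ) ^ 2] j / ((k 0 : ℝ) ^ 2 + (k 1 : ℝ) ^ 2)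

/-- The `j`-th component of the velocity `u = (-Δ)^{α/2} I θ`, where `(-Δ)^{α/2}` has the symbol
`|k|^α`. -/
def velocity (α : ℝ) (θ : Plane → ℝ) (j : Fin 2) (x : Plane) : ℂ :=
  fourierMultiplier (fun k => freqNorm k ^ α * ipmSymbol j k) θ x

/-- The partial derivative of `f` in the `j`-th variable. -/
def partialDeriv (j : Fin 2) (f : Plane → ℝ) (x : Plane) : ℝ :=
  fderiv ℝ f x (Pi.single j 1)

/-- The norm `‖(-Δ)^{r/2} e^{τ(-Δ)^{1/(2s)}} f‖`, with values in `[0,∞]`, that is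
`(∑_{k ≠ 0} |k|^{2r} e^{2τ|k|^{1/s}} |f̂(k)|²)^{1/2}`. -/
def gevreyNorm (r s τ : ℝ) (f : Plane → ℝ) : ℝ≥0∞ :=
  (∑' k : {k : Freq // k ≠ 0},
    ENNReal.ofReal (freqNorm k.1 ^ (2 * r) * Real.exp (2 * τ * freqNorm k.1 ^ (1 / s)) *
      ‖fourierCoef f k.1‖ ^ 2)) ^ (1 / 2 : ℝ)

/-- The space `G^s_τ` of smooth mean-free functions on the torus with finite norm. The Gevrey
class `G^s` is the union of the spaces `G^s_τ` over `τ > 0`. -/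
structure MemGevrey (r s τ : ℝ) (f : Plane → ℝ) : Prop where
  smooth : ContDiff ℝ ∞ f
  periodic : IsPeriodic f
  mean_zero : ∫ x in Set.Icc (0 : Plane) (fun _ => 2 * Real.pi), f x = 0
  norm_lt_top : gevreyNorm r s τ f < ⊤

/-- `θ` is a solution in `G^s` on `[0, T)` of
`∂ₜθ + u·∇θ = 0`, `u = (-Δ)^{α/2} I θ`, `θ(·,0) = θ₀`.
Taking values in `G^s` means that on each compact subinterval of `[0, T)` the functions `θ(·,t)`
form a bounded subset of one of the spaces `G^s_τ` with `τ > 0`. The equation holds pointwise, with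
a one-sided time derivative at `t = 0`; it is written in `ℂ` because Fourier series are. -/
structure IsGevreySolution (r s α T : ℝ) (θ₀ : Plane → ℝ) (θ : ℝ → Plane → ℝ) : Prop where
  gevrey : ∀ T' : ℝ, T' < T → ∃ τ : ℝ, 0 < τ ∧ ∃ M : ℝ, ∀ t ∈ Set.Icc (0 : ℝ) T',
    MemGevrey r s τ (θ t) ∧ gevreyNorm r s τ (θ t) ≤ ENNReal.ofReal M
  equation : ∀ t ∈ Set.Ico (0 : ℝ) T, ∀ x : Plane,
    HasDerivWithinAt (fun t' : ℝ => (θ t' x : ℂ))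
      (-∑ j : Fin 2, velocity α (θ t) j x * (partialDeriv j (θ t) x : ℂ)) (Set.Ico (0 : ℝ) T) t
  initial : θ 0 = θ₀

end SIPM

end

noncomputable section

namespace SIPM

/-! ### Frequencies -/

/-! Put σ = 1/s, so that α ≤ σ, 0 < σ ≤ 1. In Fourier coefficients the equation reads a' = B(a, a)
with B = `Bil α`, and B loses derivatives. A shrinking Gevrey radius pays for the loss: with w =
|k|^r exp(τ(t)|k|^σ) and τ(t) = τ₀ - λt, differentiating the weight in ∑ w²|a|² produces -2λZ, where
Z = ∑ |k|^σ w²|a|². It therefore suffices to bound Re⟨wB(a,a), wa⟩ by a constant times ‖wa‖ Z, which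
is `gevrey_energy_le`.

Two structural facts give this bound. Since the velocity is real and divergence free, transport is
skew: Re⟨B(a, wa), wa⟩ = 0 (`re_tsum_transport_eq_zero`). Hence only the commutator w(k) - w(l)
enters, and it gains |l|^(σ-1) against the one derivative in B. This settles the interactions in
which the velocity has the lower frequency (k = j + l with |j| ≤ |l|). When the velocity frequency j
dominates, |j|^α ≤ |j|^σ, and half of this power moves to the output frequency k at the price of a
factor |l| (`freqNorm_rpow_le_split`). Both cases are in `kern_mul_gevW_sub_le`. What remains is an
ℓ¹ norm with two extra derivatives, controlled by Cauchy–Schwarz exactly because ∑ |k|^(2(2-r))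
converges for r > 3.

Existence: Galerkin truncations satisfy the estimate on a time interval independent of the
truncation (`exists_galerkin_bounded`). An ultrafilter limit is taken at each time and frequency.
The equation survives because it is encoded in a second order Taylor inequality with a
truncation-independent, summable constant (`galerkin_taylor`), which is closed under pointwise
limits and can be summed over frequencies.

Uniqueness: the coefficients of any solution solve the same system
(`IsGevreySolution.isCoeffSolution`). The difference of two solutions has nonincreasing energy for a
purely exponential weight with shrinking radius, on steps whose length depends only on the Gevrey
bounds (`exists_uniqueness_step`); finitely many steps reach any given time. -/

theorem freqNorm_eq_norm (k : Freq) : freqNorm k = ‖((k 0 : ℝ) : ℂ) + ((k 1 : ℝ) : ℂ) * Complex.I‖ := by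
  rw [Complex.norm_add_mul_I, freqNorm]

theorem freqNorm_nonneg (k : Freq) : 0 ≤ freqNorm k := Real.sqrt_nonneg _

@[simp] theorem freqNorm_zero : freqNorm 0 = 0 := by simp [freqNorm]

@[simp] theorem freqNorm_neg (k : Freq) : freqNorm (-k) = freqNorm k := by simp [freqNorm]

theorem freqNorm_add_le (k l : Freq) : freqNorm (k + l) ≤ freqNorm k + freqNorm l := by
  simp only [freqNorm_eq_norm]
  refine le_trans (le_of_eq ?_) (norm_add_le _ _)
  congr 1
  simp only [Pi.add_apply]
  push_cast
  ring

theorem freqNorm_sq (k : Freq) : freqNorm k ^ 2 = (k 0 : ℝ) ^ 2 + (k 1 : ℝ) ^ 2 :=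
  Real.sq_sqrt (by positivity)

theorem abs_coord_le_freqNorm (k : Freq) (j : Fin 2) : |(k j : ℝ)| ≤ freqNorm k := by
  apply Real.abs_le_sqrt
  fin_cases j
  · simpa using sq_nonneg (k 1 : ℝ)
  · simpa using sq_nonneg (k 0 : ℝ)

theorem norm_le_freqNorm (k : Freq) : ‖k‖ ≤ freqNorm k :=
  (pi_norm_le_iff_of_nonneg (freqNorm_nonneg k)).2 fun j => by
    rw [Int.norm_eq_abs]; exact abs_coord_le_freqNorm k j

theorem one_le_freqNorm {k : Freq} (hk : k ≠ 0) : 1 ≤ freqNorm k := by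
  obtain ⟨j, hj⟩ := Function.ne_iff.1 hk
  refine le_trans ?_ (abs_coord_le_freqNorm k j)
  exact_mod_cast Int.one_le_abs hj

/-- The threshold -2 is minus the dimension of the lattice. For negative p the Euclidean length may
be replaced by the smaller sup norm. -/
theorem summable_freqNorm_rpow {p : ℝ} (hp : p < -2) :
    Summable fun k : Freq => freqNorm k ^ p := by
  have h := EisensteinSeries.summable_one_div_norm_rpow (k := -p) (by linarith)
  refine Summable.of_nonneg_of_le (fun k => Real.rpow_nonneg (freqNorm_nonneg k) _)
    (fun k => ?_) h
  rw [neg_neg]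
  by_cases hk : k = 0
  · subst hk; simp
  · exact Real.rpow_le_rpow_of_nonpos (by simpa using hk) (norm_le_freqNorm k) (by linarith)

/-- For x ≥ 1 and m ≥ n/σ, x^n is at most (x^σ)^m, which a single term of the exponential series
dominates; for x ≤ 1 everything is bounded. -/
theorem exists_one_add_pow_mul_exp_le (n : ℕ) {τ σ : ℝ} (hτ : 0 < τ) (hσ : 0 < σ) :
    ∃ C : ℝ, 0 ≤ C ∧ ∀ x : ℝ, 0 ≤ x → (1 + x) ^ n * Real.exp (-τ * x ^ σ) ≤ C := by
  obtain ⟨m, hm⟩ := exists_nat_ge (n / σ)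
  refine ⟨2 ^ n * (1 + m.factorial / τ ^ m), by positivity, fun x hx => ?_⟩
  have hxs : 0 ≤ x ^ σ := Real.rpow_nonneg hx _
  rcases le_total x 1 with h1 | h1
  · calc (1 + x) ^ n * Real.exp (-τ * x ^ σ) ≤ 2 ^ n * 1 := by
          gcongr
          · linarith
          · rw [Real.exp_le_one_iff]; nlinarith
      _ ≤ _ := by
          gcongr
          have : 0 ≤ (m.factorial : ℝ) / τ ^ m := by positivity
          linarith
  · have h2 : x ^ n ≤ (x ^ σ) ^ m := by
      rw [← Real.rpow_natCast x n, ← Real.rpow_natCast (x ^ σ) m, ← Real.rpow_mul hx]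
      apply Real.rpow_le_rpow_of_exponent_le h1
      rw [div_le_iff₀ hσ] at hm
      linarith
    have h3 : (x ^ σ) ^ m * Real.exp (-τ * x ^ σ) ≤ m.factorial / τ ^ m := by
      have := Real.pow_div_factorial_le_exp (τ * x ^ σ) (by positivity) m
      rw [neg_mul, Real.exp_neg, ← div_eq_mul_inv, div_le_div_iff₀ (Real.exp_pos _) (by positivity)]
      rw [div_le_iff₀ (by positivity), mul_pow] at this
      linarith
    calc (1 + x) ^ n * Real.exp (-τ * x ^ σ) ≤ (2 * x) ^ n * Real.exp (-τ * x ^ σ) := by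
          gcongr; linarith
      _ = 2 ^ n * (x ^ n * Real.exp (-τ * x ^ σ)) := by ring
      _ ≤ 2 ^ n * ((x ^ σ) ^ m * Real.exp (-τ * x ^ σ)) := by gcongr
      _ ≤ 2 ^ n * (1 + m.factorial / τ ^ m) := by gcongr; linarith

/-! ### Rapidly decreasing sequences -/

/-- All polynomial moments of `f` are summable. -/
def Rapid (f : Freq → ℝ) : Prop := ∀ m : ℕ, Summable fun k => (1 + freqNorm k) ^ m * f k

theorem one_add_freqNorm_pos (k : Freq) : 0 < 1 + freqNorm k := by
  linarith [freqNorm_nonneg k]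

theorem Rapid.summable {f : Freq → ℝ} (hf : Rapid f) : Summable f := by simpa using hf 0

theorem Rapid.of_le {f g : Freq → ℝ} (hg : Rapid g) (h0 : ∀ k, 0 ≤ f k) (h : ∀ k, f k ≤ g k) :
    Rapid f := fun m =>
  (hg m).of_nonneg_of_le (fun k => mul_nonneg (pow_nonneg (one_add_freqNorm_pos k).le _) (h0 k))
    fun k => mul_le_mul_of_nonneg_left (h k) (pow_nonneg (one_add_freqNorm_pos k).le _)

theorem Rapid.const_mul {f : Freq → ℝ} (hf : Rapid f) (c : ℝ) : Rapid fun k => c * f k := fun m =>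
  ((hf m).mul_left c).congr fun k => by ring

theorem Rapid.add {f g : Freq → ℝ} (hf : Rapid f) (hg : Rapid g) : Rapid fun k => f k + g k :=
  fun m => ((hf m).add (hg m)).congr fun k => by ring

theorem Rapid.one_add_pow_mul {f : Freq → ℝ} (hf : Rapid f) (n : ℕ) :
    Rapid fun k => (1 + freqNorm k) ^ n * f k := fun m =>
  (hf (m + n)).congr fun k => by ring

theorem Rapid.pow_mul {f : Freq → ℝ} (hf : Rapid f) (h0 : ∀ k, 0 ≤ f k) (n : ℕ) :
    Rapid fun k => freqNorm k ^ n * f k :=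
  (hf.one_add_pow_mul n).of_le
    (fun k => mul_nonneg (pow_nonneg (freqNorm_nonneg k) _) (h0 k)) fun k => by
      have := freqNorm_nonneg k
      have := h0 k
      gcongr
      linarith

theorem Rapid.mul_left {f : Freq → ℝ} (hf : Rapid f) (h0 : ∀ k, 0 ≤ f k) :
    Rapid fun k => freqNorm k * f k := by
  simpa using hf.pow_mul h0 1

theorem rapid_exp {τ σ : ℝ} (hτ : 0 < τ) (hσ : 0 < σ) :
    Rapid fun k => Real.exp (-τ * freqNorm k ^ σ) := by
  intro m
  obtain ⟨C, -, hC⟩ := exists_one_add_pow_mul_exp_le (m + 3) hτ hσ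
  -- Three spare powers leave |k|^(-3), summable over the plane lattice. The frequency 0 is set
  -- aside because `freqNorm 0 ^ (-3)` evaluates to 0.
  refine Summable.of_norm_bounded_eventually
    ((summable_freqNorm_rpow (p := -3) (by norm_num)).mul_left C) ?_
  have : ({0} : Set Freq).Finite := Set.finite_singleton 0
  filter_upwards [this.compl_mem_cofinite] with k hk
  have hk1 : 1 ≤ freqNorm k := one_le_freqNorm hk
  have h1 := hC _ (freqNorm_nonneg k)
  have hp := one_add_freqNorm_pos k
  rw [Real.norm_of_nonneg (by positivity), Real.rpow_neg (by linarith), ← div_eq_mul_inv,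
    le_div_iff₀ (by positivity)]
  refine le_trans ?_ h1
  have : freqNorm k ^ (3 : ℝ) ≤ (1 + freqNorm k) ^ 3 := by
    rw [show (3 : ℝ) = ((3 : ℕ) : ℝ) by norm_num, Real.rpow_natCast]
    gcongr; linarith
  rw [pow_add]
  calc (1 + freqNorm k) ^ m * Real.exp (-τ * freqNorm k ^ σ) * freqNorm k ^ (3 : ℝ)
      ≤ (1 + freqNorm k) ^ m * Real.exp (-τ * freqNorm k ^ σ) * (1 + freqNorm k) ^ 3 := by gcongr
    _ = _ := by ring

/-! ### Convolutions -/

/-- The map `(k, l) ↦ (k - l, l)`. -/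
def shear : Freq × Freq ≃ Freq × Freq where
  toFun p := (p.1 - p.2, p.2)
  invFun p := (p.1 + p.2, p.2)
  left_inv p := by simp
  right_inv p := by simp

theorem summable_shear {f g : Freq → ℝ} (hf : Summable f) (hg : Summable g)
    (hf0 : ∀ k, 0 ≤ f k) (hg0 : ∀ k, 0 ≤ g k) :
    Summable fun p : Freq × Freq => f (p.1 - p.2) * g p.2 :=
  shear.summable_iff.2 (hf.mul_of_nonneg hg hf0 hg0)

theorem tsum_shear {f g : Freq → ℝ} (hf : Summable f) (hg : Summable g)
    (hf0 : ∀ k, 0 ≤ f k) (hg0 : ∀ k, 0 ≤ g k) :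
    ∑' p : Freq × Freq, f (p.1 - p.2) * g p.2 = (∑' k, f k) * ∑' k, g k := by
  rw [hf.tsum_mul_tsum hg (hf.mul_of_nonneg hg hf0 hg0)]
  exact shear.tsum_eq (fun p : Freq × Freq => f p.1 * g p.2)

/-- The convolution of two sequences. -/
def conv (f g : Freq → ℝ) (k : Freq) : ℝ := ∑' l, f (k - l) * g l

section conv
variable {f g : Freq → ℝ}

theorem conv_nonneg (hf0 : ∀ k, 0 ≤ f k) (hg0 : ∀ k, 0 ≤ g k) (k : Freq) : 0 ≤ conv f g k :=
  tsum_nonneg fun _ => mul_nonneg (hf0 _) (hg0 _)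

theorem summable_conv_term (hf : Summable f) (hg : Summable g)
    (hf0 : ∀ k, 0 ≤ f k) (hg0 : ∀ k, 0 ≤ g k) (k : Freq) :
    Summable fun l => f (k - l) * g l :=
  (summable_shear hf hg hf0 hg0).prod_factor k

theorem summable_conv (hf : Summable f) (hg : Summable g)
    (hf0 : ∀ k, 0 ≤ f k) (hg0 : ∀ k, 0 ≤ g k) : Summable (conv f g) :=
  (summable_shear hf hg hf0 hg0).prod

/-- Polynomial weights are submultiplicative, 1 + |k| ≤ (1 + |k - l|)(1 + |l|), so each moment of
the convolution is dominated by a convolution of moments. -/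
theorem Rapid.conv (hf : Rapid f) (hg : Rapid g)
    (hf0 : ∀ k, 0 ≤ f k) (hg0 : ∀ k, 0 ≤ g k) : Rapid (conv f g) := by
  intro m
  have hF0 : ∀ k, 0 ≤ (1 + freqNorm k) ^ m * f k := fun k =>
    mul_nonneg (pow_nonneg (one_add_freqNorm_pos k).le _) (hf0 k)
  have hG0 : ∀ k, 0 ≤ (1 + freqNorm k) ^ m * g k := fun k =>
    mul_nonneg (pow_nonneg (one_add_freqNorm_pos k).le _) (hg0 k)
  refine (summable_conv (hf m) (hg m) hF0 hG0).of_nonneg_of_le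
    (fun k => mul_nonneg (pow_nonneg (one_add_freqNorm_pos k).le _)
      (conv_nonneg hf0 hg0 k)) fun k => ?_
  rw [SIPM.conv, ← tsum_mul_left]
  refine ((summable_conv_term hf.summable hg.summable hf0 hg0 k).mul_left _).tsum_le_tsum
    (fun l => ?_) (summable_conv_term (hf m) (hg m) hF0 hG0 k)
  have h1 : 1 + freqNorm k ≤ (1 + freqNorm (k - l)) * (1 + freqNorm l) := by
    have := freqNorm_add_le (k - l) l
    rw [sub_add_cancel] at this
    nlinarith [freqNorm_nonneg (k - l), freqNorm_nonneg l]
  have h2 := pow_le_pow_left₀ (one_add_freqNorm_pos k).le h1 m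
  rw [mul_pow] at h2
  calc (1 + freqNorm k) ^ m * (f (k - l) * g l)
      ≤ ((1 + freqNorm (k - l)) ^ m * (1 + freqNorm l) ^ m) * (f (k - l) * g l) :=
        mul_le_mul_of_nonneg_right h2 (mul_nonneg (hf0 _) (hg0 _))
    _ = _ := by ring

end conv

end SIPM
end

noncomputable section

namespace SIPM

/-! ### The kernel of the nonlinearity -/

/-- The symbol `|j|^α I(j) · l` of the bilinear form `(-Δ)^{α/2} I a · ∇ b`, up to a factor `i`. -/
def kern (α : ℝ) (j l : Freq) : ℝ :=
  freqNorm j ^ α * (ipmSymbol 0 j * (l 0 : ℝ) + ipmSymbol 1 j * (l 1 : ℝ))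

theorem kern_zero_left (α : ℝ) (l : Freq) : kern α 0 l = 0 := by simp [kern, ipmSymbol]

theorem kern_neg_left (α : ℝ) (j l : Freq) : kern α (-j) l = kern α j l := by
  simp [kern, ipmSymbol]

/-- The velocity is divergence free: I(j)·j = 0. -/
theorem kern_add_right (α : ℝ) (j l : Freq) : kern α j (j + l) = kern α j l := by
  simp only [kern, ipmSymbol]
  split_ifs with h
  · simp
  · simp only [Pi.add_apply, Matrix.cons_val_zero, Matrix.cons_val_one]
    push_cast
    ring

/-- Evenness of the symbol together with I(j)·j = 0 makes the kernel symmetric in input and output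
frequency. This symmetry is behind the energy cancellation. -/
theorem kern_sub_swap (α : ℝ) (k l : Freq) : kern α (l - k) k = kern α (k - l) l := by
  rw [← neg_sub k l, kern_neg_left]
  conv_rhs => rw [← kern_add_right, sub_add_cancel]

/-- I(j)·l equals j₀ (j₀l₁ - j₁l₀)/|j|², and the determinant is at most |j||l| by Lagrange's
identity. -/
theorem abs_kern_le (α : ℝ) (j l : Freq) : |kern α j l| ≤ freqNorm j ^ α * freqNorm l := by
  rw [kern, abs_mul, abs_of_nonneg (Real.rpow_nonneg (freqNorm_nonneg j) α)]
  refine mul_le_mul_of_nonneg_left ?_ (Real.rpow_nonneg (freqNorm_nonneg j) α)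
  simp only [ipmSymbol]
  split_ifs with h
  · simpa using freqNorm_nonneg l
  have hj : 0 < freqNorm j := by linarith [one_le_freqNorm h]
  have hj2 := freqNorm_sq j
  simp only [Matrix.cons_val_zero, Matrix.cons_val_one]
  rw [← hj2, show -((j 0 : ℝ) * (j 1 : ℝ)) / freqNorm j ^ 2 * (l 0 : ℝ) +
    (j 0 : ℝ) ^ 2 / freqNorm j ^ 2 * (l 1 : ℝ) =
    (j 0 : ℝ) * ((j 0 : ℝ) * (l 1 : ℝ) - (j 1 : ℝ) * (l 0 : ℝ)) / freqNorm j ^ 2 by ring,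
    abs_div, abs_mul, abs_of_pos (by positivity : 0 < freqNorm j ^ 2),
    div_le_iff₀ (by positivity)]
  have h1 := abs_coord_le_freqNorm j 0
  have h2 : |(j 0 : ℝ) * (l 1 : ℝ) - (j 1 : ℝ) * (l 0 : ℝ)| ≤ freqNorm j * freqNorm l := by
    apply abs_le_of_sq_le_sq _ (mul_nonneg hj.le (freqNorm_nonneg l))
    rw [mul_pow, hj2, freqNorm_sq l]
    nlinarith [sq_nonneg ((j 0 : ℝ) * (l 0 : ℝ) + (j 1 : ℝ) * (l 1 : ℝ))]
  calc _ ≤ freqNorm j * (freqNorm j * freqNorm l) := by gcongr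
    _ = _ := by ring

theorem abs_kern_le' (α : ℝ) (j l : Freq) : |kern α j l| ≤ freqNorm j ^ α * freqNorm (j + l) := by
  rw [← kern_add_right]; exact abs_kern_le α j _

theorem freqNorm_rpow_le {α β : ℝ} (h : α ≤ β) {j : Freq} (hj : j ≠ 0) :
    freqNorm j ^ α ≤ freqNorm j ^ β :=
  Real.rpow_le_rpow_of_exponent_le (one_le_freqNorm hj) h

theorem freqNorm_rpow_le_self {α : ℝ} (h : α ≤ 1) {j : Freq} (hj : j ≠ 0) :
    freqNorm j ^ α ≤ freqNorm j := by
  simpa using freqNorm_rpow_le h hj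

theorem abs_kern_le_mul {α : ℝ} (hα : α ≤ 1) (j l : Freq) :
    |kern α j l| ≤ freqNorm j * freqNorm l := by
  by_cases hj : j = 0
  · subst hj; simp [kern_zero_left]
  · exact (abs_kern_le α j l).trans (mul_le_mul_of_nonneg_right (freqNorm_rpow_le_self hα hj)
      (freqNorm_nonneg l))

/-! ### Weights -/

/-- Bernoulli's inequality for (M/m)^σ with exponent at most 1; the factor σ ≤ 1 is dropped. -/
theorem mul_rpow_sub_rpow_le {σ m M : ℝ} (hσ0 : 0 ≤ σ) (hσ : σ ≤ 1) (hm : 0 < m) (hM : m ≤ M) :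
    m * (M ^ σ - m ^ σ) ≤ (M - m) * m ^ σ := by
  have h := rpow_one_add_le_one_add_mul_self (s := (M - m) / m)
    (by have := div_nonneg (sub_nonneg.2 hM) hm.le; linarith) hσ0 hσ
  have e : 1 + (M - m) / m = M / m := by field_simp; ring
  have hp : 0 < m ^ σ := Real.rpow_pos_of_pos hm σ
  rw [e, Real.div_rpow (by linarith) hm.le, div_le_iff₀ hp] at h
  have h2 : m * M ^ σ ≤ m * ((1 + σ * ((M - m) / m)) * m ^ σ) := by gcongr
  have h3 : m * ((1 + σ * ((M - m) / m)) * m ^ σ) = m * m ^ σ + σ * ((M - m) * m ^ σ) := by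
    field_simp
  have h4 : 0 ≤ (M - m) * m ^ σ := mul_nonneg (by linarith) hp.le
  nlinarith

/-- Bernoulli's inequality for (m/M)^r with exponent at least 1, hence the expansion around the
larger argument. -/
theorem mul_rpow_sub_rpow_le' {r m M : ℝ} (hr : 1 ≤ r) (hm : 0 < m) (hM : m ≤ M) :
    M * (M ^ r - m ^ r) ≤ r * (M - m) * M ^ r := by
  have hM0 : 0 < M := by linarith
  have h := one_add_mul_self_le_rpow_one_add (s := (m - M) / M)
    (by rw [le_div_iff₀ hM0]; linarith) hr
  have e : 1 + (m - M) / M = m / M := by field_simp; ring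
  have hp : 0 < M ^ r := Real.rpow_pos_of_pos hM0 r
  rw [e, Real.div_rpow hm.le (by linarith), le_div_iff₀ hp] at h
  have h2 : M * ((1 + r * ((m - M) / M)) * M ^ r) ≤ M * m ^ r := by gcongr
  have h3 : M * ((1 + r * ((m - M) / M)) * M ^ r) = M * M ^ r - r * (M - m) * M ^ r := by
    field_simp
    ring
  linarith

/-- The exponential weight `exp (τ x^σ)`. -/
def expW (τ σ x : ℝ) : ℝ := Real.exp (τ * x ^ σ)

theorem expW_pos (τ σ x : ℝ) : 0 < expW τ σ x := Real.exp_pos _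

theorem one_le_expW {τ σ x : ℝ} (hτ : 0 ≤ τ) (hx : 0 ≤ x) : 1 ≤ expW τ σ x :=
  Real.one_le_exp (mul_nonneg hτ (Real.rpow_nonneg hx σ))

theorem expW_mono {τ σ x y : ℝ} (hτ : 0 ≤ τ) (hσ : 0 ≤ σ) (hx : 0 ≤ x) (h : x ≤ y) :
    expW τ σ x ≤ expW τ σ y :=
  Real.exp_le_exp.2 (mul_le_mul_of_nonneg_left (Real.rpow_le_rpow hx h hσ) hτ)

theorem expW_mono_left {τ τ' σ x : ℝ} (h : τ ≤ τ') (hx : 0 ≤ x) :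
    expW τ σ x ≤ expW τ' σ x :=
  Real.exp_le_exp.2 (mul_le_mul_of_nonneg_right h (Real.rpow_nonneg hx σ))

theorem expW_add_le {τ σ x y z : ℝ} (hτ : 0 ≤ τ) (hσ0 : 0 ≤ σ) (hσ : σ ≤ 1) (hx : 0 ≤ x)
    (hy : 0 ≤ y) (hz : 0 ≤ z) (h : z ≤ x + y) : expW τ σ z ≤ expW τ σ x * expW τ σ y := by
  rw [expW, expW, expW, ← Real.exp_add, ← mul_add]
  exact Real.exp_le_exp.2 (mul_le_mul_of_nonneg_left ((Real.rpow_le_rpow hz h hσ0).trans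
    (Real.rpow_add_le_add_rpow hx hy hσ0 hσ)) hτ)

/-- From 1 - e^(-u) ≤ u with u = τ(M^σ - m^σ), followed by the commutator bound for the power. The
factor m compensates the derivative m^(σ-1) of the exponent, leaving only m^σ. -/
theorem mul_expW_sub_le {τ σ m M : ℝ} (hτ : 0 ≤ τ) (hσ0 : 0 ≤ σ) (hσ : σ ≤ 1) (hm : 0 < m)
    (hM : m ≤ M) :
    m * (expW τ σ M - expW τ σ m) ≤ τ * (M - m) * m ^ σ * expW τ σ M := by
  have h1 : expW τ σ M - expW τ σ m ≤ τ * (M ^ σ - m ^ σ) * expW τ σ M := by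
    have h := Real.add_one_le_exp (τ * m ^ σ - τ * M ^ σ)
    have e : expW τ σ m = Real.exp (τ * m ^ σ - τ * M ^ σ) * expW τ σ M := by
      rw [expW, expW, ← Real.exp_add]; congr 1; ring
    rw [e]
    nlinarith [expW_pos τ σ M]
  calc m * (expW τ σ M - expW τ σ m) ≤ m * (τ * (M ^ σ - m ^ σ) * expW τ σ M) := by gcongr
    _ = τ * (m * (M ^ σ - m ^ σ)) * expW τ σ M := by ring
    _ ≤ τ * ((M - m) * m ^ σ) * expW τ σ M := by
        have := mul_rpow_sub_rpow_le hσ0 hσ hm hM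
        have := expW_pos τ σ M
        gcongr
    _ = _ := by ring

/-- The Gevrey weight `x^r exp (τ x^σ)`. -/
def gevW (r τ σ x : ℝ) : ℝ := x ^ r * expW τ σ x

theorem gevW_nonneg (r τ σ : ℝ) {x : ℝ} (hx : 0 ≤ x) : 0 ≤ gevW r τ σ x :=
  mul_nonneg (Real.rpow_nonneg hx r) (expW_pos _ _ _).le

theorem gevW_mono {r τ σ x y : ℝ} (hr : 0 ≤ r) (hτ : 0 ≤ τ) (hσ : 0 ≤ σ) (hx : 0 ≤ x)
    (h : x ≤ y) : gevW r τ σ x ≤ gevW r τ σ y :=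
  mul_le_mul (Real.rpow_le_rpow hx h hr) (expW_mono hτ hσ hx h) (expW_pos _ _ _).le
    (Real.rpow_nonneg (hx.trans h) r)

/-- Product rule for x^r times the exponential. The polynomial part costs no power of frequency, and
m^σ ≥ 1 lets it be written with the same factor as the exponential part. -/
theorem mul_gevW_sub_le {r τ σ m M : ℝ} (hr : 1 ≤ r) (hτ : 0 ≤ τ) (hσ0 : 0 ≤ σ) (hσ : σ ≤ 1)
    (hm : 1 ≤ m) (hM : m ≤ M) :
    m * (gevW r τ σ M - gevW r τ σ m) ≤ (τ + r) * (M - m) * m ^ σ * gevW r τ σ M := by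
  have hm0 : 0 < m := by linarith
  have hM0 : 0 < M := by linarith
  have h1 := mul_expW_sub_le hτ hσ0 hσ hm0 hM
  have h2 := mul_rpow_sub_rpow_le' hr hm0 hM
  have hMr : 0 ≤ M ^ r := Real.rpow_nonneg hM0.le r
  have hms : 1 ≤ m ^ σ := Real.one_le_rpow hm hσ0
  have hd : 0 ≤ M ^ r - m ^ r := sub_nonneg.2 (Real.rpow_le_rpow hm0.le hM (by linarith))
  have he := expW_mono hτ hσ0 hm0.le hM
  have hem := expW_pos τ σ m
  have hMm : 0 ≤ M - m := sub_nonneg.2 hM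
  calc m * (gevW r τ σ M - gevW r τ σ m)
      = M ^ r * (m * (expW τ σ M - expW τ σ m)) + m * (M ^ r - m ^ r) * expW τ σ m := by
        simp only [gevW]; ring
    _ ≤ M ^ r * (τ * (M - m) * m ^ σ * expW τ σ M) + r * (M - m) * M ^ r * expW τ σ M := by
        refine add_le_add (by gcongr) ?_
        refine mul_le_mul ?_ he hem.le (by positivity)
        exact (mul_le_mul_of_nonneg_right hM hd).trans h2
    _ ≤ M ^ r * (τ * (M - m) * m ^ σ * expW τ σ M) +
          r * (M - m) * M ^ r * expW τ σ M * m ^ σ := by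
        refine add_le_add le_rfl (le_mul_of_one_le_right ?_ hms)
        have := expW_pos τ σ M
        positivity
    _ = _ := by simp only [gevW]; ring

/-- A commutator estimate for a monotone weight, deduced from the one for ordered arguments. -/
theorem min_mul_abs_sub_le {w : ℝ → ℝ} {σ C x y d : ℝ} (hC : 0 ≤ C) (hσ : 0 ≤ σ)
    (hw0 : ∀ x, 0 ≤ x → 0 ≤ w x)
    (hw : ∀ x y, 0 ≤ x → x ≤ y → w x ≤ w y)
    (h : ∀ m M, 1 ≤ m → m ≤ M → m * (w M - w m) ≤ C * (M - m) * m ^ σ * w M)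
    (hx : 1 ≤ x) (hy : 1 ≤ y) (hxy : x ≤ y + d) (hyx : y ≤ x + d) :
    min x y * |w x - w y| ≤ C * d * (x ^ (σ / 2) * y ^ (σ / 2)) * w (max x y) := by
  have key : ∀ m M, 1 ≤ m → m ≤ M → M ≤ m + d →
      m * |w M - w m| ≤ C * d * (m ^ (σ / 2) * M ^ (σ / 2)) * w M := by
    intro m M hm hM hd
    rw [abs_of_nonneg (sub_nonneg.2 (hw m M (by linarith) hM))]
    refine (h m M hm hM).trans ?_
    -- The power σ is shared evenly by the two frequencies, so that each factor in the energy form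
    -- carries σ/2.
    have e : m ^ σ = m ^ (σ / 2) * m ^ (σ / 2) := by
      rw [← Real.rpow_add (by linarith)]; congr 1; ring
    have h1 : m ^ σ ≤ m ^ (σ / 2) * M ^ (σ / 2) := by
      rw [e]
      gcongr
    have h2 : 0 ≤ m ^ σ := by positivity
    have h3 := hw0 M (by linarith)
    have h4 : M - m ≤ d := by linarith
    have h5 : 0 ≤ M - m := by linarith
    have h6 : 0 ≤ d := h5.trans h4
    gcongr
  rcases le_total x y with hle | hle
  · rw [min_eq_left hle, max_eq_right hle, abs_sub_comm]
    exact key x y hx hle hyx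
  · rw [min_eq_right hle, max_eq_left hle, mul_comm (x ^ _)]
    exact key y x hy hle hxy

theorem freqNorm_le_two_mul {j k l : Freq} (hjk : k = j + l) (hk : k ≠ 0) (hl : l ≠ 0) :
    freqNorm j ≤ 2 * (freqNorm k * freqNorm l) := by
  have h : freqNorm j ≤ freqNorm k + freqNorm l := by
    have := freqNorm_add_le k (-l)
    rw [freqNorm_neg, hjk] at this
    simpa [hjk] using this
  nlinarith [one_le_freqNorm hk, one_le_freqNorm hl]

/-- Half of the derivatives falling on the first factor can be moved to the others. -/
theorem freqNorm_rpow_le_split {α σ : ℝ} (hασ : α ≤ σ) (hσ0 : 0 ≤ σ) (hσ : σ ≤ 1) {j k l : Freq}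
    (hjk : k = j + l) (hj : j ≠ 0) (hk : k ≠ 0) (hl : l ≠ 0) :
    freqNorm j ^ α ≤ 2 * freqNorm l * (freqNorm j ^ (σ / 2) * freqNorm k ^ (σ / 2)) := by
  have hj1 := one_le_freqNorm hj
  have hk1 := one_le_freqNorm hk
  have hl1 := one_le_freqNorm hl
  -- Nonzero frequencies have length at least 1, so |j| ≤ |k| + |l| ≤ 2|k||l|. Raising 2|l| ≥ 1 from
  -- the power σ/2 to the power 1 is harmless, since l is the low frequency when this is used.
  have h2 : freqNorm j ^ (σ / 2) ≤ 2 * freqNorm l * freqNorm k ^ (σ / 2) := by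
    calc freqNorm j ^ (σ / 2) ≤ (2 * (freqNorm k * freqNorm l)) ^ (σ / 2) :=
          Real.rpow_le_rpow (by linarith) (freqNorm_le_two_mul hjk hk hl) (by linarith)
      _ = (2 * freqNorm l) ^ (σ / 2) * freqNorm k ^ (σ / 2) := by
          rw [← Real.mul_rpow (by linarith) (by linarith)]; congr 1; ring
      _ ≤ (2 * freqNorm l) ^ (1 : ℝ) * freqNorm k ^ (σ / 2) := by
          gcongr
          · linarith
          · linarith
      _ = _ := by rw [Real.rpow_one]
  calc freqNorm j ^ α ≤ freqNorm j ^ σ := freqNorm_rpow_le hασ hj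
    _ = freqNorm j ^ (σ / 2) * freqNorm j ^ (σ / 2) := by
        rw [← Real.rpow_add (by linarith)]; congr 1; ring
    _ ≤ freqNorm j ^ (σ / 2) * (2 * freqNorm l * freqNorm k ^ (σ / 2)) := by gcongr
    _ = _ := by ring

/-! ### Pointwise bounds for the kernel against weights and commutators -/

section pointwise
variable {α σ : ℝ} {j k l : Freq}

/-- By the divergence-free condition the derivative may fall on the input or on the output,
whichever frequency is smaller. The minimum is what the commutator estimates need. -/
theorem abs_kern_le_min (hjk : k = j + l) :
    |kern α j l| ≤ freqNorm j ^ α * min (freqNorm k) (freqNorm l) := by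
  rcases min_choice (freqNorm k) (freqNorm l) with h | h <;> rw [h]
  · rw [hjk]; exact abs_kern_le' α j l
  · exact abs_kern_le α j l

theorem freqNorm_triangle (hjk : k = j + l) :
    freqNorm k ≤ freqNorm l + freqNorm j ∧ freqNorm l ≤ freqNorm k + freqNorm j := by
  constructor
  · rw [hjk, add_comm j l]; exact freqNorm_add_le l j
  · have := freqNorm_add_le k (-j)
    rw [freqNorm_neg] at this
    convert this using 2
    rw [hjk]; abel

theorem kern_mul_expW_sub_le (hα1 : α ≤ 1) (hσ0 : 0 ≤ σ) (hσ : σ ≤ 1)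
    {τ : ℝ} (hτ : 0 ≤ τ) (hjk : k = j + l) (hj : j ≠ 0) (hk : k ≠ 0) (hl : l ≠ 0) :
    |kern α j l| * |expW τ σ (freqNorm k) - expW τ σ (freqNorm l)| ≤
      τ * (freqNorm j ^ 2 * expW τ σ (freqNorm j)) * expW τ σ (freqNorm l) *
        (freqNorm k ^ (σ / 2) * freqNorm l ^ (σ / 2)) := by
  have hj1 := one_le_freqNorm hj
  have hk1 := one_le_freqNorm hk
  have hl1 := one_le_freqNorm hl
  obtain ⟨t1, t2⟩ := freqNorm_triangle hjk
  have h1 := min_mul_abs_sub_le (w := expW τ σ) (x := freqNorm k) (y := freqNorm l)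
    (d := freqNorm j) hτ hσ0 (fun x _ => (expW_pos τ σ x).le)
    (fun x y hx h => expW_mono hτ hσ0 hx h)
    (fun m M hm hM => mul_expW_sub_le hτ hσ0 hσ (by linarith) hM) hk1 hl1 t1 t2
  have h2 : expW τ σ (max (freqNorm k) (freqNorm l)) ≤
      expW τ σ (freqNorm j) * expW τ σ (freqNorm l) :=
    expW_add_le hτ hσ0 hσ (by linarith) (by linarith) (by positivity)
      (max_le (by linarith) (by linarith))
  have h3 := abs_kern_le_min (α := α) hjk
  have h4 := freqNorm_rpow_le_self hα1 hj
  calc |kern α j l| * |expW τ σ (freqNorm k) - expW τ σ (freqNorm l)|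
      ≤ freqNorm j ^ α * min (freqNorm k) (freqNorm l) *
          |expW τ σ (freqNorm k) - expW τ σ (freqNorm l)| := by gcongr
    _ = freqNorm j ^ α * (min (freqNorm k) (freqNorm l) *
          |expW τ σ (freqNorm k) - expW τ σ (freqNorm l)|) := by ring
    _ ≤ freqNorm j * (τ * freqNorm j * (freqNorm k ^ (σ / 2) * freqNorm l ^ (σ / 2)) *
          (expW τ σ (freqNorm j) * expW τ σ (freqNorm l))) := by
        have h5 : 0 ≤ min (freqNorm k) (freqNorm l) := le_min (by linarith) (by linarith)
        refine mul_le_mul h4 (h1.trans ?_) (by positivity) (by linarith)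
        gcongr
    _ = _ := by ring

/-- Used where the difference of two solutions is the transporting field and no cancellation is
available: the derivatives on that factor are split, and all others go to the fixed solution with
frequency l. -/
theorem kern_mul_expW_le (hασ : α ≤ σ) (hσ0 : 0 ≤ σ) (hσ : σ ≤ 1)
    {τ : ℝ} (hτ : 0 ≤ τ) (hjk : k = j + l) (hj : j ≠ 0) (hk : k ≠ 0) (hl : l ≠ 0) :
    |kern α j l| * expW τ σ (freqNorm k) ≤
      2 * (freqNorm l ^ 2 * expW τ σ (freqNorm l)) * expW τ σ (freqNorm j) *
        (freqNorm j ^ (σ / 2) * freqNorm k ^ (σ / 2)) := by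
  have hj1 := one_le_freqNorm hj
  have hl1 := one_le_freqNorm hl
  have h0 := freqNorm_nonneg k
  have h1 := abs_kern_le α j l
  have h2 := freqNorm_rpow_le_split hασ hσ0 hσ hjk hj hk hl
  have h3 : expW τ σ (freqNorm k) ≤ expW τ σ (freqNorm j) * expW τ σ (freqNorm l) :=
    expW_add_le hτ hσ0 hσ (by linarith) (by linarith) h0 (by linarith [(freqNorm_triangle hjk).1])
  calc |kern α j l| * expW τ σ (freqNorm k)
      ≤ (2 * freqNorm l * (freqNorm j ^ (σ / 2) * freqNorm k ^ (σ / 2)) * freqNorm l) *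
        (expW τ σ (freqNorm j) * expW τ σ (freqNorm l)) := by
        refine mul_le_mul (h1.trans ?_) h3 (expW_pos _ _ _).le (by positivity)
        gcongr
    _ = _ := by ring

/-- Two regimes. If |j| ≤ |l| the commutator is exploited; if |l| ≤ |j| the weights are estimated
separately and half of |j|^σ is moved to k. In both, the larger frequency carries the full weight,
and the constants τ + r and 2 are merged into τ + r + 2. -/
theorem kern_mul_gevW_sub_le {r : ℝ} (hr : 1 ≤ r) (hα1 : α ≤ 1) (hασ : α ≤ σ)
    (hσ0 : 0 ≤ σ) (hσ : σ ≤ 1) {τ : ℝ} (hτ : 0 ≤ τ) (hjk : k = j + l) (hj : j ≠ 0) (hk : k ≠ 0)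
    (hl : l ≠ 0) :
    |kern α j l| * |gevW r τ σ (freqNorm k) - gevW r τ σ (freqNorm l)| ≤
      2 ^ r * (τ + r + 2) *
        ((freqNorm j ^ 2 * expW τ σ (freqNorm j)) * gevW r τ σ (freqNorm l) *
          (freqNorm k ^ (σ / 2) * freqNorm l ^ (σ / 2)) +
        (freqNorm l ^ 2 * expW τ σ (freqNorm l)) * gevW r τ σ (freqNorm j) *
          (freqNorm j ^ (σ / 2) * freqNorm k ^ (σ / 2))) := by
  have hj1 := one_le_freqNorm hj
  have hk1 := one_le_freqNorm hk
  have hl1 := one_le_freqNorm hl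
  obtain ⟨t1, t2⟩ := freqNorm_triangle hjk
  have hej := expW_pos τ σ (freqNorm j)
  have hel := expW_pos τ σ (freqNorm l)
  have hgj := gevW_nonneg r τ σ (freqNorm_nonneg j)
  have hgl := gevW_nonneg r τ σ (freqNorm_nonneg l)
  have hM : max (freqNorm k) (freqNorm l) ≤ freqNorm j + freqNorm l :=
    max_le (by linarith) (by linarith)
  have hM0 : 0 ≤ max (freqNorm k) (freqNorm l) := by positivity
  have he : expW τ σ (max (freqNorm k) (freqNorm l)) ≤
      expW τ σ (freqNorm j) * expW τ σ (freqNorm l) :=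
    expW_add_le hτ hσ0 hσ (by linarith) (by linarith) hM0 hM
  have hr2 : (0 : ℝ) < 2 ^ r := by positivity
  have hmono : ∀ x y, 0 ≤ x → x ≤ y → gevW r τ σ x ≤ gevW r τ σ y :=
    fun x y hx h => gevW_mono (by linarith) hτ hσ0 hx h
  rcases le_total (freqNorm j) (freqNorm l) with hjl | hjl
  -- Low velocity frequency: max(|k|, |l|) ≤ |j| + |l| ≤ 2|l|, which is the origin of 2^r.
  · have hw : gevW r τ σ (max (freqNorm k) (freqNorm l)) ≤
        2 ^ r * (gevW r τ σ (freqNorm l) * expW τ σ (freqNorm j)) := by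
      calc gevW r τ σ (max (freqNorm k) (freqNorm l))
          ≤ (2 * freqNorm l) ^ r * (expW τ σ (freqNorm j) * expW τ σ (freqNorm l)) := by
            refine mul_le_mul (Real.rpow_le_rpow hM0 (by linarith) (by linarith)) he
              (expW_pos _ _ _).le (by positivity)
        _ = _ := by rw [Real.mul_rpow (by norm_num) (by linarith), gevW]; ring
    have h1 := min_mul_abs_sub_le (w := gevW r τ σ) (C := τ + r) (x := freqNorm k)
      (y := freqNorm l) (d := freqNorm j) (by linarith) hσ0
      (fun x hx => gevW_nonneg r τ σ hx) hmono
      (fun m M hm hM => mul_gevW_sub_le hr hτ hσ0 hσ hm hM) hk1 hl1 t1 t2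
    have h3 := abs_kern_le_min (α := α) hjk
    have h4 := freqNorm_rpow_le_self hα1 hj
    calc |kern α j l| * |gevW r τ σ (freqNorm k) - gevW r τ σ (freqNorm l)|
        ≤ freqNorm j ^ α * min (freqNorm k) (freqNorm l) *
            |gevW r τ σ (freqNorm k) - gevW r τ σ (freqNorm l)| := by gcongr
      _ = freqNorm j ^ α * (min (freqNorm k) (freqNorm l) *
            |gevW r τ σ (freqNorm k) - gevW r τ σ (freqNorm l)|) := by ring
      _ ≤ freqNorm j * ((τ + r) * freqNorm j * (freqNorm k ^ (σ / 2) * freqNorm l ^ (σ / 2)) *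
            (2 ^ r * (gevW r τ σ (freqNorm l) * expW τ σ (freqNorm j)))) := by
          have h5 : 0 ≤ min (freqNorm k) (freqNorm l) := le_min (by linarith) (by linarith)
          refine mul_le_mul h4 (h1.trans ?_) (by positivity) (by linarith)
          gcongr
      _ = 2 ^ r * (τ + r) * ((freqNorm j ^ 2 * expW τ σ (freqNorm j)) * gevW r τ σ (freqNorm l) *
          (freqNorm k ^ (σ / 2) * freqNorm l ^ (σ / 2))) := by ring
      _ ≤ _ := by
          refine mul_le_mul ?_ (le_add_of_nonneg_right (by positivity)) (by positivity)
            (by positivity)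
          exact mul_le_mul_of_nonneg_left (by linarith) hr2.le
  -- High velocity frequency: now max(|k|, |l|) ≤ 2|j|, and the difference of weights is merely
  -- bounded by the larger weight.
  · have hw : gevW r τ σ (max (freqNorm k) (freqNorm l)) ≤
        2 ^ r * (gevW r τ σ (freqNorm j) * expW τ σ (freqNorm l)) := by
      calc gevW r τ σ (max (freqNorm k) (freqNorm l))
          ≤ (2 * freqNorm j) ^ r * (expW τ σ (freqNorm j) * expW τ σ (freqNorm l)) := by
            refine mul_le_mul (Real.rpow_le_rpow hM0 (by linarith) (by linarith)) he
              (expW_pos _ _ _).le (by positivity)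
        _ = _ := by rw [Real.mul_rpow (by norm_num) (by linarith), gevW]; ring
    have hd : |gevW r τ σ (freqNorm k) - gevW r τ σ (freqNorm l)| ≤
        gevW r τ σ (max (freqNorm k) (freqNorm l)) := by
      have a1 := hmono _ _ (freqNorm_nonneg k) (le_max_left (freqNorm k) (freqNorm l))
      have a2 := hmono _ _ (freqNorm_nonneg l) (le_max_right (freqNorm k) (freqNorm l))
      have a3 := gevW_nonneg r τ σ (freqNorm_nonneg k)
      rw [abs_le]; constructor <;> linarith
    have h1 := abs_kern_le α j l
    have h2 := freqNorm_rpow_le_split hασ hσ0 hσ hjk hj hk hl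
    calc |kern α j l| * |gevW r τ σ (freqNorm k) - gevW r τ σ (freqNorm l)|
        ≤ (2 * freqNorm l * (freqNorm j ^ (σ / 2) * freqNorm k ^ (σ / 2)) * freqNorm l) *
          (2 ^ r * (gevW r τ σ (freqNorm j) * expW τ σ (freqNorm l))) := by
          refine mul_le_mul (h1.trans ?_) (hd.trans hw) (abs_nonneg _) (by positivity)
          gcongr
      _ = 2 ^ r * 2 * ((freqNorm l ^ 2 * expW τ σ (freqNorm l)) * gevW r τ σ (freqNorm j) *
          (freqNorm j ^ (σ / 2) * freqNorm k ^ (σ / 2))) := by ring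
      _ ≤ _ := by
          refine mul_le_mul ?_ (le_add_of_nonneg_left (by positivity)) (by positivity)
            (by positivity)
          exact mul_le_mul_of_nonneg_left (by linarith) hr2.le

end pointwise

end SIPM
end

noncomputable section

namespace SIPM

open ComplexConjugate

/-! ### The bilinear form on Fourier coefficients -/

/-- The Fourier coefficients of `-(-Δ)^{α/2} I a · ∇ b` in terms of those of `a` and `b`. -/
def Bil (α : ℝ) (a b : Freq → ℂ) (k : Freq) : ℂ :=
  ∑' l, -Complex.I * (kern α (k - l) l : ℂ) * a (k - l) * b l

/-- The symmetry of the Fourier coefficients of a real function. -/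
def IsSymm (a : Freq → ℂ) : Prop := ∀ k, a (-k) = conj (a k)

/-- Exchanging k and l turns the summand into minus its conjugate, so the sum equals minus its own
conjugate. No convergence is needed, as both operations commute with `tsum` unconditionally. -/
theorem re_tsum_transport_eq_zero {α : ℝ} {a : Freq → ℂ} (ha : IsSymm a) (W : Freq → ℂ) :
    (∑' p : Freq × Freq, -Complex.I * (kern α (p.1 - p.2) p.2 : ℂ) * a (p.1 - p.2) * W p.2 *
      conj (W p.1)).re = 0 := by
  set F : Freq × Freq → ℂ := fun p =>
    -Complex.I * (kern α (p.1 - p.2) p.2 : ℂ) * a (p.1 - p.2) * W p.2 * conj (W p.1) with hF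
  have h1 : ∀ p : Freq × Freq, F p.swap = -conj (F p) := by
    rintro ⟨k, l⟩
    have h2 : a (l - k) = conj (a (k - l)) := by rw [← ha, neg_sub]
    simp only [hF, Prod.swap_prod_mk, h2, kern_sub_swap, map_mul, map_neg, Complex.conj_I,
      Complex.conj_ofReal, Complex.conj_conj]
    ring
  have h3 : ∑' p, F p = -conj (∑' p, F p) := by
    rw [Complex.conj_tsum, ← tsum_neg, ← (Equiv.prodComm Freq Freq).tsum_eq F]
    exact tsum_congr h1
  have h4 := congrArg Complex.re h3
  simp only [Complex.neg_re, Complex.conj_re] at h4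
  linarith

/-- The map `(k, l) ↦ (k - l, k)`. -/
def shearFst : Freq × Freq ≃ Freq × Freq where
  toFun p := (p.1 - p.2, p.1)
  invFun p := (p.2, p.2 - p.1)
  left_inv p := by simp
  right_inv p := by simp

/-- The map `(k, l) ↦ (k, k - l)`. -/
def shearSnd : Freq × Freq ≃ Freq × Freq where
  toFun p := (p.1, p.1 - p.2)
  invFun p := (p.1, p.1 - p.2)
  left_inv p := by simp
  right_inv p := by simp

/-- Young's inequality in the form ⟨X * Y, Y⟩ ≤ ‖X‖₁ ‖Y‖₂², obtained from Y(l)Y(k) ≤ (Y(l)² +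
Y(k)²)/2 and two changes of variables. -/
theorem schur_shear {X Y : Freq → ℝ} (hX : Summable X) (hY : Summable fun k => Y k ^ 2)
    (hX0 : ∀ k, 0 ≤ X k) (hY0 : ∀ k, 0 ≤ Y k) :
    (Summable fun p : Freq × Freq => X (p.1 - p.2) * (Y p.2 * Y p.1)) ∧
      ∑' p : Freq × Freq, X (p.1 - p.2) * (Y p.2 * Y p.1) ≤ (∑' k, X k) * ∑' k, Y k ^ 2 := by
  have hm := hX.mul_of_nonneg hY hX0 fun k => sq_nonneg (Y k)
  have s1 : Summable fun p : Freq × Freq => X (p.1 - p.2) * Y p.2 ^ 2 :=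
    summable_shear hX hY hX0 fun k => sq_nonneg (Y k)
  have s2 : Summable fun p : Freq × Freq => X (p.1 - p.2) * Y p.1 ^ 2 :=
    (shearFst.summable_iff (f := fun p : Freq × Freq => X p.1 * Y p.2 ^ 2)).2 hm
  have t1 := tsum_shear hX hY hX0 fun k => sq_nonneg (Y k)
  have t2 : ∑' p : Freq × Freq, X (p.1 - p.2) * Y p.1 ^ 2 = (∑' k, X k) * ∑' k, Y k ^ 2 := by
    rw [hX.tsum_mul_tsum hY hm]
    exact shearFst.tsum_eq (fun p : Freq × Freq => X p.1 * Y p.2 ^ 2)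
  have hle : ∀ p : Freq × Freq, X (p.1 - p.2) * (Y p.2 * Y p.1) ≤
      (1 / 2) * (X (p.1 - p.2) * Y p.2 ^ 2 + X (p.1 - p.2) * Y p.1 ^ 2) := fun p => by
    nlinarith [mul_nonneg (hX0 (p.1 - p.2)) (sq_nonneg (Y p.2 - Y p.1))]
  have s3 := (s1.add s2).mul_left (1 / 2)
  have s4 := s3.of_nonneg_of_le
    (fun p => mul_nonneg (hX0 _) (mul_nonneg (hY0 _) (hY0 _))) hle
  refine ⟨s4, (s4.tsum_le_tsum hle s3).trans (le_of_eq ?_)⟩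
  rw [tsum_mul_left, s1.tsum_add s2, t1, t2]
  ring

theorem schur_shear' {X Y : Freq → ℝ} (hX : Summable X) (hY : Summable fun k => Y k ^ 2)
    (hX0 : ∀ k, 0 ≤ X k) (hY0 : ∀ k, 0 ≤ Y k) :
    (Summable fun p : Freq × Freq => X p.2 * (Y (p.1 - p.2) * Y p.1)) ∧
      ∑' p : Freq × Freq, X p.2 * (Y (p.1 - p.2) * Y p.1) ≤ (∑' k, X k) * ∑' k, Y k ^ 2 := by
  obtain ⟨h1, h2⟩ := schur_shear hX hY hX0 hY0
  have he : (fun p : Freq × Freq => X p.2 * (Y (p.1 - p.2) * Y p.1)) =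
      (fun p : Freq × Freq => X (p.1 - p.2) * (Y p.2 * Y p.1)) ∘ shearSnd := by
    ext p; simp [shearSnd]
  rw [he]
  refine ⟨shearSnd.summable_iff.2 h1, ?_⟩
  rw [← shearSnd.tsum_eq] at h2
  exact h2

/-! ### Energy forms and the cancellation of the transport term -/

section energy

variable {α : ℝ} {a b d : Freq → ℂ}

theorem summable_shear_bounded {f g h : Freq → ℝ} {C : ℝ} (hf : Summable f) (hg : Summable g)
    (hf0 : ∀ k, 0 ≤ f k) (hg0 : ∀ k, 0 ≤ g k) (hh : ∀ k, |h k| ≤ C) :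
    Summable fun p : Freq × Freq => f (p.1 - p.2) * g p.2 * h p.1 := by
  refine Summable.of_norm_bounded ((summable_shear hf hg hf0 hg0).mul_right C) fun p => ?_
  rw [norm_mul, Real.norm_of_nonneg (mul_nonneg (hf0 _) (hg0 _))]
  exact mul_le_mul_of_nonneg_left (hh _) (mul_nonneg (hf0 _) (hg0 _))

/-- A crude bound with one derivative on each factor, sufficient whenever the coefficients decay
rapidly. -/
theorem norm_bil_term_le (hα : α ≤ 1) (k l : Freq) :
    ‖-Complex.I * (kern α (k - l) l : ℂ) * a (k - l) * b l‖ ≤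
      (freqNorm (k - l) * ‖a (k - l)‖) * (freqNorm l * ‖b l‖) := by
  rw [norm_mul, norm_mul, norm_mul, norm_neg, Complex.norm_I, one_mul, Complex.norm_real,
    Real.norm_eq_abs]
  calc _ ≤ (freqNorm (k - l) * freqNorm l) * ‖a (k - l)‖ * ‖b l‖ := by
        gcongr; exact abs_kern_le_mul hα _ _
    _ = _ := by ring

/-- An energy identity: in `⟨w B(a, d), w d⟩` the weight only enters through its commutator. -/
theorem tsum_energy_le (hα : α ≤ 1) (ha : IsSymm a) {w : Freq → ℝ} {C : ℝ} (hw0 : ∀ k, 0 ≤ w k)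
    (sa : Summable fun k => freqNorm k * ‖a k‖) (sd : Summable fun k => freqNorm k * ‖d k‖)
    (sw : Summable fun k => freqNorm k * (w k * ‖d k‖))
    (hC1 : ∀ k, w k * ‖d k‖ ≤ C) (hC2 : ∀ k, w k ^ 2 * ‖d k‖ ≤ C)
    {P : Freq × Freq → ℝ} (hP : Summable P)
    (hle : ∀ k l, |kern α (k - l) l| * |w k - w l| * (w k * ‖a (k - l)‖ * ‖d l‖ * ‖d k‖) ≤
      P (k, l)) :
    ∑' k, w k ^ 2 * (conj (d k) * Bil α a d k).re ≤ ∑' p, P p := by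
  have na : ∀ k, 0 ≤ freqNorm k * ‖a k‖ := fun k => mul_nonneg (freqNorm_nonneg k) (norm_nonneg _)
  have nd : ∀ k, 0 ≤ freqNorm k * ‖d k‖ := fun k => mul_nonneg (freqNorm_nonneg k) (norm_nonneg _)
  set T : Freq × Freq → ℂ := fun p =>
    -Complex.I * (kern α (p.1 - p.2) p.2 : ℂ) * a (p.1 - p.2) * d p.2 * conj (d p.1) with hT
  have hTn : ∀ p, ‖T p‖ ≤ (freqNorm (p.1 - p.2) * ‖a (p.1 - p.2)‖) * (freqNorm p.2 * ‖d p.2‖) *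
      ‖d p.1‖ := fun p => by
    rw [hT]
    simp only [norm_mul _ (conj (d p.1)), RCLike.norm_conj]
    exact mul_le_mul_of_nonneg_right (norm_bil_term_le hα p.1 p.2) (norm_nonneg _)
  have s1 : Summable fun p => ((w p.1 ^ 2 : ℝ) : ℂ) * T p := by
    refine Summable.of_norm_bounded (summable_shear_bounded (h := fun k => w k ^ 2 * ‖d k‖) (C := C)
      sa sd na nd fun k => ?_) fun p => ?_
    · rw [abs_of_nonneg (by positivity)]; exact hC2 k
    · rw [norm_mul, Complex.norm_real, Real.norm_of_nonneg (by positivity)]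
      calc _ ≤ w p.1 ^ 2 * _ := mul_le_mul_of_nonneg_left (hTn p) (by positivity)
        _ = _ := by ring
  have s2 : Summable fun p => ((w p.1 * w p.2 : ℝ) : ℂ) * T p := by
    refine Summable.of_norm_bounded (summable_shear_bounded (h := fun k => w k * ‖d k‖) (C := C)
      sa sw na (fun k => ?_) fun k => ?_) fun p => ?_
    · exact mul_nonneg (freqNorm_nonneg k) (mul_nonneg (hw0 k) (norm_nonneg _))
    · rw [abs_of_nonneg (mul_nonneg (hw0 k) (norm_nonneg _))]; exact hC1 k
    · have h2 := mul_nonneg (hw0 p.1) (hw0 p.2)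
      rw [norm_mul, Complex.norm_real, Real.norm_of_nonneg h2]
      calc _ ≤ (w p.1 * w p.2) * _ := mul_le_mul_of_nonneg_left (hTn p) h2
        _ = _ := by ring
  -- The symmetric expression with w(k)w(l) is the transport form of the sequence wd, which
  -- vanishes. Subtracting it replaces w(k)² by w(k)(w(k) - w(l)).
  have e2 : (∑' p, ((w p.1 * w p.2 : ℝ) : ℂ) * T p).re = 0 := by
    rw [← re_tsum_transport_eq_zero (α := α) ha (fun k => (w k : ℂ) * d k)]
    congr 1
    refine tsum_congr fun p => ?_
    simp only [hT, map_mul, Complex.conj_ofReal]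
    push_cast
    ring
  have e1 : ∑' k, w k ^ 2 * (conj (d k) * Bil α a d k).re =
      (∑' p, ((w p.1 ^ 2 : ℝ) : ℂ) * T p).re := by
    rw [s1.tsum_prod, Complex.re_tsum s1.prod]
    refine tsum_congr fun k => ?_
    rw [← Complex.re_ofReal_mul]
    congr 1
    rw [Bil, ← tsum_mul_left, ← tsum_mul_left]
    refine tsum_congr fun l => ?_
    simp only [hT]
    ring
  have e3 : ∑' k, w k ^ 2 * (conj (d k) * Bil α a d k).re =
      (∑' p, (((w p.1 ^ 2 : ℝ) : ℂ) * T p - ((w p.1 * w p.2 : ℝ) : ℂ) * T p)).re := by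
    rw [s1.tsum_sub s2, Complex.sub_re, e2, sub_zero, e1]
  rw [e3]
  refine (Complex.re_le_norm _).trans (tsum_of_norm_bounded hP.hasSum fun p => ?_)
  refine le_trans (le_of_eq ?_) (hle p.1 p.2)
  rw [← sub_mul, norm_mul, ← Complex.ofReal_sub, Complex.norm_real, Real.norm_eq_abs,
    show w p.1 ^ 2 - w p.1 * w p.2 = w p.1 * (w p.1 - w p.2) by ring, abs_mul,
    abs_of_nonneg (hw0 _)]
  simp only [hT, norm_mul, norm_neg, Complex.norm_I, Complex.norm_real, Real.norm_eq_abs,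
    RCLike.norm_conj]
  ring

theorem tsum_mul_re_le {w : Freq → ℝ} {C : ℝ} (hα : α ≤ 1)
    (sa : Summable fun k => freqNorm k * ‖a k‖) (sb : Summable fun k => freqNorm k * ‖b k‖)
    (hC : ∀ k, w k ^ 2 * ‖d k‖ ≤ C)
    {P : Freq × Freq → ℝ} (hP : Summable P)
    (hle : ∀ k l, |kern α (k - l) l| * (w k ^ 2 * ‖a (k - l)‖ * ‖b l‖ * ‖d k‖) ≤ P (k, l)) :
    ∑' k, w k ^ 2 * (conj (d k) * Bil α a b k).re ≤ ∑' p, P p := by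
  have na : ∀ k, 0 ≤ freqNorm k * ‖a k‖ := fun k => mul_nonneg (freqNorm_nonneg k) (norm_nonneg _)
  have nb : ∀ k, 0 ≤ freqNorm k * ‖b k‖ := fun k => mul_nonneg (freqNorm_nonneg k) (norm_nonneg _)
  set T : Freq × Freq → ℂ := fun p => ((w p.1 ^ 2 : ℝ) : ℂ) *
    (-Complex.I * (kern α (p.1 - p.2) p.2 : ℂ) * a (p.1 - p.2) * b p.2 * conj (d p.1)) with hT
  have s1 : Summable T := by
    refine Summable.of_norm_bounded (summable_shear_bounded (h := fun k => w k ^ 2 * ‖d k‖) (C := C)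
      sa sb na nb fun k => ?_) fun p => ?_
    · rw [abs_of_nonneg (by positivity)]; exact hC k
    · simp only [hT]
      rw [norm_mul, norm_mul _ (conj _), RCLike.norm_conj, Complex.norm_real,
        Real.norm_of_nonneg (by positivity)]
      calc _ ≤ w p.1 ^ 2 * (_ * ‖d p.1‖) := mul_le_mul_of_nonneg_left
            (mul_le_mul_of_nonneg_right (norm_bil_term_le hα p.1 p.2) (norm_nonneg _))
            (by positivity)
        _ = _ := by ring
  have e1 : ∑' k, w k ^ 2 * (conj (d k) * Bil α a b k).re = (∑' p, T p).re := by
    rw [s1.tsum_prod, Complex.re_tsum s1.prod]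
    refine tsum_congr fun k => ?_
    rw [← Complex.re_ofReal_mul]
    congr 1
    rw [Bil, ← tsum_mul_left, ← tsum_mul_left]
    refine tsum_congr fun l => ?_
    simp only [hT]
    ring
  rw [e1]
  refine (Complex.re_le_norm _).trans (tsum_of_norm_bounded hP.hasSum fun p => ?_)
  refine le_trans (le_of_eq ?_) (hle p.1 p.2)
  simp only [hT, norm_mul, norm_neg, Complex.norm_I, Complex.norm_real, Real.norm_eq_abs,
    RCLike.norm_conj, abs_of_nonneg (sq_nonneg (w p.1))]
  ring

end energy

end SIPM
end

noncomputable section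

namespace SIPM

open ComplexConjugate

/-! ### Trilinear estimates for solutions and for differences -/

section estimates

variable {α σ : ℝ} {a b d : Freq → ℂ}

/-- The constant in the trilinear estimate in Gevrey spaces. -/
def energyConst (r τ : ℝ) : ℝ :=
  2 * (2 ^ r * (τ + r + 2)) * Real.sqrt (∑' k : Freq, (freqNorm k ^ (2 - r)) ^ 2)

theorem energyConst_mono {r τ τ' : ℝ} (h : τ ≤ τ') : energyConst r τ ≤ energyConst r τ' := by
  unfold energyConst
  gcongr

theorem summable_freqNorm_rpow_sq {r : ℝ} (hr : 3 < r) :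
    Summable fun k : Freq => (freqNorm k ^ (2 - r)) ^ 2 := by
  refine (summable_freqNorm_rpow (p := 2 * (2 - r)) (by linarith)).congr fun k => ?_
  rw [← Real.rpow_natCast, ← Real.rpow_mul (freqNorm_nonneg k)]
  congr 1
  push_cast
  ring

/-- The trilinear estimate for trigonometric polynomials. -/
theorem gevrey_energy_le {r τ : ℝ} (hr : 3 < r) (hα1 : α ≤ 1) (hασ : α ≤ σ) (hσ0 : 0 ≤ σ)
    (hσ : σ ≤ 1) (hτ : 0 ≤ τ) (ha : IsSymm a) (ha0 : a 0 = 0) (hfin : (Function.support a).Finite) :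
    ∑' k, gevW r τ σ (freqNorm k) ^ 2 * (conj (a k) * Bil α a a k).re ≤
      energyConst r τ * Real.sqrt (∑' k, (gevW r τ σ (freqNorm k) * ‖a k‖) ^ 2) *
        ∑' k, (freqNorm k ^ (σ / 2) * (gevW r τ σ (freqNorm k) * ‖a k‖)) ^ 2 := by
  have hs : ∀ f : Freq → ℝ, (∀ k, a k = 0 → f k = 0) → Summable f := fun f hf =>
    summable_of_hasFiniteSupport (hfin.subset fun k hk => fun h => hk (hf k h))
  have hw0 : ∀ k : Freq, 0 ≤ gevW r τ σ (freqNorm k) := fun k => gevW_nonneg _ _ _ (freqNorm_nonneg k)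
  have hb : ∀ f : Freq → ℝ, (∀ k, a k = 0 → f k = 0) → ∃ C, ∀ k, f k ≤ C := fun f hf => by
    obtain ⟨C, hC⟩ := (hfin.image f).bddAbove
    refine ⟨max C 0, fun k => ?_⟩
    by_cases hk : a k = 0
    · rw [hf k hk]; exact le_max_right _ _
    · exact (hC ⟨k, hk, rfl⟩).trans (le_max_left _ _)
  obtain ⟨C1, hC1⟩ := hb (fun k => gevW r τ σ (freqNorm k) * ‖a k‖) (by intro k hk; simp [hk])
  obtain ⟨C2, hC2⟩ := hb (fun k => gevW r τ σ (freqNorm k) ^ 2 * ‖a k‖) (by intro k hk; simp [hk])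
  set X : Freq → ℝ := fun k => freqNorm k ^ 2 * expW τ σ (freqNorm k) * ‖a k‖ with hX
  set Y : Freq → ℝ := fun k => freqNorm k ^ (σ / 2) * (gevW r τ σ (freqNorm k) * ‖a k‖) with hY
  have hX0 : ∀ k, 0 ≤ X k := fun k => by
    have := expW_pos τ σ (freqNorm k); positivity
  have hY0 : ∀ k, 0 ≤ Y k := fun k =>
    mul_nonneg (Real.rpow_nonneg (freqNorm_nonneg k) _) (mul_nonneg (hw0 k) (norm_nonneg _))
  have sX : Summable X := hs X (by intro k hk; simp [hX, hk])
  have sY : Summable fun k => Y k ^ 2 := hs _ (by intro k hk; simp [hY, hk])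
  obtain ⟨p1, q1⟩ := schur_shear sX sY hX0 hY0
  obtain ⟨p2, q2⟩ := schur_shear' sX sY hX0 hY0
  set c : ℝ := 2 ^ r * (τ + r + 2) with hc
  have hc0 : 0 ≤ c := by positivity
  have key := tsum_energy_le (α := α) (a := a) (d := a) (C := max C1 C2)
    (w := fun k => gevW r τ σ (freqNorm k)) hα1 ha hw0
    (hs _ (by intro k hk; simp [hk])) (hs _ (by intro k hk; simp [hk]))
    (hs _ (by intro k hk; simp [hk])) (fun k => (hC1 k).trans (le_max_left _ _))
    (fun k => (hC2 k).trans (le_max_right _ _)) ((p1.add p2).mul_left c) (fun k l => by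
      have hP : 0 ≤ c * (X (k - l) * (Y l * Y k) + X l * (Y (k - l) * Y k)) :=
        mul_nonneg hc0 (add_nonneg (mul_nonneg (hX0 _) (mul_nonneg (hY0 _) (hY0 _)))
          (mul_nonneg (hX0 _) (mul_nonneg (hY0 _) (hY0 _))))
      by_cases hk : k = 0
      · subst hk; simpa [ha0] using hP
      by_cases hl : l = 0
      · subst hl; simpa [ha0] using hP
      by_cases hj : k - l = 0
      · rw [hj] at hP ⊢; simpa [kern_zero_left, ha0] using hP
      have h1 := kern_mul_gevW_sub_le (r := r) (by linarith) hα1 hασ hσ0 hσ hτ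
        (sub_add_cancel k l).symm hj hk hl
      have h2 : 0 ≤ gevW r τ σ (freqNorm k) * ‖a (k - l)‖ * ‖a l‖ * ‖a k‖ := by
        have := hw0 k; positivity
      refine (mul_le_mul_of_nonneg_right h1 h2).trans (le_of_eq ?_)
      simp only [hX, hY, hc]
      ring)
  -- Cauchy–Schwarz after writing |k|² = |k|^(2-r) |k|^r; the hypothesis r > 3 is the convergence of
  -- the first factor.
  have hXs : ∑' k, X k ≤ Real.sqrt (∑' k : Freq, (freqNorm k ^ (2 - r)) ^ 2) *
      Real.sqrt (∑' k, (gevW r τ σ (freqNorm k) * ‖a k‖) ^ 2) := by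
    have e : ∀ k, X k = freqNorm k ^ (2 - r) * (gevW r τ σ (freqNorm k) * ‖a k‖) := fun k => by
      by_cases hk : k = 0
      · subst hk; simp [hX, ha0]
      · have hp : 0 < freqNorm k := by linarith [one_le_freqNorm hk]
        have : freqNorm k ^ 2 = freqNorm k ^ (2 - r) * freqNorm k ^ r := by
          rw [← Real.rpow_add hp, sub_add_cancel, ← Real.rpow_natCast]; norm_num
        simp only [hX, gevW, this]
        ring
    have z : ∀ k ∉ hfin.toFinset, a k = 0 := fun k hk => by simpa using hk
    rw [tsum_eq_sum (s := hfin.toFinset) (fun k hk => by simp [hX, z k hk])]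
    rw [Finset.sum_congr rfl fun k _ => e k]
    refine (Real.sum_mul_le_sqrt_mul_sqrt _ _ _).trans ?_
    gcongr
    · exact (summable_freqNorm_rpow_sq hr).sum_le_tsum _ fun k _ => sq_nonneg _
    · exact (hs _ (by intro k hk; simp [hk])).sum_le_tsum _ fun k _ => sq_nonneg _
  have hYs : 0 ≤ ∑' k, Y k ^ 2 := tsum_nonneg fun k => sq_nonneg _
  calc _ ≤ _ := key
    _ = c * (∑' p : Freq × Freq, X (p.1 - p.2) * (Y p.2 * Y p.1) +
        ∑' p : Freq × Freq, X p.2 * (Y (p.1 - p.2) * Y p.1)) := by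
        rw [tsum_mul_left, p1.tsum_add p2]
    _ ≤ c * ((∑' k, X k) * ∑' k, Y k ^ 2 + (∑' k, X k) * ∑' k, Y k ^ 2) := by gcongr
    _ = 2 * c * (∑' k, X k) * ∑' k, Y k ^ 2 := by ring
    _ ≤ 2 * c * (Real.sqrt (∑' k : Freq, (freqNorm k ^ (2 - r)) ^ 2) *
      Real.sqrt (∑' k, (gevW r τ σ (freqNorm k) * ‖a k‖) ^ 2)) * ∑' k, Y k ^ 2 := by gcongr
    _ = _ := by rw [energyConst]; ring

/-- The energy estimate for the difference of two solutions. -/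
theorem difference_energy_le {δ : ℝ} (hα1 : α ≤ 1) (hασ : α ≤ σ) (hσ0 : 0 ≤ σ)
    (hσ : σ ≤ 1) (hδ : 0 ≤ δ) (ha : IsSymm a) (hd0 : d 0 = 0) (hb0 : b 0 = 0)
    (ra : Rapid fun k => expW δ σ (freqNorm k) * ‖a k‖)
    (rb : Rapid fun k => expW δ σ (freqNorm k) * ‖b k‖)
    (rd : Rapid fun k => expW δ σ (freqNorm k) ^ 2 * ‖d k‖) :
    ∑' k, expW δ σ (freqNorm k) ^ 2 * (conj (d k) * Bil α a d k).re +
      ∑' k, expW δ σ (freqNorm k) ^ 2 * (conj (d k) * Bil α d b k).re ≤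
      (δ * (∑' k, freqNorm k ^ 2 * (expW δ σ (freqNorm k) * ‖a k‖)) +
        2 * ∑' k, freqNorm k ^ 2 * (expW δ σ (freqNorm k) * ‖b k‖)) *
        ∑' k, (freqNorm k ^ (σ / 2) * (expW δ σ (freqNorm k) * ‖d k‖)) ^ 2 := by
  set w : Freq → ℝ := fun k => expW δ σ (freqNorm k) with hw
  have hw1 : ∀ k, 1 ≤ w k := fun k => one_le_expW hδ (freqNorm_nonneg k)
  have hw0 : ∀ k, 0 ≤ w k := fun k => zero_le_one.trans (hw1 k)
  have low : ∀ {f : Freq → ℂ}, Rapid (fun k => w k * ‖f k‖) → Rapid fun k => ‖f k‖ :=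
    fun h => h.of_le (fun k => norm_nonneg _) fun k => le_mul_of_one_le_left (norm_nonneg _) (hw1 k)
  have rwd : Rapid fun k => w k * ‖d k‖ := rd.of_le
    (fun k => mul_nonneg (hw0 k) (norm_nonneg _)) fun k => by
      have : w k ≤ w k ^ 2 := by nlinarith [hw1 k]
      exact mul_le_mul_of_nonneg_right this (norm_nonneg _)
  have nwd : ∀ k, 0 ≤ w k * ‖d k‖ := fun k => mul_nonneg (hw0 k) (norm_nonneg _)
  have nwa : ∀ k, 0 ≤ w k * ‖a k‖ := fun k => mul_nonneg (hw0 k) (norm_nonneg _)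
  have nwb : ∀ k, 0 ≤ w k * ‖b k‖ := fun k => mul_nonneg (hw0 k) (norm_nonneg _)
  have bd : ∀ {f : Freq → ℝ}, Summable f → (∀ k, 0 ≤ f k) → ∀ k, f k ≤ ∑' l, f l :=
    fun hf h0 k => hf.le_tsum k fun l _ => h0 l
  have hC1 := bd rwd.summable nwd
  have hC2 := bd rd.summable fun k => mul_nonneg (sq_nonneg _) (norm_nonneg _)
  set Y : Freq → ℝ := fun k => freqNorm k ^ (σ / 2) * (w k * ‖d k‖) with hY
  have hY0 : ∀ k, 0 ≤ Y k := fun k => mul_nonneg (Real.rpow_nonneg (freqNorm_nonneg k) _) (nwd k)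
  have sY : Summable fun k => Y k ^ 2 := by
    refine ((rwd.mul_left nwd).summable.mul_left (∑' k, w k * ‖d k‖)).of_nonneg_of_le
      (fun k => sq_nonneg _) fun k => ?_
    by_cases hk : k = 0
    · subst hk; simp [hY, hd0]
    · have h1 : (freqNorm k ^ (σ / 2)) ^ 2 ≤ freqNorm k := by
        rw [← Real.rpow_natCast, ← Real.rpow_mul (freqNorm_nonneg k)]
        exact freqNorm_rpow_le_self (by push_cast; linarith) hk
      have h2 := nwd k
      calc Y k ^ 2 = (freqNorm k ^ (σ / 2)) ^ 2 * ((w k * ‖d k‖) * (w k * ‖d k‖)) := by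
            simp only [hY]; ring
        _ ≤ freqNorm k * ((∑' k, w k * ‖d k‖) * (w k * ‖d k‖)) := by
            have h3 := hC1 k
            have h4 := freqNorm_nonneg k
            gcongr
        _ = _ := by ring
  have sXa := (ra.pow_mul nwa 2).summable
  have sXb := (rb.pow_mul nwb 2).summable
  obtain ⟨p1, q1⟩ := schur_shear sXa sY (fun k => mul_nonneg (sq_nonneg _) (nwa k)) hY0
  obtain ⟨p2, q2⟩ := schur_shear' sXb sY (fun k => mul_nonneg (sq_nonneg _) (nwb k)) hY0
  have k1 := tsum_energy_le (α := α) (a := a) (d := d)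
    (C := max (∑' k, w k * ‖d k‖) (∑' k, w k ^ 2 * ‖d k‖)) (w := w) hα1 ha hw0
    ((low ra).mul_left fun k => norm_nonneg _).summable
    ((low rwd).mul_left fun k => norm_nonneg _).summable
    (rwd.mul_left nwd).summable (fun k => (hC1 k).trans (le_max_left _ _))
    (fun k => (hC2 k).trans (le_max_right _ _)) (p1.mul_left δ) (fun k l => by
      have hP : 0 ≤ δ * (freqNorm (k - l) ^ 2 * (w (k - l) * ‖a (k - l)‖) * (Y l * Y k)) :=
        mul_nonneg hδ (mul_nonneg (mul_nonneg (sq_nonneg _) (nwa _))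
          (mul_nonneg (hY0 _) (hY0 _)))
      by_cases hk : k = 0
      · subst hk; simpa [hd0, hw] using hP
      by_cases hl : l = 0
      · subst hl; simpa [hd0] using hP
      by_cases hj : k - l = 0
      · rw [hj]; simp [kern_zero_left]
      have h1 := kern_mul_expW_sub_le hα1 hσ0 hσ hδ
        (sub_add_cancel k l).symm hj hk hl
      have h2 : 0 ≤ w k * ‖a (k - l)‖ * ‖d l‖ * ‖d k‖ := by
        have := hw0 k; positivity
      refine (mul_le_mul_of_nonneg_right h1 h2).trans (le_of_eq ?_)
      simp only [hY, hw]
      ring)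
  have k2 := tsum_mul_re_le (α := α) (a := d) (b := b) (d := d)
    (C := ∑' k, w k ^ 2 * ‖d k‖) (w := w) hα1
    ((low rwd).mul_left fun k => norm_nonneg _).summable
    ((low rb).mul_left fun k => norm_nonneg _).summable
    hC2 (p2.mul_left 2) (fun k l => by
      have hP : 0 ≤ 2 * (freqNorm l ^ 2 * (w l * ‖b l‖) * (Y (k - l) * Y k)) :=
        mul_nonneg zero_le_two (mul_nonneg (mul_nonneg (sq_nonneg _) (nwb _))
          (mul_nonneg (hY0 _) (hY0 _)))
      by_cases hk : k = 0
      · subst hk; simpa [hd0] using hP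
      by_cases hl : l = 0
      · subst hl; simp [hb0]
      by_cases hj : k - l = 0
      · rw [hj] at hP ⊢; simpa [kern_zero_left] using hP
      have h1 := kern_mul_expW_le hασ hσ0 hσ hδ (sub_add_cancel k l).symm hj hk hl
      have h2 : 0 ≤ w k * ‖d (k - l)‖ * ‖b l‖ * ‖d k‖ := by
        have := hw0 k; positivity
      calc |kern α (k - l) l| * (w k ^ 2 * ‖d (k - l)‖ * ‖b l‖ * ‖d k‖)
          = |kern α (k - l) l| * w k * (w k * ‖d (k - l)‖ * ‖b l‖ * ‖d k‖) := by ring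
        _ ≤ _ := mul_le_mul_of_nonneg_right h1 h2
        _ = _ := by
          simp only [hY, hw]
          ring)
  rw [tsum_mul_left] at k1 k2
  refine (add_le_add k1 k2).trans ?_
  rw [add_mul, mul_assoc, mul_assoc]
  exact add_le_add (mul_le_mul_of_nonneg_left q1 hδ) (mul_le_mul_of_nonneg_left q2 zero_le_two)

end estimates

end SIPM
end

/-! ### The truncated system and its solvability -/

noncomputable section

namespace SIPM

open ComplexConjugate

theorem kern_neg_right (α : ℝ) (j l : Freq) : kern α j (-l) = -kern α j l := by
  simp only [kern, Pi.neg_apply]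
  push_cast
  ring

theorem IsSymm.bil {α : ℝ} {a b : Freq → ℂ} (ha : IsSymm a) (hb : IsSymm b) :
    IsSymm (Bil α a b) := by
  intro k
  rw [Bil, Bil, Complex.conj_tsum, ← (Equiv.neg Freq).tsum_eq]
  refine tsum_congr fun l => ?_
  rw [Equiv.neg_apply, show -k - -l = -(k - l) by abel, ha, hb, kern_neg_left, kern_neg_right]
  simp only [map_mul, map_neg, Complex.conj_I, Complex.conj_ofReal]
  push_cast
  ring

theorem bil_eq_sum (α : ℝ) (a : Freq → ℂ) {b : Freq → ℂ} {S : Finset Freq}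
    (hb : ∀ k ∉ S, b k = 0) (k : Freq) :
    Bil α a b k = ∑ l ∈ S, -Complex.I * (kern α (k - l) l : ℂ) * a (k - l) * b l :=
  tsum_eq_sum fun l hl => by rw [hb l hl, mul_zero]

section galerkin

variable {S : Finset Freq}

/-- Extension of a finite family of coefficients by zero. -/
def extend (x : S → ℂ) (k : Freq) : ℂ := if h : k ∈ S then x ⟨k, h⟩ else 0

theorem extend_of_notMem (x : S → ℂ) {k : Freq} (h : k ∉ S) : extend x k = 0 := dif_neg h

theorem extend_of_mem (x : S → ℂ) {k : Freq} (h : k ∈ S) : extend x k = x ⟨k, h⟩ := dif_pos h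

theorem contDiff_extend (k : Freq) : ContDiff ℝ 1 fun x : S → ℂ => extend x k := by
  by_cases h : k ∈ S
  · simp only [extend_of_mem _ h]; fun_prop
  · simp only [extend_of_notMem _ h]; fun_prop

/-- The projection of a finite family of coefficients to the symmetric ones. -/
def symmetrize (hS : ∀ k ∈ S, -k ∈ S) : (S → ℂ) →L[ℝ] (S → ℂ) :=
  LinearMap.toContinuousLinearMap
    { toFun := fun x k => (1 / 2 : ℝ) • (x k + conj (x ⟨-k.1, hS _ k.2⟩))
      map_add' := fun x y => by
        ext k
        simp only [Pi.add_apply, map_add, smul_add]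
        abel
      map_smul' := fun c x => by
        ext k
        simp only [Pi.smul_apply, Complex.real_smul, map_mul, Complex.conj_ofReal, RingHom.id_apply]
        ring }

theorem symmetrize_apply (hS : ∀ k ∈ S, -k ∈ S) (x : S → ℂ) (k : S) :
    symmetrize hS x k = (1 / 2 : ℝ) • (x k + conj (x ⟨-k.1, hS _ k.2⟩)) := rfl

theorem isSymm_extend_symmetrize (hS : ∀ k ∈ S, -k ∈ S) (x : S → ℂ) :
    IsSymm (extend (symmetrize hS x)) := by
  intro k
  by_cases h : k ∈ S
  · rw [extend_of_mem _ h, extend_of_mem _ (hS k h), symmetrize_apply, symmetrize_apply]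
    simp only [Complex.real_smul, map_mul, map_add, Complex.conj_conj, Complex.conj_ofReal, neg_neg]
    ring
  · have h' : -k ∉ S := fun h' => h (by simpa using hS _ h')
    rw [extend_of_notMem _ h, extend_of_notMem _ h', map_zero]

theorem symmetrize_eq_self (hS : ∀ k ∈ S, -k ∈ S) {x : S → ℂ} (hx : IsSymm (extend x)) :
    symmetrize hS x = x := by
  ext k
  have h := hx k.1
  rw [extend_of_mem _ k.2, extend_of_mem _ (hS _ k.2)] at h
  rw [symmetrize_apply, h, Complex.conj_conj, Complex.real_smul]
  push_cast
  ring

/-- Solutions of the Galerkin system with a cutoff `χ`. -/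
theorem exists_galerkin (α : ℝ) (hS : ∀ k ∈ S, -k ∈ S) {a₀ : Freq → ℂ} (ha₀ : IsSymm a₀)
    (hsupp : ∀ k ∉ S, a₀ k = 0) {R T : ℝ} (hR : 0 < R) (hT : 0 < T) :
    ∃ (a : ℝ → Freq → ℂ) (χ : ℝ → ℝ), a 0 = a₀ ∧ (∀ t, IsSymm (a t)) ∧
      (∀ t, ∀ k ∉ S, a t k = 0) ∧ (∀ t, 0 ≤ χ t ∧ χ t ≤ 1) ∧
      (∀ t, (∀ k, ‖a t k‖ ≤ R) → χ t = 1) ∧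
      ∀ t ∈ Set.Icc 0 T, ∀ k ∈ S,
        HasDerivWithinAt (fun t => a t k) ((χ t : ℂ) * Bil α (a t) (a t) k) (Set.Icc 0 T) t := by
  -- The cutoff makes the quadratic field bounded and globally Lipschitz, hence solvable on all of
  -- [0, T]. The a priori bound later shows that it is never active.
  let f : ContDiffBump (0 : S → ℂ) := ⟨R, R + 1, hR, by linarith⟩
  let F : (S → ℂ) → (S → ℂ) := fun x k => Bil α (extend x) (extend x) k
  have hF : ContDiff ℝ 1 F := by
    refine contDiff_pi.2 fun k => ?_
    have : (fun x : S → ℂ => F x k) = fun x =>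
        ∑ l ∈ S, -Complex.I * (kern α (k - l) l : ℂ) * extend x (k - l) * extend x l := by
      ext x; exact bil_eq_sum α _ (fun k hk => extend_of_notMem x hk) _
    rw [this]
    exact ContDiff.sum fun l _ => (contDiff_const.mul (contDiff_extend _)).mul (contDiff_extend _)
  let Φ : (S → ℂ) → (S → ℂ) := fun y => f y • F y
  have hΦ : ContDiff ℝ 1 Φ := f.contDiff.smul hF
  have hΦc : HasCompactSupport Φ := f.hasCompactSupport.smul_right
  obtain ⟨K, hK⟩ := hΦ.lipschitzWith_of_hasCompactSupport hΦc one_ne_zero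
  obtain ⟨L, hL⟩ := hΦc.exists_bound_of_continuous hΦ.continuous
  let x₀ : S → ℂ := fun k => a₀ k
  have hx₀ : extend x₀ = a₀ := by
    ext k
    by_cases h : k ∈ S
    · rw [extend_of_mem _ h]
    · rw [extend_of_notMem _ h, hsupp k h]
  -- The field is composed with the projection to symmetric families, and the projected curve is the
  -- desired solution. Its symmetry is thus automatic and need not be propagated by the flow.
  have hpl : IsPicardLindelof (fun _ : ℝ => Φ ∘ symmetrize hS) (tmin := 0) (tmax := T)
      ⟨0, le_rfl, hT.le⟩ x₀ (L.toNNReal * T.toNNReal) 0 L.toNNReal (K * ‖symmetrize hS‖₊) :=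
    { lipschitzOnWith := fun _ _ => (hK.comp (symmetrize hS).lipschitz).lipschitzOnWith
      continuousOn := fun _ _ => continuousOn_const
      norm_le := fun _ _ x _ => (hL _).trans (Real.le_coe_toNNReal L)
      mul_max_le := by simp [hT.le] }
  obtain ⟨γ, hγ0, hγ⟩ := hpl.exists_eq_forall_mem_Icc_hasDerivWithinAt₀
  refine ⟨fun t => extend (symmetrize hS (γ t)), fun t => f (symmetrize hS (γ t)), ?_,
    fun t => isSymm_extend_symmetrize hS _, fun t k hk => extend_of_notMem _ hk,
    fun t => ⟨f.nonneg, f.le_one⟩, fun t ht => ?_, fun t ht k hk => ?_⟩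
  · change extend (symmetrize hS (γ 0)) = a₀
    rw [show γ 0 = x₀ from hγ0, symmetrize_eq_self hS (by rwa [hx₀]), hx₀]
  · apply f.one_of_mem_closedBall
    rw [mem_closedBall_zero_iff, pi_norm_le_iff_of_nonneg hR.le]
    intro k
    simpa only [extend_of_mem _ k.2] using ht k.1
  · have h1 := (symmetrize hS).hasFDerivAt.comp_hasDerivWithinAt t (hγ t ht)
    -- The field preserves symmetry, so projecting the equation changes nothing.
    have h2 : symmetrize hS (Φ (symmetrize hS (γ t))) = Φ (symmetrize hS (γ t)) := by
      apply symmetrize_eq_self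
      have h3 : extend (Φ (symmetrize hS (γ t))) = fun k => if k ∈ S then
          (f (symmetrize hS (γ t)) : ℂ) * Bil α (extend (symmetrize hS (γ t)))
            (extend (symmetrize hS (γ t))) k else 0 := by
        ext k
        by_cases h : k ∈ S
        · rw [extend_of_mem _ h, if_pos h]; rfl
        · rw [extend_of_notMem _ h, if_neg h]
      have h4 := isSymm_extend_symmetrize hS (γ t)
      have h5 := h4.bil (α := α) h4
      intro k
      rw [h3]
      by_cases h : k ∈ S
      · simp only [if_pos h, if_pos (hS k h), h5 k, map_mul, Complex.conj_ofReal]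
      · have h' : -k ∉ S := fun h' => h (by simpa using hS _ h')
        simp only [if_neg h, if_neg h', map_zero]
    have h6 := (hasDerivWithinAt_pi.1 h1) ⟨k, hk⟩
    simp only [Function.comp_def, extend_of_mem _ hk] at h6 ⊢
    rw [h2] at h6
    exact h6

end galerkin

end SIPM
end

/-! ### A priori bounds uniform in the truncation -/

noncomputable section

namespace SIPM

open ComplexConjugate

theorem one_le_gevW {r τ σ x : ℝ} (hr : 0 ≤ r) (hτ : 0 ≤ τ) (hx : 1 ≤ x) : 1 ≤ gevW r τ σ x :=
  one_le_mul_of_one_le_of_one_le (Real.one_le_rpow hx hr) (one_le_expW hτ (by linarith))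

theorem gevW_mono_left {r τ τ' σ x : ℝ} (h : τ ≤ τ') (hx : 0 ≤ x) :
    gevW r τ σ x ≤ gevW r τ' σ x :=
  mul_le_mul_of_nonneg_left (expW_mono_left h hx) (Real.rpow_nonneg hx r)

theorem hasDerivAt_gevW_sq (r τ lam σ x t : ℝ) :
    HasDerivAt (fun t => gevW r (τ - lam * t) σ x ^ 2)
      (-(2 * lam * x ^ σ) * gevW r (τ - lam * t) σ x ^ 2) t := by
  have h1 : HasDerivAt (fun t : ℝ => (τ - lam * t) * x ^ σ) (-lam * x ^ σ) t := by
    simpa using (((hasDerivAt_id t).const_mul lam).const_sub τ).mul_const (x ^ σ)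
  have h2 := ((h1.exp.const_mul (x ^ r)).pow 2)
  refine h2.congr_deriv ?_
  simp only [gevW, expW]
  ring

theorem hasDerivWithinAt_norm_sq {f : ℝ → ℂ} {f' : ℂ} {s : Set ℝ} {t : ℝ}
    (h : HasDerivWithinAt f f' s t) :
    HasDerivWithinAt (fun t => ‖f t‖ ^ 2) (2 * (conj (f t) * f').re) s t := by
  have h1 := h.norm_sq
  rw [Complex.inner, mul_comm f'] at h1
  exact h1

theorem sq_freqNorm_rpow_half (k : Freq) (σ : ℝ) :
    (freqNorm k ^ (σ / 2)) ^ 2 = freqNorm k ^ σ := by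
  rw [← Real.rpow_natCast, ← Real.rpow_mul (freqNorm_nonneg k)]
  congr 1
  push_cast
  ring

/-- The a priori estimate for the Galerkin system, on a time interval that does not depend on the
truncation. -/
theorem exists_galerkin_bounded {r α σ K τ₀ : ℝ} (hr : 3 < r) (hα1 : α ≤ 1) (hασ : α ≤ σ)
    (hσ0 : 0 ≤ σ) (hσ : σ ≤ 1) (hK : 0 < K) (hτ₀ : 0 < τ₀) :
    ∃ T : ℝ, 0 < T ∧ ∀ (S : Finset Freq) (a₀ : Freq → ℂ), (∀ k ∈ S, -k ∈ S) → 0 ∉ S →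
      IsSymm a₀ → (∀ k ∉ S, a₀ k = 0) →
      ∑ k ∈ S, (gevW r τ₀ σ (freqNorm k) * ‖a₀ k‖) ^ 2 ≤ K ^ 2 →
      ∃ a : ℝ → Freq → ℂ, a 0 = a₀ ∧ (∀ t, IsSymm (a t)) ∧ (∀ t, ∀ k ∉ S, a t k = 0) ∧
        (∀ t ∈ Set.Icc 0 T, ∀ k ∈ S,
          HasDerivWithinAt (fun t => a t k) (Bil α (a t) (a t) k) (Set.Icc 0 T) t) ∧
        ∀ t ∈ Set.Icc 0 T,
          ∑ k ∈ S, (gevW r (τ₀ / 2) σ (freqNorm k) * ‖a t k‖) ^ 2 ≤ (2 * K) ^ 2 := by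
  set c : ℝ := energyConst r τ₀ with hc
  have hc0 : 0 ≤ c := by rw [hc, energyConst]; positivity
  -- As long as the energy is at most (2K)², the nonlinearity contributes at most 2c(2K)Z and the
  -- shrinking radius -2λZ; this λ makes the sum nonpositive.
  set lam : ℝ := 2 * K * c + 1 with hlam
  have hlam0 : 0 < lam := by positivity
  -- At this time exactly half of the radius has been used up.
  set T : ℝ := τ₀ / (2 * lam) with hT
  have hT0 : 0 < T := by positivity
  have hlT : lam * T = τ₀ / 2 := by rw [hT]; field_simp
  refine ⟨T, hT0, fun S a₀ hS hS0 ha₀ hsupp hE0 => ?_⟩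
  obtain ⟨a, χ, h0, hsym, hsup, hχ, hχ1, hder⟩ :=
    exists_galerkin α hS ha₀ hsupp (R := 2 * K) (T := T) (by positivity) hT0
  have hτ : ∀ t ∈ Set.Icc 0 T, τ₀ / 2 ≤ τ₀ - lam * t ∧ τ₀ - lam * t ≤ τ₀ := fun t ht => by
    have h1 : lam * t ≤ lam * T := mul_le_mul_of_nonneg_left ht.2 hlam0.le
    have h2 : 0 ≤ lam * t := mul_nonneg hlam0.le ht.1
    constructor <;> linarith
  set w : ℝ → Freq → ℝ := fun t k => gevW r (τ₀ - lam * t) σ (freqNorm k) with hw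
  set E : ℝ → ℝ := fun t => ∑ k ∈ S, w t k ^ 2 * ‖a t k‖ ^ 2 with hE
  set D : ℝ → ℝ := fun t => ∑ k ∈ S, (-(2 * lam * freqNorm k ^ σ) * w t k ^ 2 * ‖a t k‖ ^ 2 +
    w t k ^ 2 * (2 * (conj (a t k) * ((χ t : ℂ) * Bil α (a t) (a t) k)).re)) with hD
  have hED : ∀ t ∈ Set.Icc 0 T, HasDerivWithinAt E (D t) (Set.Icc 0 T) t := fun t ht =>
    HasDerivWithinAt.fun_sum fun k hk =>
      (hasDerivAt_gevW_sq r τ₀ lam σ (freqNorm k) t).hasDerivWithinAt.mul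
        (hasDerivWithinAt_norm_sq (hder t ht k hk))
  have hDle : ∀ t ∈ Set.Icc 0 T, E t ≤ (2 * K) ^ 2 → D t ≤ 0 := by
    intro t ht hEt
    obtain ⟨hτ1, hτ2⟩ := hτ t ht
    have ha0 : a t 0 = 0 := hsup t 0 hS0
    have hfin : (Function.support (a t)).Finite :=
      S.finite_toSet.subset fun k hk => by_contra fun h => hk (hsup t k h)
    have h1 := gevrey_energy_le (σ := σ) (τ := τ₀ - lam * t) hr hα1 hασ hσ0 hσ (by linarith)
      (hsym t) ha0 hfin
    rw [tsum_eq_sum (s := S) (fun k hk => by simp [hsup t k hk]),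
      tsum_eq_sum (s := S) (fun k hk => by simp [hsup t k hk]),
      tsum_eq_sum (s := S) (fun k hk => by simp [hsup t k hk])] at h1
    set Z : ℝ := ∑ k ∈ S, (freqNorm k ^ (σ / 2) * (w t k * ‖a t k‖)) ^ 2 with hZ
    have hZ0 : 0 ≤ Z := Finset.sum_nonneg fun k _ => sq_nonneg _
    set Q : ℝ := ∑ k ∈ S, w t k ^ 2 * (conj (a t k) * Bil α (a t) (a t) k).re with hQ
    have hQle : Q ≤ c * (2 * K) * Z := by
      refine h1.trans ?_
      have e1 : Real.sqrt (∑ k ∈ S, (w t k * ‖a t k‖) ^ 2) ≤ 2 * K := by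
        apply Real.sqrt_le_iff.2 ⟨by positivity, ?_⟩
        refine le_trans (le_of_eq (Finset.sum_congr rfl fun k _ => ?_)) hEt
        ring
      have e2 := energyConst_mono (r := r) hτ2
      gcongr
    have hDe : D t = -(2 * lam) * Z + 2 * (χ t * Q) := by
      simp only [hD, hZ, hQ, Finset.mul_sum, ← Finset.sum_add_distrib]
      refine Finset.sum_congr rfl fun k _ => ?_
      rw [mul_left_comm (conj _), Complex.re_ofReal_mul, mul_pow, sq_freqNorm_rpow_half]
      ring
    have hχQ : χ t * Q ≤ c * (2 * K) * Z := by
      have h3 : 0 ≤ c * (2 * K) * Z := by positivity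
      nlinarith [(hχ t).1, (hχ t).2]
    rw [hDe]
    have : c * (2 * K) * Z ≤ lam * Z := by
      apply mul_le_mul_of_nonneg_right _ hZ0
      rw [hlam]; linarith
    linarith
  have hEle : ∀ t ∈ Set.Icc 0 T, E t ≤ (2 * K) ^ 2 := by
    -- A barrier rising linearly from K² to (2K)². Its strictly positive slope turns the conditional
    -- inequality D ≤ 0 into a bound for all times.
    have hB : ∀ t, HasDerivAt (fun t => K ^ 2 + 3 * K ^ 2 / T * t) (3 * K ^ 2 / T) t := fun t => by
      simpa using ((hasDerivAt_id t).const_mul (3 * K ^ 2 / T)).const_add (K ^ 2)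
    have hB1 : ∀ t ∈ Set.Icc 0 T, K ^ 2 + 3 * K ^ 2 / T * t ≤ (2 * K) ^ 2 := fun t ht => by
      have : 3 * K ^ 2 / T * t ≤ 3 * K ^ 2 / T * T :=
        mul_le_mul_of_nonneg_left ht.2 (by positivity)
      rw [div_mul_cancel₀ _ hT0.ne'] at this
      linarith
    have := image_le_of_deriv_right_lt_deriv_boundary (f := E) (f' := D) (a := 0) (b := T)
      (fun t ht => (hED t ht).continuousWithinAt)
      (fun t ht => (hED t ⟨ht.1, ht.2.le⟩).mono_of_mem_nhdsWithin
        (Icc_mem_nhdsGE_of_mem ht))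
      (B := fun t => K ^ 2 + 3 * K ^ 2 / T * t) (B' := fun _ => 3 * K ^ 2 / T) ?_ hB ?_
    · intro t ht
      exact (this ht).trans (hB1 t ht)
    · simp only [hE, hw, h0, mul_zero, sub_zero, add_zero]
      refine le_trans (le_of_eq (Finset.sum_congr rfl fun k _ => ?_)) hE0
      ring
    · intro t ht hEB
      have ht' : t ∈ Set.Icc 0 T := ⟨ht.1, ht.2.le⟩
      have := hDle t ht' (hEB.le.trans (hB1 t ht'))
      have : 0 < 3 * K ^ 2 / T := by positivity
      linarith
  have hw1 : ∀ t ∈ Set.Icc 0 T, ∀ k ∈ S, 1 ≤ w t k := fun t ht k hk =>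
    one_le_gevW (by linarith) (by linarith [(hτ t ht).1])
      (one_le_freqNorm fun h => hS0 (h ▸ hk))
  -- All weights are at least 1 on the box, so the energy bound keeps every coefficient within 2K,
  -- the radius where the cutoff equals 1.
  have hχe : ∀ t ∈ Set.Icc 0 T, χ t = 1 := by
    intro t ht
    apply hχ1
    intro k
    by_cases hk : k ∈ S
    · have h1 : w t k ^ 2 * ‖a t k‖ ^ 2 ≤ E t :=
        Finset.single_le_sum (f := fun k => w t k ^ 2 * ‖a t k‖ ^ 2)
          (fun k _ => mul_nonneg (sq_nonneg _) (sq_nonneg _)) hk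
      have h2 : ‖a t k‖ ^ 2 ≤ w t k ^ 2 * ‖a t k‖ ^ 2 :=
        le_mul_of_one_le_left (sq_nonneg _) (one_le_pow₀ (hw1 t ht k hk))
      exact le_of_sq_le_sq (h2.trans (h1.trans (hEle t ht))) (by positivity)
    · rw [hsup t k hk, norm_zero]; positivity
  refine ⟨a, h0, hsym, hsup, fun t ht k hk => ?_, fun t ht => ?_⟩
  · have := hder t ht k hk
    rwa [hχe t ht, Complex.ofReal_one, one_mul] at this
  · refine le_trans (Finset.sum_le_sum fun k _ => ?_) (hEle t ht)
    rw [← mul_pow]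
    have := gevW_mono_left (r := r) (σ := σ) (hτ t ht).1 (freqNorm_nonneg k)
    have := gevW_nonneg r (τ₀ / 2) σ (freqNorm_nonneg k)
    gcongr

end SIPM
end

/-! ### Continuity of the nonlinearity and the limit of the truncations -/

noncomputable section

namespace SIPM

open ComplexConjugate Filter Topology

section bilinear

variable {α : ℝ} {a a' b b' : Freq → ℂ} {β γ : Freq → ℝ}

theorem summable_conv_freqNorm (hβ : Rapid β) (hγ : Rapid γ) (hβ0 : ∀ k, 0 ≤ β k)
    (hγ0 : ∀ k, 0 ≤ γ k) (k : Freq) :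
    Summable fun l => (freqNorm (k - l) * β (k - l)) * (freqNorm l * γ l) :=
  summable_conv_term (hβ.mul_left hβ0).summable (hγ.mul_left hγ0).summable
    (fun k => mul_nonneg (freqNorm_nonneg k) (hβ0 k))
    (fun k => mul_nonneg (freqNorm_nonneg k) (hγ0 k)) k

theorem norm_bil_term_le_of_le (hα : α ≤ 1) (ha : ∀ k, ‖a k‖ ≤ β k) (hb : ∀ k, ‖b k‖ ≤ γ k)
    (k l : Freq) :
    ‖-Complex.I * (kern α (k - l) l : ℂ) * a (k - l) * b l‖ ≤
      (freqNorm (k - l) * β (k - l)) * (freqNorm l * γ l) := by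
  refine (norm_bil_term_le hα k l).trans ?_
  have h1 := freqNorm_nonneg (k - l)
  have h2 := freqNorm_nonneg l
  have h3 := (norm_nonneg _).trans (ha (k - l))
  have := ha (k - l)
  have := hb l
  gcongr

theorem summable_bil_term (hα : α ≤ 1) (hβ : Rapid β) (hγ : Rapid γ) (ha : ∀ k, ‖a k‖ ≤ β k)
    (hb : ∀ k, ‖b k‖ ≤ γ k) (k : Freq) :
    Summable fun l => -Complex.I * (kern α (k - l) l : ℂ) * a (k - l) * b l :=
  Summable.of_norm_bounded (summable_conv_freqNorm hβ hγ (fun k => (norm_nonneg _).trans (ha k))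
    (fun k => (norm_nonneg _).trans (hb k)) k) fun l => norm_bil_term_le_of_le hα ha hb k l

theorem norm_bil_le (hα : α ≤ 1) (hβ : Rapid β) (hγ : Rapid γ) (ha : ∀ k, ‖a k‖ ≤ β k)
    (hb : ∀ k, ‖b k‖ ≤ γ k) (k : Freq) :
    ‖Bil α a b k‖ ≤ conv (fun k => freqNorm k * β k) (fun k => freqNorm k * γ k) k :=
  tsum_of_norm_bounded (summable_conv_freqNorm hβ hγ (fun k => (norm_nonneg _).trans (ha k))
    (fun k => (norm_nonneg _).trans (hb k)) k).hasSum fun l => norm_bil_term_le_of_le hα ha hb k l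

/-- The splitting is chosen so that the first term transports the difference by a solution, where
the energy cancellation applies, and the second has the difference only as velocity. -/
theorem bil_sub_bil (hα : α ≤ 1) (hβ : Rapid β) (ha : ∀ k, ‖a k‖ ≤ β k)
    (hb : ∀ k, ‖b k‖ ≤ β k) (k : Freq) :
    Bil α a a k - Bil α b b k =
      Bil α b (fun k => a k - b k) k + Bil α (fun k => a k - b k) a k := by
  have hab : ∀ k, ‖a k - b k‖ ≤ 2 * β k := fun k =>
    (norm_sub_le _ _).trans (by linarith [ha k, hb k])
  have hβ2 := hβ.const_mul 2
  rw [Bil, Bil, Bil, Bil, ← (summable_bil_term hα hβ hβ ha ha k).tsum_sub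
    (summable_bil_term hα hβ hβ hb hb k), ← (summable_bil_term hα hβ hβ2 hb hab k).tsum_add
    (summable_bil_term hα hβ2 hβ hab ha k)]
  exact tsum_congr fun l => by ring

theorem norm_bil_sub_bil_le {h : ℝ} (hα : α ≤ 1) (hβ : Rapid β) (hγ : Rapid γ)
    (ha : ∀ k, ‖a k‖ ≤ β k) (hb : ∀ k, ‖b k‖ ≤ β k) (hab : ∀ k, ‖a k - b k‖ ≤ h * γ k) (k : Freq) :
    ‖Bil α a a k - Bil α b b k‖ ≤
      h * (conv (fun k => freqNorm k * β k) (fun k => freqNorm k * γ k) k +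
        conv (fun k => freqNorm k * γ k) (fun k => freqNorm k * β k) k) := by
  rw [bil_sub_bil hα hβ ha hb]
  have hγ' := hγ.const_mul h
  refine (norm_add_le _ _).trans ((add_le_add (norm_bil_le hα hβ hγ' hb hab k)
    (norm_bil_le hα hγ' hβ hab ha k)).trans (le_of_eq ?_))
  rw [mul_add]
  simp only [conv]
  rw [← tsum_mul_left, ← tsum_mul_left]
  congr 1 <;> exact tsum_congr fun l => by ring

theorem tendsto_bil {ι : Type*} {u : Filter ι} (hα : α ≤ 1) (hβ : Rapid β) {f : ι → Freq → ℂ}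
    (hf : ∀ n k, ‖f n k‖ ≤ β k) (h : ∀ k, Tendsto (fun n => f n k) u (𝓝 (a k))) (k : Freq) :
    Tendsto (fun n => Bil α (f n) (f n) k) u (𝓝 (Bil α a a k)) := by
  rcases isEmpty_or_nonempty ι with hι | ⟨⟨n₀⟩⟩
  · rw [u.filter_eq_bot_of_isEmpty]; exact tendsto_bot
  have hβ0 : ∀ k, 0 ≤ β k := fun k => (norm_nonneg _).trans (hf n₀ k)
  exact tendsto_tsum_of_dominated_convergence (summable_conv_freqNorm hβ hβ hβ0 hβ0 k)
    (fun l => (tendsto_const_nhds.mul (h _)).mul (h _))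
    (Eventually.of_forall fun n l => norm_bil_term_le_of_le hα (hf n) (hf n) k l)

end bilinear

/-- A second order Taylor estimate for the Galerkin system. -/
theorem galerkin_taylor {α T : ℝ} (hα : α ≤ 1) {β : Freq → ℝ} (hβ : Rapid β)
    {S : Finset Freq} {a : ℝ → Freq → ℂ} (hsup : ∀ t, ∀ k ∉ S, a t k = 0)
    (hder : ∀ t ∈ Set.Icc 0 T, ∀ k ∈ S,
      HasDerivWithinAt (fun t => a t k) (Bil α (a t) (a t) k) (Set.Icc 0 T) t)
    (hb : ∀ t ∈ Set.Icc 0 T, ∀ k, ‖a t k‖ ≤ β k) {b₁ b₂ : Freq → ℝ}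
    (hb₁ : b₁ = conv (fun k => freqNorm k * β k) (fun k => freqNorm k * β k)) (rb₁ : Rapid b₁)
    (hb₁0 : ∀ k, 0 ≤ b₁ k)
    (hb₂ : b₂ = fun k => conv (fun k => freqNorm k * β k) (fun k => freqNorm k * b₁ k) k +
        conv (fun k => freqNorm k * b₁ k) (fun k => freqNorm k * β k) k)
    {s t : ℝ} (hs : s ∈ Set.Icc 0 T) (ht : t ∈ Set.Icc 0 T) {k : Freq} (hk : k ∈ S) :
    ‖a s k - a t k - ((s - t : ℝ) : ℂ) * Bil α (a t) (a t) k‖ ≤ b₂ k * (s - t) ^ 2 := by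
  -- A first application of the mean value inequality: the velocity of each coefficient is bounded
  -- by b₁.
  have hlip : ∀ u ∈ Set.Icc 0 T, ∀ k, ‖a u k - a t k‖ ≤ |u - t| * b₁ k := by
    intro u hu k
    by_cases hk : k ∈ S
    · have := (convex_Icc 0 T).norm_image_sub_le_of_norm_hasDerivWithin_le
        (fun v hv => hder v hv k hk) (C := b₁ k)
        (fun v hv => by rw [hb₁]; exact norm_bil_le hα hβ hβ (hb v hv) (hb v hv) k) ht hu
      rwa [Real.norm_eq_abs, mul_comm] at this
    · rw [hsup u k hk, hsup t k hk, sub_zero, norm_zero]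
      exact mul_nonneg (abs_nonneg _) (hb₁0 k)
  have hsub : Set.uIcc t s ⊆ Set.Icc 0 T := Set.uIcc_subset_Icc ht hs
  have hb₂0 : 0 ≤ b₂ k := by
    have hβ0 : ∀ k, 0 ≤ freqNorm k * β k := fun k =>
      mul_nonneg (freqNorm_nonneg k) ((norm_nonneg _).trans (hb t ht k))
    have h1 : ∀ k, 0 ≤ freqNorm k * b₁ k := fun k => mul_nonneg (freqNorm_nonneg k) (hb₁0 k)
    rw [hb₂]
    exact add_nonneg (conv_nonneg hβ0 h1 k) (conv_nonneg h1 hβ0 k)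
  -- A second application, to the remainder itself: its derivative B(a(u)) - B(a(t)) is at most b₂|u
  -- - t| by the Lipschitz bound.
  have key := (convex_uIcc t s).norm_image_sub_le_of_norm_hasDerivWithin_le
    (f := fun u => a u k - ((u - t : ℝ) : ℂ) * Bil α (a t) (a t) k)
    (f' := fun u => Bil α (a u) (a u) k - Bil α (a t) (a t) k) (C := b₂ k * |s - t|)
    (fun u hu => by
      have h1 := (hder u (hsub hu) k hk).mono hsub
      have h2 : HasDerivWithinAt (fun u : ℝ => ((u - t : ℝ) : ℂ)) 1 (Set.uIcc t s) u := by
        simpa using (((hasDerivAt_id u).sub_const t).ofReal_comp).hasDerivWithinAt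
      simpa using h1.fun_sub (h2.mul_const (Bil α (a t) (a t) k)))
    (fun u hu => by
      have h1 := norm_bil_sub_bil_le hα hβ rb₁ (hb u (hsub hu)) (hb t ht) (hlip u (hsub hu)) k
      have h2 : |u - t| ≤ |s - t| := Set.abs_sub_left_of_mem_uIcc hu
      rw [hb₂] at hb₂0 ⊢
      rw [mul_comm _ |s - t|]
      exact h1.trans (mul_le_mul_of_nonneg_right h2 hb₂0))
    Set.left_mem_uIcc Set.right_mem_uIcc
  rw [Real.norm_eq_abs, mul_assoc, ← sq, sq_abs] at key
  simpa [sub_right_comm] using key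

/-- The frequencies in a box, without zero. -/
def box (n : ℕ) : Finset Freq := (Finset.Icc (fun _ => -(n : ℤ)) (fun _ => (n : ℤ))).erase 0

theorem mem_box {n : ℕ} {k : Freq} : k ∈ box n ↔ k ≠ 0 ∧ ∀ j, |k j| ≤ n := by
  simp only [box, Finset.mem_erase, Finset.mem_Icc, Pi.le_def, abs_le, forall_and]

theorem eventually_mem_box {k : Freq} (hk : k ≠ 0) : ∀ᶠ n in atTop, k ∈ box n := by
  filter_upwards [eventually_ge_atTop (max (k 0).natAbs (k 1).natAbs)] with n hn
  refine mem_box.2 ⟨hk, fun j => ?_⟩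
  rw [Int.abs_eq_natAbs]
  have : (k j).natAbs ≤ n := by
    fin_cases j
    exacts [(le_max_left _ _).trans hn, (le_max_right _ _).trans hn]
  exact_mod_cast this

theorem norm_le_of_gevW_le {r τ σ M : ℝ} (hr : 0 ≤ r) (hM : 0 ≤ M) {z : ℂ} {k : Freq}
    (hk : k ≠ 0) (h : (gevW r τ σ (freqNorm k) * ‖z‖) ^ 2 ≤ M ^ 2) :
    ‖z‖ ≤ M * Real.exp (-τ * freqNorm k ^ σ) := by
  have h1 : gevW r τ σ (freqNorm k) * ‖z‖ ≤ M := le_of_sq_le_sq h hM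
  have h2 : expW τ σ (freqNorm k) * ‖z‖ ≤ gevW r τ σ (freqNorm k) * ‖z‖ :=
    mul_le_mul_of_nonneg_right (le_mul_of_one_le_left (expW_pos _ _ _).le
      (Real.one_le_rpow (one_le_freqNorm hk) hr)) (norm_nonneg _)
  rw [neg_mul, Real.exp_neg, ← div_eq_mul_inv, le_div_iff₀ (Real.exp_pos _), mul_comm]
  exact h2.trans h1

/-- Solutions of the system for the Fourier coefficients. -/
theorem exists_coeff_solution {r α σ K τ₀ : ℝ} (hr : 3 < r) (hα1 : α ≤ 1) (hασ : α ≤ σ)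
    (hσ0 : 0 < σ) (hσ : σ ≤ 1) (hK : 0 < K) (hτ₀ : 0 < τ₀) :
    ∃ T : ℝ, 0 < T ∧ ∀ a₀ : Freq → ℂ, IsSymm a₀ → a₀ 0 = 0 →
      (∀ S : Finset Freq, ∑ k ∈ S, (gevW r τ₀ σ (freqNorm k) * ‖a₀ k‖) ^ 2 ≤ K ^ 2) →
      ∃ (a : ℝ → Freq → ℂ) (b : Freq → ℝ), Rapid b ∧ a 0 = a₀ ∧ ∀ t ∈ Set.Icc 0 T,
        IsSymm (a t) ∧ a t 0 = 0 ∧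
        (∀ S : Finset Freq, ∑ k ∈ S, (gevW r (τ₀ / 2) σ (freqNorm k) * ‖a t k‖) ^ 2 ≤
          (2 * K) ^ 2) ∧
        ∀ s ∈ Set.Icc 0 T, ∀ k,
          ‖a s k - a t k - ((s - t : ℝ) : ℂ) * Bil α (a t) (a t) k‖ ≤ b k * (s - t) ^ 2 := by
  obtain ⟨T, hT, hgal⟩ := exists_galerkin_bounded hr hα1 hασ hσ0.le hσ hK hτ₀
  refine ⟨T, hT, fun a₀ hsym₀ ha₀0 hE₀ => ?_⟩
  have hbox : ∀ n, ∀ k ∈ box n, -k ∈ box n := fun n k hk => by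
    rw [mem_box] at hk ⊢; simpa using hk
  have hgal' := fun n : ℕ => hgal (box n) (fun k => if k ∈ box n then a₀ k else 0) (hbox n)
    (fun h => (mem_box.1 h).1 rfl)
    (fun k => by
      have : -k ∈ box n ↔ k ∈ box n := ⟨fun h => by simpa using hbox n _ h, hbox n k⟩
      simp only [this]
      split_ifs
      · exact hsym₀ k
      · simp)
    (fun k hk => if_neg hk)
    ((Finset.sum_congr rfl fun k hk => by rw [if_pos hk]).le.trans (hE₀ (box n)))
  choose an h0 hsym hsup hder hbd using hgal'
  set β : Freq → ℝ := fun k => 2 * K * Real.exp (-(τ₀ / 2) * freqNorm k ^ σ) with hβ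
  have rβ : Rapid β := (rapid_exp (by positivity) hσ0).const_mul _
  have hβ0 : ∀ k, 0 ≤ β k := fun k => by positivity
  have hb : ∀ n, ∀ t ∈ Set.Icc 0 T, ∀ k, ‖an n t k‖ ≤ β k := by
    intro n t ht k
    by_cases hk : k ∈ box n
    · refine norm_le_of_gevW_le (r := r) (by linarith) (by positivity) (mem_box.1 hk).1
        (le_trans ?_ (hbd n t ht))
      exact Finset.single_le_sum (f := fun k => (gevW r (τ₀ / 2) σ (freqNorm k) * ‖an n t k‖) ^ 2)
        (fun k _ => sq_nonneg _) hk
    · rw [hsup n t k hk, norm_zero]; exact hβ0 k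
  obtain ⟨b₁, hb₁⟩ : ∃ b₁, b₁ = conv (fun k => freqNorm k * β k) (fun k => freqNorm k * β k) :=
    ⟨_, rfl⟩
  have nβ : ∀ k, 0 ≤ freqNorm k * β k := fun k => mul_nonneg (freqNorm_nonneg k) (hβ0 k)
  have rb₁ : Rapid b₁ := hb₁ ▸ (rβ.mul_left hβ0).conv (rβ.mul_left hβ0) nβ nβ
  have hb₁0 : ∀ k, 0 ≤ b₁ k := fun k => hb₁ ▸ conv_nonneg nβ nβ k
  have nb₁ : ∀ k, 0 ≤ freqNorm k * b₁ k := fun k => mul_nonneg (freqNorm_nonneg k) (hb₁0 k)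
  obtain ⟨b₂, hb₂⟩ : ∃ b₂ : Freq → ℝ, b₂ = fun k =>
      conv (fun k => freqNorm k * β k) (fun k => freqNorm k * b₁ k) k +
        conv (fun k => freqNorm k * b₁ k) (fun k => freqNorm k * β k) k := ⟨_, rfl⟩
  have rb₂ : Rapid b₂ := hb₂ ▸ ((rβ.mul_left hβ0).conv (rb₁.mul_left hb₁0) nβ nb₁).add
    ((rb₁.mul_left hb₁0).conv (rβ.mul_left hβ0) nb₁ nβ)
  -- Coefficients stay in a compact disc, so an ultrafilter limit exists for every t and k at once.
  -- Neither a diagonal subsequence nor equicontinuity is needed.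
  have hlim : ∀ t k, ∃ z : ℂ, t ∈ Set.Icc 0 T →
      Tendsto (fun n => an n t k) (hyperfilter ℕ : Filter ℕ) (𝓝 z) := by
    intro t k
    by_cases ht : t ∈ Set.Icc 0 T
    · obtain ⟨z, -, hz⟩ := (isCompact_closedBall (0 : ℂ) (β k)).ultrafilter_le_nhds
        ((hyperfilter ℕ).map fun n => an n t k) (by
          rw [Ultrafilter.coe_map, le_principal_iff, mem_map]
          exact univ_mem' fun n => mem_closedBall_zero_iff.2 (hb n t ht k))
      exact ⟨z, fun _ => hz⟩
    · exact ⟨0, fun h => absurd h ht⟩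
  choose a ha using hlim
  have hev : ∀ k : Freq, k ≠ 0 → ∀ᶠ n in (hyperfilter ℕ : Filter ℕ), k ∈ box n := fun k hk =>
    Nat.hyperfilter_le_atTop (eventually_mem_box hk)
  have ha0 : ∀ t ∈ Set.Icc 0 T, a t 0 = 0 := fun t ht => by
    refine tendsto_nhds_unique (ha t 0 ht) (tendsto_const_nhds.congr fun n => ?_)
    exact (hsup n t 0 fun h => (mem_box.1 h).1 rfl).symm
  refine ⟨a, b₂, rb₂, ?_, fun t ht => ⟨?_, ha0 t ht, ?_, ?_⟩⟩
  · ext k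
    have h0T : (0 : ℝ) ∈ Set.Icc 0 T := ⟨le_rfl, hT.le⟩
    by_cases hk : k = 0
    · rw [hk, ha0 0 h0T, ha₀0]
    · refine tendsto_nhds_unique (ha 0 k h0T) (tendsto_const_nhds.congr' ?_)
      filter_upwards [hev k hk] with n hn
      rw [h0 n]
      exact (if_pos hn).symm
  · intro k
    refine tendsto_nhds_unique (ha t (-k) ht) ?_
    simp only [hsym _ t k]
    exact (Complex.continuous_conj.tendsto _).comp (ha t k ht)
  -- Bounds on finite partial sums pass to the pointwise limit, and for large n the box contains any
  -- prescribed nonzero frequency; here it even suffices to discard the terms outside the box.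
  · intro S
    refine le_of_tendsto (tendsto_finsetSum S fun k _ =>
      (tendsto_const_nhds.mul (ha t k ht).norm).pow 2) (Eventually.of_forall fun n => ?_)
    refine le_trans ?_ (hbd n t ht)
    rw [← Finset.sum_inter_add_sum_sdiff S (box n),
      Finset.sum_eq_zero (s := S \ box n) fun k hk => by
        rw [hsup n t k (Finset.mem_sdiff.1 hk).2]; simp, add_zero]
    exact Finset.sum_le_sum_of_subset_of_nonneg Finset.inter_subset_right fun _ _ _ => sq_nonneg _
  · intro s hs k
    have hBil := tendsto_bil hα1 rβ (fun n => hb n t ht) (fun k => ha t k ht) k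
    by_cases hk : k = 0
    -- The nonlinearity has mean zero: the kernel is bounded by the output frequency, which is 0
    -- here.
    · have hz : Bil α (a t) (a t) 0 = 0 := by
        refine (tsum_congr fun l => ?_).trans tsum_zero
        have : kern α (0 - l) l = 0 := by
          have := abs_kern_le' α (0 - l) l
          rw [sub_add_cancel, freqNorm_zero, mul_zero] at this
          exact abs_nonpos_iff.1 this
        rw [this]; simp
      rw [hk, ha0 s hs, ha0 t ht, hz]
      have : 0 ≤ b₂ 0 := by rw [hb₂]; exact add_nonneg (conv_nonneg nβ nb₁ _) (conv_nonneg nb₁ nβ _)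
      simp only [sub_zero, mul_zero, norm_zero]
      positivity
    · refine le_of_tendsto (((ha s k hs).sub (ha t k ht)).sub (tendsto_const_nhds.mul hBil)).norm ?_
      filter_upwards [hev k hk] with n hn
      exact galerkin_taylor hα1 rβ (hsup n) (hder n) (hb n) hb₁ rb₁ hb₁0 hb₂ hs ht hn

end SIPM
end

noncomputable section

namespace SIPM

open ComplexConjugate MeasureTheory

/-! ### Characters -/

theorem norm_character (k : Freq) (x : Plane) : ‖character k x‖ = 1 := by
  rw [character, mul_comm, Complex.norm_exp_ofReal_mul_I]

theorem character_add (k l : Freq) (x : Plane) :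
    character (k + l) x = character k x * character l x := by
  rw [character, character, character, ← Complex.exp_add]
  congr 1
  simp only [Pi.add_apply]
  push_cast
  ring

theorem character_neg (k : Freq) (x : Plane) : character (-k) x = conj (character k x) := by
  rw [character, character, ← Complex.exp_conj]
  congr 1
  simp only [map_mul, Complex.conj_I, Complex.conj_ofReal, Pi.neg_apply]
  push_cast
  ring

theorem character_zero (x : Plane) : character 0 x = 1 := by simp [character]

theorem continuous_character (k : Freq) : Continuous (character k) := by
  unfold character
  fun_prop

theorem character_add_single (k : Freq) (j : Fin 2) (x : Plane) :
    character k (x + Pi.single j (2 * Real.pi)) = character k x := by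
  rw [character, character, Complex.exp_eq_exp_iff_exists_int]
  refine ⟨k j, ?_⟩
  fin_cases j <;> simp <;> ring

/-- The fundamental domain of the torus. -/
abbrev cell : Set Plane := Set.Icc (0 : Plane) (fun _ => 2 * Real.pi)

/-- The cell and the character both factor over coordinates, reducing the claim to one-dimensional
orthogonality. -/
theorem integral_character (k : Freq) :
    ∫ x in cell, character k x = if k = 0 then (((2 * Real.pi) ^ 2 : ℝ) : ℂ) else 0 := by
  have h1 : ∀ n : ℤ, ∫ y in Set.Icc 0 (2 * Real.pi), Complex.exp (Complex.I * ((n * y : ℝ) : ℂ)) =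
      if n = 0 then ((2 * Real.pi : ℝ) : ℂ) else 0 := by
    intro n
    rw [integral_Icc_eq_integral_Ioc, ← intervalIntegral.integral_of_le Real.two_pi_pos.le]
    split_ifs with hn
    · simp [hn]
    · have hc : Complex.I * (n : ℂ) ≠ 0 := mul_ne_zero Complex.I_ne_zero (by exact_mod_cast hn)
      have : ∀ y : ℝ, Complex.I * ((n * y : ℝ) : ℂ) = Complex.I * n * y := fun y => by
        push_cast; ring
      simp only [this]
      rw [integral_exp_mul_complex hc]
      have h2 : Complex.exp (Complex.I * n * ((2 * Real.pi : ℝ) : ℂ)) = 1 := by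
        rw [← Complex.exp_int_mul_two_pi_mul_I n]
        congr 1
        push_cast
        ring
      rw [h2]
      simp
  have h2 : ∀ x : Plane, character k x =
      ∏ j, Complex.exp (Complex.I * (((k j : ℝ) * x j : ℝ) : ℂ)) := fun x => by
    rw [Fin.prod_univ_two, ← Complex.exp_add, character]
    congr 1
    push_cast
    ring
  have h3 : (volume : Measure Plane).restrict cell =
      Measure.pi fun _ : Fin 2 => (volume : Measure ℝ).restrict (Set.Icc 0 (2 * Real.pi)) := by
    rw [← Measure.restrict_pi_pi, ← volume_pi]
    congr 1
    exact (Set.pi_univ_Icc _ _).symm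
  rw [h3]
  simp only [h2]
  rw [integral_fintype_prod_eq_prod (𝕜 := ℂ) (fun (j : Fin 2) (y : ℝ) =>
    Complex.exp (Complex.I * (((k j : ℝ) * y : ℝ) : ℂ)))]
  rw [Fin.prod_univ_two]
  simp only [h1]
  by_cases hk : k = 0
  · subst hk
    simp [sq]
  · rw [if_neg hk]
    obtain ⟨j, hj⟩ := Function.ne_iff.1 hk
    fin_cases j
    · simp [show k 0 ≠ 0 from hj]
    · simp [show k 1 ≠ 0 from hj]

/-! ### Fourier series -/

/-- The Fourier series with coefficients `c`. -/
def series (c : Freq → ℂ) (x : Plane) : ℂ := ∑' k, c k * character k x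

section series

variable {c : Freq → ℂ}

theorem summable_series (hc : Summable fun k => ‖c k‖) (x : Plane) :
    Summable fun k => c k * character k x :=
  Summable.of_norm_bounded hc fun k => by rw [norm_mul, norm_character, mul_one]

theorem norm_series_le (hc : Summable fun k => ‖c k‖) (x : Plane) :
    ‖series c x‖ ≤ ∑' k, ‖c k‖ :=
  tsum_of_norm_bounded hc.hasSum fun k => by rw [norm_mul, norm_character, mul_one]

theorem continuous_series (hc : Summable fun k => ‖c k‖) : Continuous (series c) :=
  continuous_tsum (fun k => continuous_const.mul (continuous_character k)) hc fun k x => by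
    rw [norm_mul, norm_character, mul_one]

theorem series_add_single (j : Fin 2) (x : Plane) :
    series c (x + Pi.single j (2 * Real.pi)) = series c x := by
  simp only [series, character_add_single]

theorem integral_series_mul_character (hc : Summable fun k => ‖c k‖) (m : Freq) :
    ((((2 * Real.pi) ^ 2)⁻¹ : ℝ) : ℂ) * ∫ x in cell, series c x * character (-m) x = c m := by
  have h1 : ∀ x, series c x * character (-m) x = ∑' k, c k * character (k - m) x := fun x => by
    rw [series, ← tsum_mul_right]
    refine tsum_congr fun k => ?_
    rw [sub_eq_add_neg, character_add, mul_assoc]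
  have hcell : IsCompact cell := isCompact_Icc
  have hint : ∀ k, IntegrableOn (fun x => c k * character (k - m) x) cell := fun k =>
    ((continuous_const.mul (continuous_character _)).continuousOn).integrableOn_compact hcell
  have h2 : HasSum (fun k => ∫ x in cell, c k * character (k - m) x)
      (∫ x in cell, ∑' k, c k * character (k - m) x) := by
    refine hasSum_integral_of_summable_integral_norm hint ?_
    simp only [norm_mul, norm_character, mul_one, integral_const]
    exact hc.mul_left _
  have h3 : (fun k => ∫ x in cell, c k * character (k - m) x) = fun k =>
      if k = m then c m * (((2 * Real.pi) ^ 2 : ℝ) : ℂ) else 0 := by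
    ext k
    rw [integral_const_mul, integral_character]
    by_cases hk : k = m
    · subst hk; simp
    · rw [if_neg (sub_ne_zero.2 hk), if_neg hk, mul_zero]
  rw [h3] at h2
  simp only [h1]
  rw [h2.unique (hasSum_ite_eq m _), mul_comm (c m), ← mul_assoc, ← Complex.ofReal_mul,
    inv_mul_cancel₀ (by positivity), Complex.ofReal_one, one_mul]

end series

theorem isSymm_fourierCoef (f : Plane → ℝ) : IsSymm (fourierCoef f) := by
  intro k
  rw [fourierCoef, fourierCoef, map_mul, Complex.conj_ofReal, ← integral_conj]
  congr 1
  refine integral_congr_ae (ae_of_all _ fun x => ?_)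
  simp only [map_mul, Complex.conj_ofReal, ← character_neg, neg_neg]

theorem IsPeriodic.add_int {f : Plane → ℝ} (hf : IsPeriodic f) (n : Freq) (x : Plane) :
    f (x + fun j => 2 * Real.pi * n j) = f x := by
  have e : (fun j => 2 * Real.pi * (n j : ℝ)) =
      n 0 • (Pi.single 0 (2 * Real.pi) : Plane) + n 1 • (Pi.single 1 (2 * Real.pi) : Plane) := by
    ext j
    fin_cases j <;> simp [mul_comm]
  rw [e, ← add_assoc, (Function.Periodic.zsmul (hf 1) (n 1)) _,
    (Function.Periodic.zsmul (hf 0) (n 0)) _]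

open scoped Pointwise in
/-- Fourier inversion for continuous functions on the torus. -/
theorem series_fourierCoef {f : Plane → ℝ} (hf : Continuous f) (hp : IsPeriodic f)
    (hs : Summable fun k => ‖fourierCoef f k‖) (x : Plane) : series (fourierCoef f) x = f x := by
  let π : C(Plane, UnitAddTorus (Fin 2)) :=
    ⟨fun y j => (y j : UnitAddCircle), by
      refine continuous_pi fun j => ?_
      exact (AddCircle.continuous_mk' 1).comp (continuous_apply j)⟩
  have hπ : Topology.IsQuotientMap π :=
    (IsOpenQuotientMap.piMap (f := fun (_ : Fin 2) (y : ℝ) => (y : UnitAddCircle)) fun _ =>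
      QuotientAddGroup.isOpenQuotientMap_mk).isQuotientMap
  -- Rescaling by 2π turns f into a function of period 1, which descends to the unit torus; Fourier
  -- inversion there is then transported back.
  let g : C(Plane, ℂ) := ⟨fun y => (f ((2 * Real.pi) • y) : ℂ), by fun_prop⟩
  have hg : ∀ y z, π y = π z → g y = g z := by
    intro y z h
    have h1 : ∀ j, ∃ n : ℤ, y j = z j + n := fun j => by
      have := congrFun h j
      obtain ⟨n, hn⟩ := AddSubgroup.mem_zmultiples_iff.1 (QuotientAddGroup.eq_iff_sub_mem.1 this)
      exact ⟨n, by rw [zsmul_eq_mul, mul_one] at hn; linarith⟩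
    choose n hn using h1
    have e : (2 * Real.pi) • y = (2 * Real.pi) • z + fun j => 2 * Real.pi * (n j : ℝ) := by
      ext j
      simp only [Pi.smul_apply, Pi.add_apply, smul_eq_mul, hn j]
      ring
    change (f ((2 * Real.pi) • y) : ℂ) = f ((2 * Real.pi) • z)
    rw [e, hp.add_int n]
  let F : C(UnitAddTorus (Fin 2), ℂ) := hπ.lift g hg
  have hF : ∀ y, F (π y) = g y := fun y => DFunLike.congr_fun (hπ.lift_comp g hg) y
  have hm : ∀ k y, UnitAddTorus.mFourier k (π y) = character k ((2 * Real.pi) • y) := by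
    intro k y
    change ∏ j, fourier (k j) (y j : UnitAddCircle) = _
    simp only [fourier_coe_apply]
    rw [Fin.prod_univ_two, ← Complex.exp_add, character]
    congr 1
    simp
    ring
  have hcoef : ∀ k, UnitAddTorus.mFourierCoeff F k = fourierCoef f k := by
    intro k
    rw [UnitAddTorus.mFourierCoeff_eq_integral F k 0]
    have h1 : {x : Plane | ∀ i, x i ∈ Set.Ioc ((0 : Plane) i) ((0 : Plane) i + 1)} =
        Set.univ.pi fun i => Set.Ioc ((0 : Plane) i) ((1 : Plane) i) := by
      ext x; simp [Set.mem_pi]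
    rw [h1, volume_pi, setIntegral_congr_set Measure.univ_pi_Ioc_ae_eq_Icc, ← volume_pi]
    have h2 : ∀ y : Plane, UnitAddTorus.mFourier (-k) (fun i => (y i : UnitAddCircle)) •
        F (fun i => (y i : UnitAddCircle)) =
        (fun x : Plane => (f x : ℂ) * character (-k) x) ((2 * Real.pi) • y) := fun y => by
      have a1 := hm (-k) y
      have a2 := hF y
      simp only [π, ContinuousMap.coe_mk] at a1 a2
      rw [a1, a2, smul_eq_mul, mul_comm]
      rfl
    simp only [h2]
    refine (Measure.setIntegral_comp_smul_of_pos volume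
      (fun x : Plane => (f x : ℂ) * character (-k) x) _ Real.two_pi_pos).trans ?_
    rw [fourierCoef]
    have h3 : (2 * Real.pi) • Set.Icc (0 : Plane) 1 = cell := by
      ext y
      rw [Set.mem_smul_set_iff_inv_smul_mem₀ Real.two_pi_pos.ne', Set.mem_Icc, Set.mem_Icc,
        Pi.le_def, Pi.le_def, Pi.le_def, Pi.le_def]
      refine and_congr (forall_congr' fun j => ?_) (forall_congr' fun j => ?_)
      · exact mul_nonneg_iff_of_pos_left (inv_pos.2 Real.two_pi_pos)
      · change (2 * Real.pi)⁻¹ * y j ≤ 1 ↔ y j ≤ 2 * Real.pi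
        rw [inv_mul_le_iff₀ Real.two_pi_pos, mul_one]
    rw [h3]
    simp
  have hs' : Summable (UnitAddTorus.mFourierCoeff F) := by
    rw [funext hcoef]; exact hs.of_norm
  have := UnitAddTorus.hasSum_mFourier_series_apply_of_summable hs' (π ((2 * Real.pi)⁻¹ • x))
  rw [hF] at this
  simp only [hcoef, hm, smul_inv_smul₀ Real.two_pi_pos.ne', smul_eq_mul, g, ContinuousMap.coe_mk]
    at this
  exact this.tsum_eq

end SIPM
end

noncomputable section

namespace SIPM

open ComplexConjugate MeasureTheory

/-! ### Differentiation and smoothness of Fourier series -/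

section smoothness

variable {c : Freq → ℂ}

/-- The Fourier coefficients of the `j`-th partial derivative. -/
def derivCoef (j : Fin 2) (c : Freq → ℂ) (k : Freq) : ℂ := ((k j : ℝ) : ℂ) * Complex.I * c k

theorem norm_derivCoef_le (j : Fin 2) (c : Freq → ℂ) (k : Freq) :
    ‖derivCoef j c k‖ ≤ freqNorm k * ‖c k‖ := by
  rw [derivCoef, norm_mul, norm_mul, Complex.norm_I, mul_one, Complex.norm_real, Real.norm_eq_abs]
  exact mul_le_mul_of_nonneg_right (abs_coord_le_freqNorm k j) (norm_nonneg _)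

theorem rapid_derivCoef (hc : Rapid fun k => ‖c k‖) (j : Fin 2) :
    Rapid fun k => ‖derivCoef j c k‖ :=
  (hc.mul_left fun _ => norm_nonneg _).of_le (fun _ => norm_nonneg _) (norm_derivCoef_le j c)

theorem IsSymm.derivCoef (hc : IsSymm c) (j : Fin 2) : IsSymm (derivCoef j c) := by
  intro k
  simp only [SIPM.derivCoef, hc k, map_mul, Complex.conj_I, Complex.conj_ofReal, Pi.neg_apply]
  push_cast
  ring

/-- The derivative of a Fourier series. -/
def seriesDeriv (c : Freq → ℂ) (x : Plane) : Plane →L[ℝ] ℂ :=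
  ∑ j, (ContinuousLinearMap.proj j : Plane →L[ℝ] ℝ).smulRight (series (derivCoef j c) x)

theorem hasFDerivAt_character (k : Freq) (x : Plane) :
    HasFDerivAt (character k) (∑ j, (ContinuousLinearMap.proj j : Plane →L[ℝ] ℝ).smulRight
      (((k j : ℝ) : ℂ) * Complex.I * character k x)) x := by
  have h0 : ∀ j : Fin 2, HasFDerivAt (fun y : Plane => y j)
      (ContinuousLinearMap.proj j : Plane →L[ℝ] ℝ) x := fun j =>
    (ContinuousLinearMap.proj j : Plane →L[ℝ] ℝ).hasFDerivAt
  have h1 := ((h0 0).const_mul (k 0 : ℝ)).add ((h0 1).const_mul (k 1 : ℝ))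
  have h2 := ((Complex.ofRealCLM.hasFDerivAt.comp x h1).const_mul Complex.I).cexp
  refine h2.congr_fderiv ?_
  ext v
  simp [Fin.sum_univ_two, character]
  ring

theorem hasFDerivAt_series (hc : Rapid fun k => ‖c k‖) (x : Plane) :
    HasFDerivAt (series c) (seriesDeriv c x) x := by
  set f' : Freq → Plane → (Plane →L[ℝ] ℂ) := fun k y => c k •
    ∑ j, (ContinuousLinearMap.proj j : Plane →L[ℝ] ℝ).smulRight
      (((k j : ℝ) : ℂ) * Complex.I * character k y) with hf'
  have hbound : ∀ k y, ‖f' k y‖ ≤ 2 * (freqNorm k * ‖c k‖) := by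
    intro k y
    refine ContinuousLinearMap.opNorm_le_bound _ (by
      have := freqNorm_nonneg k; positivity) fun v => ?_
    have h1 : ∀ j, ‖v j • (((k j : ℝ) : ℂ) * Complex.I * character k y)‖ ≤ ‖v‖ * freqNorm k := by
      intro j
      rw [norm_smul, norm_mul, norm_mul, norm_character, Complex.norm_I, mul_one, mul_one,
        Complex.norm_real, Real.norm_eq_abs (k j : ℝ)]
      exact mul_le_mul (norm_le_pi_norm v j) (abs_coord_le_freqNorm k j) (abs_nonneg _)
        (norm_nonneg _)
    have h2 : f' k y v = c k * (v 0 • (((k 0 : ℝ) : ℂ) * Complex.I * character k y) +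
        v 1 • (((k 1 : ℝ) : ℂ) * Complex.I * character k y)) := by
      simp [hf', Fin.sum_univ_two, mul_add]
    rw [h2, norm_mul]
    calc _ ≤ ‖c k‖ * (‖v‖ * freqNorm k + ‖v‖ * freqNorm k) := by
          gcongr
          exact (norm_add_le _ _).trans (add_le_add (h1 0) (h1 1))
      _ = _ := by ring
  have hsum := (hc.mul_left fun k => norm_nonneg _).summable.mul_left 2
  have h := hasFDerivAt_tsum (f := fun k y => c k * character k y) (f' := f') hsum
    (fun k y => (hasFDerivAt_character k y).const_mul (c k)) hbound
    (summable_series hc.summable 0) x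
  refine h.congr_fderiv ?_
  ext v
  have hs : Summable fun k => f' k x := Summable.of_norm_bounded hsum fun k => hbound k x
  change ContinuousLinearMap.apply ℝ ℂ v (∑' k, f' k x) = _
  rw [(ContinuousLinearMap.apply ℝ ℂ v).map_tsum hs]
  simp only [seriesDeriv, Fin.sum_univ_two, add_apply,
    ContinuousLinearMap.smulRight_apply, ContinuousLinearMap.proj_apply, series,
    Complex.real_smul]
  rw [← tsum_mul_left, ← tsum_mul_left,
    ← ((summable_series (rapid_derivCoef hc 0).summable x).mul_left _).tsum_add
    ((summable_series (rapid_derivCoef hc 1).summable x).mul_left _)]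
  refine tsum_congr fun k => ?_
  simp [hf', Fin.sum_univ_two, derivCoef]
  ring

/-- The derivative is built from series whose coefficients again decay rapidly, so induction on the
order works once the coefficients are generalized. -/
theorem contDiff_series (hc : Rapid fun k => ‖c k‖) : ContDiff ℝ ∞ (series c) := by
  refine contDiff_infty.2 fun n => ?_
  induction n generalizing c with
  | zero => exact contDiff_zero.2 (continuous_series hc.summable)
  | succ n ih =>
    rw [Nat.cast_add, Nat.cast_one, contDiff_succ_iff_fderiv]
    refine ⟨fun x => (hasFDerivAt_series hc x).differentiableAt, by simp, ?_⟩
    have : fderiv ℝ (series c) = seriesDeriv c := funext fun x => (hasFDerivAt_series hc x).fderiv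
    rw [this]
    exact ContDiff.sum fun j _ => contDiff_const.smulRight (ih (rapid_derivCoef hc j))

theorem conj_series (hc : IsSymm c) (x : Plane) : conj (series c x) = series c x := by
  rw [series, Complex.conj_tsum, ← (Equiv.neg Freq).tsum_eq]
  refine tsum_congr fun k => ?_
  rw [map_mul, Equiv.neg_apply, hc k, Complex.conj_conj, character_neg, Complex.conj_conj]

theorem ofReal_re_series (hc : IsSymm c) (x : Plane) : ((series c x).re : ℂ) = series c x :=
  Complex.conj_eq_iff_re.1 (conj_series hc x)

theorem partialDeriv_eq_series {f : Plane → ℝ} (hf : ∀ x, (f x : ℂ) = series c x)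
    (hc : Rapid fun k => ‖c k‖) (hsym : IsSymm c) (j : Fin 2) (x : Plane) :
    (partialDeriv j f x : ℂ) = series (derivCoef j c) x := by
  have h1 : f = fun x => Complex.reCLM (series c x) := funext fun x => by
    rw [← hf x, Complex.reCLM_apply, Complex.ofReal_re]
  have h2 := (Complex.reCLM.hasFDerivAt.comp x (hasFDerivAt_series hc x))
  have h3 : partialDeriv j f x = (series (derivCoef j c) x).re := by
    rw [partialDeriv, h1]
    change fderiv ℝ (Complex.reCLM ∘ series c) x _ = _
    rw [h2.fderiv]
    fin_cases j <;> simp [seriesDeriv, Fin.sum_univ_two]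
  rw [h3, ofReal_re_series (hsym.derivCoef j)]

theorem fourierCoef_eq {f : Plane → ℝ} (hf : ∀ x, (f x : ℂ) = series c x)
    (hc : Summable fun k => ‖c k‖) : fourierCoef f = c := by
  ext k
  rw [fourierCoef]
  simp only [hf]
  exact integral_series_mul_character hc k

end smoothness

/-! ### The nonlinearity in physical space and in Fourier space -/

section nonlinearity

variable {a b c : Freq → ℂ}

theorem shear_apply (p : Freq × Freq) : shear p = (p.1 - p.2, p.2) := rfl

/-- The double series converges absolutely and is resummed along the shear (k, l) ↦ (k - l, l),
giving the convolution of coefficients. -/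
theorem series_mul (ha : Summable fun k => ‖a k‖) (hb : Summable fun k => ‖b k‖) (x : Plane) :
    series a x * series b x = series (fun k => ∑' l, a (k - l) * b l) x := by
  have ha' : Summable fun k => ‖a k * character k x‖ := by
    simpa only [norm_mul, norm_character, mul_one] using ha
  have hb' : Summable fun k => ‖b k * character k x‖ := by
    simpa only [norm_mul, norm_character, mul_one] using hb
  have hab := summable_mul_of_summable_norm ha' hb'
  have hs := shear.summable_iff.2 hab
  rw [series, series, tsum_mul_tsum_of_summable_norm ha' hb', ← shear.tsum_eq]
  simp only [Function.comp_def, shear_apply] at hs ⊢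
  rw [hs.tsum_prod, series]
  refine tsum_congr fun k => ?_
  rw [← tsum_mul_right]
  refine tsum_congr fun l => ?_
  have : character k x = character (k - l) x * character l x := by
    rw [← character_add, sub_add_cancel]
  rw [this]
  ring

theorem abs_freqNorm_mul_ipmSymbol_le {α : ℝ} (hα : α ≤ 1) (j : Fin 2) (k : Freq) :
    |freqNorm k ^ α * ipmSymbol j k| ≤ freqNorm k := by
  by_cases hk : k = 0
  · simp [hk, ipmSymbol]
  have h1 := freqNorm_rpow_le_self hα hk
  have hp : 0 < freqNorm k := by linarith [one_le_freqNorm hk]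
  have h2 : |ipmSymbol j k| ≤ 1 := by
    have h3 : |(k 0 : ℝ)| * |(k 0 : ℝ)| ≤ freqNorm k ^ 2 := by
      rw [sq]
      exact mul_le_mul (abs_coord_le_freqNorm k 0) (abs_coord_le_freqNorm k 0) (abs_nonneg _) hp.le
    have h4 : |(k 0 : ℝ)| * |(k 1 : ℝ)| ≤ freqNorm k ^ 2 := by
      rw [sq]
      exact mul_le_mul (abs_coord_le_freqNorm k 0) (abs_coord_le_freqNorm k 1) (abs_nonneg _) hp.le
    rw [ipmSymbol, if_neg hk, ← freqNorm_sq, abs_div, abs_of_pos (by positivity : 0 < freqNorm k ^ 2),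
      div_le_one (by positivity)]
    fin_cases j
    · simpa [abs_mul] using h4
    · simpa [abs_mul, sq] using h3
  rw [abs_mul, abs_of_nonneg (Real.rpow_nonneg hp.le α)]
  calc _ ≤ freqNorm k * 1 := mul_le_mul h1 h2 (abs_nonneg _) hp.le
    _ = _ := mul_one _

/-- Links the pointwise equation with the coefficient system: the minus sign and the factor i of the
gradient are exactly those built into `Bil`. -/
theorem nonlinearity_eq_series {α : ℝ} (hα : α ≤ 1) {f : Plane → ℝ}
    (hf : ∀ x, (f x : ℂ) = series c x) (hc : Rapid fun k => ‖c k‖) (hsym : IsSymm c) (x : Plane) :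
    -∑ j : Fin 2, velocity α f j x * (partialDeriv j f x : ℂ) = series (Bil α c c) x := by
  set u : Fin 2 → Freq → ℂ := fun j k => ((freqNorm k ^ α * ipmSymbol j k : ℝ) : ℂ) * c k with hu
  have hv : ∀ j, velocity α f j x = series (u j) x := fun j => by
    rw [velocity, fourierMultiplier, fourierCoef_eq hf hc.summable]; rfl
  have ru : ∀ j, Summable fun k => ‖u j k‖ := fun j =>
    (hc.mul_left fun k => norm_nonneg _).summable.of_nonneg_of_le (fun k => norm_nonneg _)
      fun k => by
        rw [hu, norm_mul, Complex.norm_real, Real.norm_eq_abs]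
        exact mul_le_mul_of_nonneg_right (abs_freqNorm_mul_ipmSymbol_le hα j k) (norm_nonneg _)
  have rd : ∀ j, Summable fun k => ‖derivCoef j c k‖ := fun j => (rapid_derivCoef hc j).summable
  have st : ∀ j k, Summable fun l => u j (k - l) * derivCoef j c l := fun j k =>
    Summable.of_norm_bounded (summable_conv_term (ru j) (rd j) (fun _ => norm_nonneg _)
      (fun _ => norm_nonneg _) k) fun l => (norm_mul _ _).le
  have sc : ∀ j, Summable fun k => ‖∑' l, u j (k - l) * derivCoef j c l‖ := fun j =>
    (summable_conv (ru j) (rd j) (fun _ => norm_nonneg _) (fun _ => norm_nonneg _)).of_nonneg_of_le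
      (fun k => norm_nonneg _) fun k => tsum_of_norm_bounded (summable_conv_term (ru j) (rd j)
        (fun _ => norm_nonneg _) (fun _ => norm_nonneg _) k).hasSum fun l => (norm_mul _ _).le
  simp only [hv, partialDeriv_eq_series hf hc hsym, Fin.sum_univ_two]
  rw [series_mul (ru 0) (rd 0), series_mul (ru 1) (rd 1), series, series,
    ← (summable_series (sc 0) x).tsum_add (summable_series (sc 1) x), ← tsum_neg]
  refine tsum_congr fun k => ?_
  rw [← add_mul, ← neg_mul, ← (st 0 k).tsum_add (st 1 k), ← tsum_neg, Bil]
  congr 1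
  refine tsum_congr fun l => ?_
  simp only [hu, derivCoef, kern]
  push_cast
  ring

end nonlinearity

/-! ### Gevrey norms -/

theorem gevrey_term_eq (r s τ : ℝ) (z : ℂ) (k : Freq) :
    freqNorm k ^ (2 * r) * Real.exp (2 * τ * freqNorm k ^ (1 / s)) * ‖z‖ ^ 2 =
      (gevW r τ (1 / s) (freqNorm k) * ‖z‖) ^ 2 := by
  rw [gevW, expW, mul_pow, mul_pow, ← Real.rpow_natCast (freqNorm k ^ r),
    ← Real.rpow_mul (freqNorm_nonneg k), ← Real.exp_nat_mul]
  congr 3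
  · push_cast; ring
  · push_cast; ring

/-- Trades the extended-real norm for finite partial sums, the form that survives pointwise limits.
Including k = 0 is harmless because its weight 0^r vanishes. -/
theorem gevreyNorm_le_iff {r s τ M : ℝ} (hr : 0 < r) (hM : 0 ≤ M) (f : Plane → ℝ) :
    gevreyNorm r s τ f ≤ ENNReal.ofReal M ↔
      ∀ S : Finset Freq, ∑ k ∈ S, (gevW r τ (1 / s) (freqNorm k) * ‖fourierCoef f k‖) ^ 2 ≤
        M ^ 2 := by
  set t : Freq → ℝ := fun k => (gevW r τ (1 / s) (freqNorm k) * ‖fourierCoef f k‖) ^ 2 with ht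
  have h0 : t 0 = 0 := by simp [ht, gevW, Real.zero_rpow hr.ne']
  have e : gevreyNorm r s τ f = (∑' k, ENNReal.ofReal (t k)) ^ (1 / 2 : ℝ) := by
    rw [gevreyNorm]
    congr 1
    simp only [gevrey_term_eq]
    refine tsum_subtype_eq_of_support_subset (s := {k : Freq | k ≠ 0})
      (f := fun k => ENNReal.ofReal (t k)) fun k hk h => hk ?_
    change ENNReal.ofReal (t k) = 0
    rw [h, h0, ENNReal.ofReal_zero]
  rw [e, one_div, ENNReal.rpow_inv_le_iff two_pos, ENNReal.ofReal_rpow_of_nonneg hM zero_le_two,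
    Real.rpow_two]
  constructor
  · intro h S
    have h1 := (ENNReal.sum_le_tsum S).trans h
    rw [← ENNReal.ofReal_sum_of_nonneg fun k _ => sq_nonneg _] at h1
    exact (ENNReal.ofReal_le_ofReal_iff (sq_nonneg _)).1 h1
  · intro h
    refine ENNReal.summable.tsum_le_of_sum_le fun S => ?_
    rw [← ENNReal.ofReal_sum_of_nonneg fun k _ => sq_nonneg _]
    exact ENNReal.ofReal_le_ofReal (h S)

theorem MemGevrey.fourierCoef_zero {r s τ : ℝ} {f : Plane → ℝ} (hf : MemGevrey r s τ f) :
    fourierCoef f 0 = 0 := by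
  have h := hf.mean_zero
  simp only [fourierCoef, neg_zero, character_zero, mul_one]
  rw [integral_complex_ofReal, h, Complex.ofReal_zero, mul_zero]

theorem MemGevrey.norm_fourierCoef_le {r s τ M : ℝ} (hr : 0 < r) (hM : 0 ≤ M) {f : Plane → ℝ}
    (hf : MemGevrey r s τ f) (h : gevreyNorm r s τ f ≤ ENNReal.ofReal M) (k : Freq) :
    ‖fourierCoef f k‖ ≤ M * Real.exp (-τ * freqNorm k ^ (1 / s)) := by
  by_cases hk : k = 0
  · rw [hk, hf.fourierCoef_zero, norm_zero]; positivity
  · refine norm_le_of_gevW_le hr.le hM hk ?_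
    simpa using (gevreyNorm_le_iff hr hM f).1 h {k}

theorem MemGevrey.eq_series {r s τ : ℝ} {f : Plane → ℝ}
    (hf : MemGevrey r s τ f) (hs : Summable fun k => ‖fourierCoef f k‖) (x : Plane) :
    (f x : ℂ) = series (fourierCoef f) x :=
  (series_fourierCoef hf.smooth.continuous hf.periodic hs x).symm

theorem memGevrey_of_series {r s τ M : ℝ} (hr : 0 < r) (hM : 0 ≤ M) {f : Plane → ℝ}
    {c : Freq → ℂ} (hf : ∀ x, (f x : ℂ) = series c x) (hc : Rapid fun k => ‖c k‖) (h0 : c 0 = 0)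
    (hb : ∀ S : Finset Freq, ∑ k ∈ S, (gevW r τ (1 / s) (freqNorm k) * ‖c k‖) ^ 2 ≤ M ^ 2) :
    MemGevrey r s τ f ∧ gevreyNorm r s τ f ≤ ENNReal.ofReal M := by
  have hcoef := fourierCoef_eq hf hc.summable
  have hn : gevreyNorm r s τ f ≤ ENNReal.ofReal M := by
    rw [gevreyNorm_le_iff hr hM, hcoef]; exact hb
  have hre : f = fun x => (series c x).re := funext fun x => by rw [← hf x, Complex.ofReal_re]
  refine ⟨⟨?_, fun j x => ?_, ?_, hn.trans_lt ENNReal.ofReal_lt_top⟩, hn⟩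
  · rw [hre]
    exact Complex.reCLM.contDiff.comp (contDiff_series hc)
  · rw [hre]
    simp only [series_add_single]
  · have h1 : fourierCoef f 0 = 0 := by rw [hcoef, h0]
    simp only [fourierCoef, neg_zero, character_zero, mul_one] at h1
    rw [integral_complex_ofReal, mul_eq_zero] at h1
    rcases h1 with h1 | h1
    · exact absurd (Complex.ofReal_eq_zero.1 h1) (by positivity)
    · exact Complex.ofReal_eq_zero.1 h1

end SIPM
end

noncomputable section

namespace SIPM

open ComplexConjugate MeasureTheory

/-! ### Uniqueness -/

/-- `a` solves the system for the Fourier coefficients on `[t₀, t₁]` and is dominated by `β`. -/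
structure IsCoeffSolution (α : ℝ) (β : Freq → ℝ) (t₀ t₁ : ℝ) (a : ℝ → Freq → ℂ) : Prop where
  symm : ∀ t ∈ Set.Icc t₀ t₁, IsSymm (a t)
  zero : ∀ t ∈ Set.Icc t₀ t₁, a t 0 = 0
  bound : ∀ t ∈ Set.Icc t₀ t₁, ∀ k, ‖a t k‖ ≤ β k
  cont : ∀ k, ContinuousOn (fun t => a t k) (Set.Icc t₀ t₁)
  deriv : ∀ t ∈ Set.Ioo t₀ t₁, ∀ k, HasDerivAt (fun t => a t k) (Bil α (a t) (a t) k) t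

theorem IsCoeffSolution.mono {α : ℝ} {β : Freq → ℝ} {t₀ t₁ s₀ s₁ : ℝ} {a : ℝ → Freq → ℂ}
    (h : IsCoeffSolution α β t₀ t₁ a) (h₀ : t₀ ≤ s₀) (h₁ : s₁ ≤ t₁) :
    IsCoeffSolution α β s₀ s₁ a where
  symm t ht := h.symm t (Set.Icc_subset_Icc h₀ h₁ ht)
  zero t ht := h.zero t (Set.Icc_subset_Icc h₀ h₁ ht)
  bound t ht := h.bound t (Set.Icc_subset_Icc h₀ h₁ ht)
  cont k := (h.cont k).mono (Set.Icc_subset_Icc h₀ h₁)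
  deriv t ht := h.deriv t (Set.Ioo_subset_Ioo h₀ h₁ ht)

theorem hasDerivAt_expW_sq (τ lam σ x t : ℝ) :
    HasDerivAt (fun t => expW (τ - lam * t) σ x ^ 2)
      (-(2 * lam * x ^ σ) * expW (τ - lam * t) σ x ^ 2) t := by
  simpa [gevW] using hasDerivAt_gevW_sq 0 τ lam σ x t

/-- Uniqueness on short intervals, whose length depends only on the Gevrey bounds. -/
theorem exists_uniqueness_step {α σ τ M : ℝ} (hα1 : α ≤ 1) (hασ : α ≤ σ) (hσ0 : 0 < σ)
    (hσ : σ ≤ 1) (hτ : 0 < τ) (hM : 0 ≤ M) :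
    ∃ h : ℝ, 0 < h ∧ ∀ (t₀ t₁ : ℝ) (a b : ℝ → Freq → ℂ), t₀ ≤ t₁ → t₁ ≤ t₀ + h →
      IsCoeffSolution α (fun k => M * Real.exp (-τ * freqNorm k ^ σ)) t₀ t₁ a →
      IsCoeffSolution α (fun k => M * Real.exp (-τ * freqNorm k ^ σ)) t₀ t₁ b →
      a t₀ = b t₀ → a t₁ = b t₁ := by
  set β : Freq → ℝ := fun k => 2 * M * Real.exp (-τ * freqNorm k ^ σ) with hβ
  have hβ0 : ∀ k, 0 ≤ β k := fun k => by positivity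
  have rβ : Rapid β := (rapid_exp hτ hσ0).const_mul _
  -- The squared weight with radius at most τ/4 costs e^(τ/2 |k|^σ) against a decay e^(-τ|k|^σ),
  -- leaving a rapidly decreasing majorant. The factor 2M in β also covers the difference of the
  -- solutions.
  set ρ : Freq → ℝ := fun k => expW (τ / 4) σ (freqNorm k) ^ 2 * β k with hρ
  have hρ0 : ∀ k, 0 ≤ ρ k := fun k => mul_nonneg (sq_nonneg _) (hβ0 k)
  have rρ : Rapid ρ := by
    have e : ρ = fun k => 2 * M * Real.exp (-(τ / 2) * freqNorm k ^ σ) := by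
      ext k
      simp only [hρ, hβ, expW]
      rw [← Real.exp_nat_mul, mul_left_comm, ← Real.exp_add]
      congr 2
      push_cast
      ring
    rw [e]
    exact (rapid_exp (by positivity) hσ0).const_mul _
  set X : ℝ := ∑' k, freqNorm k ^ 2 * ρ k with hX
  have sX : Summable fun k => freqNorm k ^ 2 * ρ k := (rρ.pow_mul hρ0 2).summable
  have hX0 : 0 ≤ X := tsum_nonneg fun k => mul_nonneg (sq_nonneg _) (hρ0 k)
  -- Chosen to dominate δ·X + 2X, the constant in `difference_energy_le` when δ ≤ τ/4; X bounds the
  -- ℓ¹ norms of both solutions.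
  set lam : ℝ := τ / 4 * X + 2 * X + 1 with hlam
  have hlam0 : 0 < lam := by positivity
  refine ⟨τ / 4 / lam, by positivity, fun t₀ t₁ a b h01 hh ha hb hab => ?_⟩
  have hhl : lam * (t₁ - t₀) ≤ τ / 4 := by
    have : t₁ - t₀ ≤ τ / 4 / lam := by linarith
    rw [le_div_iff₀ hlam0] at this
    linarith
  -- The radius starts at τ/4 at time t₀ and, by the choice of step length, stays nonnegative up to
  -- t₁.
  set δ : ℝ → ℝ := fun t => (τ / 4 + lam * t₀) - lam * t with hδ
  have hδ0 : ∀ t ∈ Set.Icc t₀ t₁, 0 ≤ δ t := fun t ht => by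
    have := mul_le_mul_of_nonneg_left ht.2 hlam0.le
    simp only [hδ]; linarith
  have hδ1 : ∀ t ∈ Set.Icc t₀ t₁, δ t ≤ τ / 4 := fun t ht => by
    have := mul_le_mul_of_nonneg_left ht.1 hlam0.le
    simp only [hδ]; linarith
  set v : ℝ → Freq → ℝ := fun t k => expW (δ t) σ (freqNorm k) with hv
  have hv0 : ∀ t k, 0 < v t k := fun t k => expW_pos _ _ _
  have hv1 : ∀ t ∈ Set.Icc t₀ t₁, ∀ k, 1 ≤ v t k := fun t ht k =>
    one_le_expW (hδ0 t ht) (freqNorm_nonneg k)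
  have hvle : ∀ t ∈ Set.Icc t₀ t₁, ∀ k, v t k ^ 2 ≤ expW (τ / 4) σ (freqNorm k) ^ 2 :=
    fun t ht k => pow_le_pow_left₀ (hv0 t k).le (expW_mono_left (hδ1 t ht) (freqNorm_nonneg k)) 2
  set d : ℝ → Freq → ℂ := fun t k => a t k - b t k with hd
  have hM2 : ∀ k, M * Real.exp (-τ * freqNorm k ^ σ) ≤ β k := fun k => by
    simp only [hβ]
    have : 0 ≤ M * Real.exp (-τ * freqNorm k ^ σ) := by positivity
    linarith
  have ba : ∀ t ∈ Set.Icc t₀ t₁, ∀ k, ‖a t k‖ ≤ β k := fun t ht k => (ha.bound t ht k).trans (hM2 k)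
  have bb : ∀ t ∈ Set.Icc t₀ t₁, ∀ k, ‖b t k‖ ≤ β k := fun t ht k => (hb.bound t ht k).trans (hM2 k)
  have bd : ∀ t ∈ Set.Icc t₀ t₁, ∀ k, ‖d t k‖ ≤ β k := fun t ht k => by
    refine (norm_sub_le _ _).trans ((add_le_add (ha.bound t ht k) (hb.bound t ht k)).trans ?_)
    simp only [hβ]; linarith
  have hvρ : ∀ t ∈ Set.Icc t₀ t₁, ∀ {z : ℂ} {k : Freq}, ‖z‖ ≤ β k → v t k ^ 2 * ‖z‖ ≤ ρ k :=
    fun t ht z k hz => mul_le_mul (hvle t ht k) hz (norm_nonneg _) (sq_nonneg _)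
  have hvρ1 : ∀ t ∈ Set.Icc t₀ t₁, ∀ {z : ℂ} {k : Freq}, ‖z‖ ≤ β k → v t k * ‖z‖ ≤ ρ k :=
    fun t ht z k hz => le_trans (mul_le_mul_of_nonneg_right (by
      have := hv1 t ht k; nlinarith) (norm_nonneg _)) (hvρ t ht hz)
  have hd0 : ∀ t ∈ Set.Icc t₀ t₁, d t 0 = 0 := fun t ht => by
    simp only [hd, ha.zero t ht, hb.zero t ht, sub_zero]
  have hβM : ∀ k, β k ≤ 2 * M := fun k => by
    have : Real.exp (-τ * freqNorm k ^ σ) ≤ 1 := by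
      rw [Real.exp_le_one_iff]
      have := Real.rpow_nonneg (freqNorm_nonneg k) σ
      nlinarith
    exact mul_le_of_le_one_right (by positivity) this
  have nβ : ∀ k, 0 ≤ freqNorm k * β k := fun k => mul_nonneg (freqNorm_nonneg k) (hβ0 k)
  have sb : Summable (conv (fun k => freqNorm k * β k) (fun k => freqNorm k * β k)) :=
    ((rβ.mul_left hβ0).conv (rβ.mul_left hβ0) nβ nβ).summable
  set B : ℝ := ∑' k, conv (fun k => freqNorm k * β k) (fun k => freqNorm k * β k) k with hB
  have hBil : ∀ {f g : Freq → ℂ}, (∀ k, ‖f k‖ ≤ β k) → (∀ k, ‖g k‖ ≤ β k) → ∀ k,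
      ‖Bil α f g k‖ ≤ B := fun hf hg k =>
    (norm_bil_le hα1 rβ rβ hf hg k).trans (sb.le_tsum k fun l _ => conv_nonneg nβ nβ l)
  have sQ : ∀ t ∈ Set.Icc t₀ t₁, ∀ {f g : Freq → ℂ}, (∀ k, ‖f k‖ ≤ β k) → (∀ k, ‖g k‖ ≤ β k) →
      Summable fun k => v t k ^ 2 * (conj (d t k) * Bil α f g k).re := fun t ht f g hf hg => by
    refine Summable.of_norm_bounded (rρ.summable.mul_right B) fun k => ?_
    rw [norm_mul, Real.norm_of_nonneg (sq_nonneg _)]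
    calc _ ≤ v t k ^ 2 * (‖d t k‖ * ‖Bil α f g k‖) := by
          refine mul_le_mul_of_nonneg_left ?_ (sq_nonneg _)
          refine (Complex.abs_re_le_norm _).trans (le_of_eq ?_)
          rw [norm_mul, RCLike.norm_conj]
      _ = (v t k ^ 2 * ‖d t k‖) * ‖Bil α f g k‖ := by ring
      _ ≤ ρ k * B := mul_le_mul (hvρ t ht (bd t ht k)) (hBil hf hg k) (norm_nonneg _) (hρ0 k)
  set E : ℝ → ℝ := fun t => ∑' k, v t k ^ 2 * ‖d t k‖ ^ 2 with hE
  set e' : Freq → ℝ → ℝ := fun k t => -(2 * lam * freqNorm k ^ σ) * v t k ^ 2 * ‖d t k‖ ^ 2 +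
    v t k ^ 2 * (2 * (conj (d t k) * (Bil α (a t) (a t) k - Bil α (b t) (b t) k)).re) with he'
  have hEterm : ∀ t ∈ Set.Icc t₀ t₁, ∀ k, ‖v t k ^ 2 * ‖d t k‖ ^ 2‖ ≤ ρ k * (2 * M) :=
    fun t ht k => by
      rw [Real.norm_of_nonneg (by positivity)]
      calc v t k ^ 2 * ‖d t k‖ ^ 2 = (v t k ^ 2 * ‖d t k‖) * ‖d t k‖ := by ring
        _ ≤ ρ k * (2 * M) := mul_le_mul (hvρ t ht (bd t ht k)) ((bd t ht k).trans (hβM k))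
            (norm_nonneg _) (hρ0 k)
  have sE : ∀ t ∈ Set.Icc t₀ t₁, Summable fun k => v t k ^ 2 * ‖d t k‖ ^ 2 := fun t ht =>
    Summable.of_norm_bounded (rρ.summable.mul_right (2 * M)) (hEterm t ht)
  have hY : ∀ t ∈ Set.Icc t₀ t₁, ∀ k, freqNorm k ^ σ * (v t k ^ 2 * ‖d t k‖ ^ 2) ≤
      freqNorm k * (ρ k * (2 * M)) := fun t ht k => by
    by_cases hk : k = 0
    · subst hk; simp [hd0 t ht]
    · have h1 := (Real.le_norm_self _).trans (hEterm t ht k)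
      exact mul_le_mul (freqNorm_rpow_le_self hσ hk) h1 (by positivity) (freqNorm_nonneg k)
  have sN : Summable fun k => freqNorm k * (ρ k * (2 * M)) :=
    ((rρ.mul_left hρ0).summable.mul_right (2 * M)).congr fun k => by ring
  have sY : ∀ t ∈ Set.Icc t₀ t₁, Summable fun k => freqNorm k ^ σ * (v t k ^ 2 * ‖d t k‖ ^ 2) :=
    fun t ht => sN.of_nonneg_of_le (fun k => by
      have := Real.rpow_nonneg (freqNorm_nonneg k) σ; positivity) (hY t ht)
  have he'b : ∀ k, ∀ t ∈ Set.Ioo t₀ t₁, ‖e' k t‖ ≤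
      2 * lam * (freqNorm k * (ρ k * (2 * M))) + 2 * (ρ k * (2 * B)) := by
    intro k t ht'
    have ht := Set.Ioo_subset_Icc_self ht'
    refine (norm_add_le _ _).trans (add_le_add ?_ ?_)
    · rw [neg_mul, neg_mul, norm_neg, Real.norm_of_nonneg (by
        have := Real.rpow_nonneg (freqNorm_nonneg k) σ; positivity)]
      calc _ = 2 * lam * (freqNorm k ^ σ * (v t k ^ 2 * ‖d t k‖ ^ 2)) := by ring
        _ ≤ _ := mul_le_mul_of_nonneg_left (hY t ht k) (by positivity)
    · rw [norm_mul, Real.norm_of_nonneg (sq_nonneg _), norm_mul, Real.norm_of_nonneg zero_le_two]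
      have h1 : ‖Bil α (a t) (a t) k - Bil α (b t) (b t) k‖ ≤ 2 * B :=
        (norm_sub_le _ _).trans (by
          linarith [hBil (ba t ht) (ba t ht) k, hBil (bb t ht) (bb t ht) k])
      calc _ ≤ v t k ^ 2 * (2 * (‖d t k‖ * ‖Bil α (a t) (a t) k - Bil α (b t) (b t) k‖)) := by
            refine mul_le_mul_of_nonneg_left (mul_le_mul_of_nonneg_left ?_ zero_le_two)
              (sq_nonneg _)
            refine (Complex.abs_re_le_norm _).trans (le_of_eq ?_)
            rw [norm_mul, RCLike.norm_conj]
        _ = 2 * ((v t k ^ 2 * ‖d t k‖) * ‖Bil α (a t) (a t) k - Bil α (b t) (b t) k‖) := by ring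
        _ ≤ 2 * (ρ k * (2 * B)) := mul_le_mul_of_nonneg_left
            (mul_le_mul (hvρ t ht (bd t ht k)) h1 (norm_nonneg _) (hρ0 k)) zero_le_two
  -- Termwise differentiation of the energy is legitimate because the derivatives have a summable
  -- majorant independent of t.
  have hder : ∀ t ∈ Set.Ioo t₀ t₁, HasDerivAt E (∑' k, e' k t) t := by
    intro t ht
    refine hasDerivAt_tsum_of_isPreconnected (t := Set.Ioo t₀ t₁) (y₀ := t)
      ((sN.mul_left (2 * lam)).add ((rρ.summable.mul_right (2 * B)).mul_left 2)) isOpen_Ioo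
      isPreconnected_Ioo (fun k y hy => ?_) he'b ht (sE t (Set.Ioo_subset_Icc_self ht)) ht
    have h1 := hasDerivWithinAt_norm_sq (s := Set.univ)
      ((ha.deriv y hy k).sub (hb.deriv y hy k)).hasDerivWithinAt
    exact (hasDerivAt_expW_sq (τ / 4 + lam * t₀) lam σ (freqNorm k) y).mul
      (hasDerivWithinAt_univ.1 h1)
  have hcont : ContinuousOn E (Set.Icc t₀ t₁) := by
    refine continuousOn_tsum (fun k => ?_) (rρ.summable.mul_right (2 * M))
      fun k t ht => hEterm t ht k
    refine ContinuousOn.mul ?_ (((ha.cont k).sub (hb.cont k)).norm.pow 2)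
    exact fun t _ => (hasDerivAt_expW_sq (τ / 4 + lam * t₀) lam σ (freqNorm k)
      t).continuousAt.continuousWithinAt
  have hneg : ∀ t ∈ Set.Ioo t₀ t₁, ∑' k, e' k t ≤ 0 := by
    intro t ht'
    have ht := Set.Ioo_subset_Icc_self ht'
    set Z : ℝ := ∑' k, freqNorm k ^ σ * (v t k ^ 2 * ‖d t k‖ ^ 2) with hZ
    have hZ0 : 0 ≤ Z := tsum_nonneg fun k => by
      have := Real.rpow_nonneg (freqNorm_nonneg k) σ; positivity
    have s1 := sQ t ht (bb t ht) (bd t ht)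
    have s2 := sQ t ht (bd t ht) (ba t ht)
    have e1 : ∑' k, e' k t = -(2 * lam) * Z +
        2 * (∑' k, v t k ^ 2 * (conj (d t k) * Bil α (b t) (d t) k).re +
          ∑' k, v t k ^ 2 * (conj (d t k) * Bil α (d t) (a t) k).re) := by
      rw [hZ, ← s1.tsum_add s2, ← tsum_mul_left, ← tsum_mul_left,
        ← ((sY t ht).mul_left _).tsum_add ((s1.add s2).mul_left 2)]
      refine tsum_congr fun k => ?_
      simp only [he']
      rw [bil_sub_bil hα1 rβ (ba t ht) (bb t ht), mul_add (conj (d t k)), Complex.add_re]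
      ring
    have rv : ∀ {f : Freq → ℂ}, (∀ k, ‖f k‖ ≤ β k) → Rapid fun k => v t k * ‖f k‖ := fun hf =>
      rρ.of_le (fun k => mul_nonneg (hv0 t k).le (norm_nonneg _)) fun k => hvρ1 t ht (hf k)
    have hXle : ∀ {f : Freq → ℂ}, (∀ k, ‖f k‖ ≤ β k) →
        ∑' k, freqNorm k ^ 2 * (v t k * ‖f k‖) ≤ X := fun {f} hf =>
      (((rv hf).pow_mul (fun k => mul_nonneg (hv0 t k).le (norm_nonneg _)) 2).summable).tsum_le_tsum
        (fun k => mul_le_mul_of_nonneg_left (hvρ1 t ht (hf k)) (sq_nonneg _)) sX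
    have key := difference_energy_le (a := b t) (b := a t) (d := d t) hα1 hασ hσ0.le hσ (hδ0 t ht)
      (hb.symm t ht) (hd0 t ht) (ha.zero t ht) (rv (bb t ht)) (rv (ba t ht))
      (rρ.of_le (fun k => mul_nonneg (sq_nonneg _) (norm_nonneg _)) fun k => hvρ t ht (bd t ht k))
    have e2 : ∑' k, (freqNorm k ^ (σ / 2) * (v t k * ‖d t k‖)) ^ 2 = Z := by
      refine tsum_congr fun k => ?_
      rw [mul_pow, sq_freqNorm_rpow_half, mul_pow]
    rw [e2] at key
    have h1 : δ t * (∑' k, freqNorm k ^ 2 * (v t k * ‖b t k‖)) +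
        2 * ∑' k, freqNorm k ^ 2 * (v t k * ‖a t k‖) ≤ lam := by
      have h2 := hXle (ba t ht)
      have h3 : δ t * (∑' k, freqNorm k ^ 2 * (v t k * ‖b t k‖)) ≤ τ / 4 * X :=
        mul_le_mul (hδ1 t ht) (hXle (bb t ht)) (tsum_nonneg fun k => mul_nonneg (sq_nonneg _)
          (mul_nonneg (hv0 t k).le (norm_nonneg _))) (by positivity)
      rw [hlam]; linarith
    have h2 := key.trans (mul_le_mul_of_nonneg_right h1 hZ0)
    rw [e1]
    linarith
  have hanti : AntitoneOn E (Set.Icc t₀ t₁) := by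
    refine antitoneOn_of_deriv_nonpos (convex_Icc _ _) hcont ?_ ?_ <;> rw [interior_Icc]
    · exact fun t ht => (hder t ht).differentiableAt.differentiableWithinAt
    · intro t ht
      rw [(hder t ht).deriv]
      exact hneg t ht
  have hl : t₀ ∈ Set.Icc t₀ t₁ := ⟨le_rfl, h01⟩
  have hr : t₁ ∈ Set.Icc t₀ t₁ := ⟨h01, le_rfl⟩
  have hE1 : E t₁ ≤ 0 := by
    refine (hanti hl hr h01).trans (le_of_eq ?_)
    simp [hE, hd, hab]
  ext k
  have h1 : v t₁ k ^ 2 * ‖d t₁ k‖ ^ 2 ≤ 0 :=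
    ((sE t₁ hr).le_tsum k fun l _ => by positivity).trans hE1
  have h2 : ‖d t₁ k‖ ^ 2 ≤ 0 := nonpos_of_mul_nonpos_right h1 (pow_pos (hv0 t₁ k) 2)
  have h3 : d t₁ k = 0 := norm_eq_zero.1 (pow_eq_zero_iff two_ne_zero |>.1
    (le_antisymm h2 (sq_nonneg _)))
  exact sub_eq_zero.1 h3

/-- Solutions with common Gevrey bounds are determined by their initial values. -/
theorem IsCoeffSolution.eq {α σ τ M T : ℝ} (hα1 : α ≤ 1) (hασ : α ≤ σ) (hσ0 : 0 < σ)
    (hσ : σ ≤ 1) (hτ : 0 < τ) (hM : 0 ≤ M) {a b : ℝ → Freq → ℂ}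
    (ha : IsCoeffSolution α (fun k => M * Real.exp (-τ * freqNorm k ^ σ)) 0 T a)
    (hb : IsCoeffSolution α (fun k => M * Real.exp (-τ * freqNorm k ^ σ)) 0 T b)
    (hab : a 0 = b 0) {t : ℝ} (ht : t ∈ Set.Icc 0 T) : a t = b t := by
  obtain ⟨h, hh, step⟩ := exists_uniqueness_step (M := M) hα1 hασ hσ0 hσ hτ hM
  -- The step length h does not depend on the starting time, so intervals of length h can be
  -- chained.
  have key : ∀ n : ℕ, ∀ t ∈ Set.Icc 0 T, t ≤ n * h → a t = b t := by
    intro n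
    induction n with
    | zero =>
      intro t ht hn
      have : t = 0 := le_antisymm (by simpa using hn) ht.1
      rw [this, hab]
    | succ n ih =>
      intro t ht hn
      rcases le_total t (n * h) with hle | hle
      · exact ih t ht hle
      · have h0 : 0 ≤ n * h := by positivity
        refine step (n * h) t a b hle ?_ (ha.mono h0 ht.2) (hb.mono h0 ht.2)
          (ih _ ⟨h0, hle.trans ht.2⟩ le_rfl)
        push_cast at hn
        linarith
  obtain ⟨n, hn⟩ := exists_nat_ge (t / h)
  exact key n t ht ((div_le_iff₀ hh).1 hn)

end SIPM
end

/-! ### Passing between solutions on the torus and coefficient systems -/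

noncomputable section

namespace SIPM

open ComplexConjugate MeasureTheory

/-- The Fourier coefficients of a Gevrey solution solve the system for the coefficients. -/
theorem IsGevreySolution.isCoeffSolution {r s α T T' τ M : ℝ} {θ₀ : Plane → ℝ}
    {θ : ℝ → Plane → ℝ} (hr : 0 < r) (hs : 0 < s) (hα1 : α ≤ 1) (hθ : IsGevreySolution r s α T θ₀ θ)
    (hT' : T' < T) (hτ : 0 < τ) (hM : 0 ≤ M)
    (hb : ∀ t ∈ Set.Icc (0 : ℝ) T',
      MemGevrey r s τ (θ t) ∧ gevreyNorm r s τ (θ t) ≤ ENNReal.ofReal M) :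
    IsCoeffSolution α (fun k => M * Real.exp (-τ * freqNorm k ^ (1 / s))) 0 T'
      fun t => fourierCoef (θ t) := by
  set β : Freq → ℝ := fun k => M * Real.exp (-τ * freqNorm k ^ (1 / s)) with hβ
  have hβ0 : ∀ k, 0 ≤ β k := fun k => by positivity
  have rβ : Rapid β := (rapid_exp hτ (by positivity)).const_mul _
  have bnd : ∀ t ∈ Set.Icc (0 : ℝ) T', ∀ k, ‖fourierCoef (θ t) k‖ ≤ β k := fun t ht =>
    (hb t ht).1.norm_fourierCoef_le hr hM (hb t ht).2
  have rc : ∀ t ∈ Set.Icc (0 : ℝ) T', Rapid fun k => ‖fourierCoef (θ t) k‖ := fun t ht =>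
    rβ.of_le (fun k => norm_nonneg _) (bnd t ht)
  have hser : ∀ t ∈ Set.Icc (0 : ℝ) T', ∀ x, (θ t x : ℂ) = series (fourierCoef (θ t)) x :=
    fun t ht => (hb t ht).1.eq_series (rc t ht).summable
  have nβ : ∀ k, 0 ≤ freqNorm k * β k := fun k => mul_nonneg (freqNorm_nonneg k) (hβ0 k)
  set b₁ : Freq → ℝ := conv (fun k => freqNorm k * β k) (fun k => freqNorm k * β k) with hb₁
  have sb₁ : Summable b₁ := ((rβ.mul_left hβ0).conv (rβ.mul_left hβ0) nβ nβ).summable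
  have hBil : ∀ t ∈ Set.Icc (0 : ℝ) T', ∀ k,
      ‖Bil α (fourierCoef (θ t)) (fourierCoef (θ t)) k‖ ≤ b₁ k := fun t ht =>
    norm_bil_le hα1 rβ rβ (bnd t ht) (bnd t ht)
  have sBil : ∀ t ∈ Set.Icc (0 : ℝ) T',
      Summable fun k => ‖Bil α (fourierCoef (θ t)) (fourierCoef (θ t)) k‖ := fun t ht =>
    sb₁.of_nonneg_of_le (fun k => norm_nonneg _) (hBil t ht)
  have hder : ∀ t ∈ Set.Icc (0 : ℝ) T', ∀ x,
      HasDerivWithinAt (fun t' : ℝ => (θ t' x : ℂ))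
        (series (Bil α (fourierCoef (θ t)) (fourierCoef (θ t))) x) (Set.Ico 0 T) t := fun t ht x => by
    have := hθ.equation t ⟨ht.1, ht.2.trans_lt hT'⟩ x
    rwa [nonlinearity_eq_series hα1 (hser t ht) (rc t ht) (isSymm_fourierCoef _)] at this
  have hmeas : ∀ t ∈ Set.Icc (0 : ℝ) T', ∀ k, AEStronglyMeasurable
      (fun x => (θ t x : ℂ) * character (-k) x) (volume.restrict cell) := fun t ht k =>
    ((Complex.continuous_ofReal.comp (hb t ht).1.smooth.continuous).mul
      (continuous_character _)).aestronglyMeasurable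
  have hcell : IsFiniteMeasure (volume.restrict cell) :=
    ⟨by rw [Measure.restrict_apply_univ]; exact isCompact_Icc.measure_lt_top⟩
  refine ⟨fun t _ => isSymm_fourierCoef _, fun t ht => (hb t ht).1.fourierCoef_zero, bnd,
    fun k => ?_, fun t ht => ?_⟩
  · refine continuousOn_const.mul ?_
    refine continuousOn_of_dominated (bound := fun _ => ∑' k, β k) (fun t ht => hmeas t ht k)
      (fun t ht => ae_of_all _ fun x => ?_) (integrable_const _) (ae_of_all _ fun x => ?_)
    · rw [norm_mul, norm_character, mul_one, hser t ht]
      exact (norm_series_le (rc t ht).summable x).trans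
        ((rc t ht).summable.tsum_le_tsum (bnd t ht) rβ.summable)
    · exact ContinuousOn.mul (fun t ht => (hder t ht x).continuousWithinAt.mono
        fun u hu => ⟨hu.1, hu.2.trans_lt hT'⟩) continuousOn_const
  · intro k
    have ht' := Set.Ioo_subset_Icc_self ht
    -- Differentiation under the integral over the cell; the time derivative is bounded in x and t
    -- by the sum of the majorant b₁ of the nonlinearity's coefficients.
    have h := (hasDerivAt_integral_of_dominated_loc_of_deriv_le (μ := volume.restrict cell)
      (F := fun t x => (θ t x : ℂ) * character (-k) x)
      (F' := fun t x => series (Bil α (fourierCoef (θ t)) (fourierCoef (θ t))) x *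
        character (-k) x) (bound := fun _ => ∑' k, b₁ k) (s := Set.Ioo 0 T') (x₀ := t)
      (isOpen_Ioo.mem_nhds ht)
      (by
        filter_upwards [isOpen_Ioo.mem_nhds ht] with u hu
        exact hmeas u (Set.Ioo_subset_Icc_self hu) k)
      (((Complex.continuous_ofReal.comp (hb t ht').1.smooth.continuous).mul
        (continuous_character _)).continuousOn.integrableOn_compact isCompact_Icc)
      (((continuous_series (sBil t ht')).mul (continuous_character _)).aestronglyMeasurable)
      (ae_of_all _ fun x u hu => by
        have hu' := Set.Ioo_subset_Icc_self hu
        rw [norm_mul, norm_character, mul_one]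
        exact (norm_series_le (sBil u hu') x).trans
          ((sBil u hu').tsum_le_tsum (hBil u hu') sb₁))
      (integrable_const _)
      (ae_of_all _ fun x u hu => by
        refine HasDerivAt.mul_const ?_ _
        exact (hder u (Set.Ioo_subset_Icc_self hu) x).hasDerivAt
          (Ico_mem_nhds hu.1 (hu.2.trans hT')))).2
    have h2 := h.const_mul ((((2 * Real.pi) ^ 2)⁻¹ : ℝ) : ℂ)
    rwa [integral_series_mul_character (sBil t ht')] at h2

/-- Both solutions are placed under one common Gevrey bound on [0, t], where their coefficients must
agree; Fourier inversion then identifies the functions. -/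
theorem IsGevreySolution.eq {r s α T : ℝ} {θ₀ : Plane → ℝ} {θ η : ℝ → Plane → ℝ} (hr : 0 < r)
    (hs : 1 ≤ s) (hα1 : α ≤ 1) (hασ : α ≤ 1 / s) (hθ : IsGevreySolution r s α T θ₀ θ)
    (hη : IsGevreySolution r s α T θ₀ η) {t : ℝ} (ht : t ∈ Set.Ico 0 T) : η t = θ t := by
  have hs0 : 0 < s := by linarith
  obtain ⟨τ₁, hτ₁, M₁, h₁⟩ := hθ.gevrey t ht.2
  obtain ⟨τ₂, hτ₂, M₂, h₂⟩ := hη.gevrey t ht.2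
  have htt : t ∈ Set.Icc 0 t := ⟨ht.1, le_rfl⟩
  have c₁ := hθ.isCoeffSolution hr hs0 hα1 ht.2 hτ₁ (le_max_right M₁ 0) fun u hu =>
    ⟨(h₁ u hu).1, (h₁ u hu).2.trans (ENNReal.ofReal_le_ofReal (le_max_left _ _))⟩
  have c₂ := hη.isCoeffSolution hr hs0 hα1 ht.2 hτ₂ (le_max_right M₂ 0) fun u hu =>
    ⟨(h₂ u hu).1, (h₂ u hu).2.trans (ENNReal.ofReal_le_ofReal (le_max_left _ _))⟩
  -- The common bound uses the smaller radius and the larger constant.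
  have weaken : ∀ {τ M : ℝ} {a : ℝ → Freq → ℂ}, min τ₁ τ₂ ≤ τ → 0 ≤ M →
      M ≤ max (max M₁ 0) (max M₂ 0) →
      IsCoeffSolution α (fun k => M * Real.exp (-τ * freqNorm k ^ (1 / s))) 0 t a →
      IsCoeffSolution α (fun k => max (max M₁ 0) (max M₂ 0) *
        Real.exp (-min τ₁ τ₂ * freqNorm k ^ (1 / s))) 0 t a := fun h1 h0 h2 ha =>
    { ha with
      bound := fun u hu k => (ha.bound u hu k).trans (by
        have := Real.rpow_nonneg (freqNorm_nonneg k) (1 / s)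
        gcongr) }
  have heq := IsCoeffSolution.eq hα1 hασ (by positivity) ((div_le_one hs0).2 hs)
    (lt_min hτ₁ hτ₂) ((le_max_right M₁ 0).trans (le_max_left _ _))
    (weaken (min_le_left _ _) (le_max_right _ _) (le_max_left _ _) c₁)
    (weaken (min_le_right _ _) (le_max_right _ _) (le_max_right _ _) c₂)
    (by simp only [hθ.initial, hη.initial]) htt
  have ser : ∀ {τ M : ℝ} {f : Plane → ℝ}, 0 < τ → MemGevrey r s τ f →
      (∀ k, ‖fourierCoef f k‖ ≤ M * Real.exp (-τ * freqNorm k ^ (1 / s))) → ∀ x,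
      (f x : ℂ) = series (fourierCoef f) x := fun hτ hf hb =>
    hf.eq_series (((rapid_exp hτ (by positivity)).const_mul _).of_le (fun _ => norm_nonneg _)
      hb).summable
  ext x
  have e₁ := ser hτ₁ (h₁ t htt).1 (c₁.bound t htt) x
  have e₂ := ser hτ₂ (h₂ t htt).1 (c₂.bound t htt) x
  rw [← heq, ← e₁] at e₂
  exact_mod_cast e₂

/-- Local existence of Gevrey solutions, on a time interval depending only on the size of the
data. -/
theorem exists_gevreySolution {r s α K τ₀ : ℝ} (hr : 3 < r) (hs : 1 ≤ s) (hα1 : α ≤ 1)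
    (hασ : α ≤ 1 / s) (hK : 0 < K) (hτ₀ : 0 < τ₀) :
    ∃ T : ℝ, 0 < T ∧ ∀ θ₀ : Plane → ℝ, MemGevrey r s τ₀ θ₀ →
      gevreyNorm r s τ₀ θ₀ ≤ ENNReal.ofReal K →
      ∃ θ : ℝ → Plane → ℝ, IsGevreySolution r s α T θ₀ θ := by
  have hs0 : 0 < s := by linarith
  have hσ0 : 0 < 1 / s := by positivity
  have hr0 : 0 < r := by linarith
  obtain ⟨T, hT, hsol⟩ := exists_coeff_solution (σ := 1 / s) hr hα1 hασ hσ0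
    ((div_le_one hs0).2 hs) hK hτ₀
  refine ⟨T, hT, fun θ₀ hθ₀ hn => ?_⟩
  obtain ⟨a, b, rb, h0, ha⟩ := hsol (fourierCoef θ₀) (isSymm_fourierCoef θ₀) hθ₀.fourierCoef_zero
    ((gevreyNorm_le_iff hr0 hK.le θ₀).1 hn)
  have rexp : ∀ {τ M : ℝ}, 0 < τ → Rapid fun k => M * Real.exp (-τ * freqNorm k ^ (1 / s)) :=
    fun hτ => (rapid_exp hτ hσ0).const_mul _
  have bnd : ∀ t ∈ Set.Icc 0 T, ∀ k,
      ‖a t k‖ ≤ 2 * K * Real.exp (-(τ₀ / 2) * freqNorm k ^ (1 / s)) := fun t ht k => by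
    obtain ⟨-, hz, hb, -⟩ := ha t ht
    by_cases hk : k = 0
    · rw [hk, hz, norm_zero]; positivity
    · refine norm_le_of_gevW_le hr0.le (by positivity) hk ?_
      simpa using hb {k}
  have ra : ∀ t ∈ Set.Icc 0 T, Rapid fun k => ‖a t k‖ := fun t ht =>
    (rexp (by positivity)).of_le (fun k => norm_nonneg _) (bnd t ht)
  have hf : ∀ t ∈ Set.Icc 0 T, ∀ x, ((series (a t) x).re : ℂ) = series (a t) x := fun t ht =>
    ofReal_re_series (ha t ht).1
  refine ⟨fun t x => (series (a t) x).re, fun T' hT' => ⟨τ₀ / 2, by positivity, 2 * K,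
    fun t ht => ?_⟩, fun t ht x => ?_, ?_⟩
  · have ht' : t ∈ Set.Icc 0 T := ⟨ht.1, ht.2.trans hT'.le⟩
    exact memGevrey_of_series hr0 (by positivity) (hf t ht') (ra t ht') (ha t ht').2.1
      (ha t ht').2.2.1
  · have ht' : t ∈ Set.Icc 0 T := ⟨ht.1, ht.2.le⟩
    rw [nonlinearity_eq_series hα1 (hf t ht') (ra t ht') (ha t ht').1]
    have sB : Summable fun k => ‖Bil α (a t) (a t) k‖ := by
      have r1 := rexp (M := 2 * K) (τ := τ₀ / 2) (by positivity)
      have n1 : ∀ k, 0 ≤ 2 * K * Real.exp (-(τ₀ / 2) * freqNorm k ^ (1 / s)) := fun k => by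
        positivity
      have n2 := fun k => mul_nonneg (freqNorm_nonneg k) (n1 k)
      exact ((r1.mul_left n1).conv (r1.mul_left n1) n2 n2).summable.of_nonneg_of_le
        (fun k => norm_nonneg _) (norm_bil_le hα1 r1 r1 (bnd t ht') (bnd t ht'))
    -- The coefficientwise Taylor bounds are summed against characters of modulus 1. The quadratic
    -- remainder yields the time derivative at every t, one-sided at 0, without interchanging
    -- derivative and sum.
    have key : ∀ u ∈ Set.Ico 0 T, ‖((series (a u) x).re : ℂ) - ((series (a t) x).re : ℂ) -
        (u - t) • series (Bil α (a t) (a t)) x‖ ≤ (∑' k, b k) * (u - t) ^ 2 := by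
      intro u hu
      have hu' : u ∈ Set.Icc 0 T := ⟨hu.1, hu.2.le⟩
      rw [hf u hu', hf t ht', Complex.real_smul, series, series, series, ← tsum_mul_left,
        ← (summable_series (ra u hu').summable x).tsum_sub
          (summable_series (ra t ht').summable x),
        ← ((summable_series (ra u hu').summable x).sub
          (summable_series (ra t ht').summable x)).tsum_sub
          ((summable_series sB x).mul_left _), ← tsum_mul_right]
      refine tsum_of_norm_bounded (rb.summable.mul_right _).hasSum fun k => ?_
      rw [← mul_assoc, ← sub_mul, ← sub_mul, norm_mul, norm_character, mul_one]
      exact (ha t ht').2.2.2 u hu' k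
    rw [hasDerivWithinAt_iff_isLittleO]
    have h1 : (fun u => (u - t) ^ 2) =o[nhdsWithin t (Set.Ico 0 T)] fun u => u - t := by
      refine (Asymptotics.IsLittleO.mono ?_ nhdsWithin_le_nhds)
      have := Asymptotics.isLittleO_pow_sub_sub t (one_lt_two)
      simpa using this
    refine Asymptotics.IsBigO.trans_isLittleO (Asymptotics.IsBigO.of_bound (∑' k, b k) ?_) h1
    filter_upwards [self_mem_nhdsWithin] with u hu
    refine (key u hu).trans (le_of_eq ?_)
    rw [Real.norm_of_nonneg (sq_nonneg _)]
  · ext x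
    have hr1 : Summable fun k => ‖fourierCoef θ₀ k‖ :=
      ((rexp hτ₀).of_le (fun _ => norm_nonneg _) (hθ₀.norm_fourierCoef_le hr0 hK.le hn)).summable
    rw [h0, ← hθ₀.eq_series hr1, Complex.ofReal_re]

end SIPM
end

theorem mainTheorem7 (r α s : ℝ) (hr : 3 < r)
    (hαs : (0 < α ∧ α ≤ 1 ∧ 1 ≤ s ∧ s ≤ 1 / α) ∨ (α = 0 ∧ 1 ≤ s)) :
    ∀ K₀ : ℝ, 0 < K₀ → ∀ τ₀ : ℝ, 0 < τ₀ → ∃ T : ℝ, 0 < T ∧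
      ∀ θ₀ : SIPM.Plane → ℝ, SIPM.MemGevrey r s τ₀ θ₀ →
        SIPM.gevreyNorm r s τ₀ θ₀ ≤ ENNReal.ofReal K₀ →
        ∃ θ : ℝ → SIPM.Plane → ℝ, SIPM.IsGevreySolution r s α T θ₀ θ ∧
          ∀ η : ℝ → SIPM.Plane → ℝ, SIPM.IsGevreySolution r s α T θ₀ η →
            ∀ t ∈ Set.Ico (0 : ℝ) T, η t = θ t := by
  intro K₀ hK₀ τ₀ hτ₀
  have hs : 1 ≤ s := by rcases hαs with h | h; exacts [h.2.2.1, h.2]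
  have hα1 : α ≤ 1 := by rcases hαs with h | h; exacts [h.2.1, h.1 ▸ zero_le_one]
  -- This is the only form in which the restriction on s enters besides s ≥ 1, and it covers α = 0
  -- as well.
  have hασ : α ≤ 1 / s := by
    rcases hαs with ⟨h1, -, -, h2⟩ | ⟨h1, -⟩
    · exact (le_div_comm₀ (by linarith) h1).1 h2
    · rw [h1]; positivity
  obtain ⟨T, hT, hex⟩ := SIPM.exists_gevreySolution hr hs hα1 hασ hK₀ hτ₀
  refine ⟨T, hT, fun θ₀ hθ₀ hn => ?_⟩
  obtain ⟨θ, hθ⟩ := hex θ₀ hθ₀ hn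
  exact ⟨θ, hθ, fun η hη t ht => SIPM.IsGevreySolution.eq (by linarith) hs hα1 hασ hθ hη ht⟩
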